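/- **Setting.** A concept class $\mathcal C$ consists, for each $d\in\mathbb N$, of a nonempty domain $X_d$ of bit strings of length at most $d$ and a set $\mathcal C_d$ of concepts $c:X_d\to\{+1,-1\}$, together with a scheme that represents concepts by bit strings; $\mathrm{size}(c)$ is the length of a shortest representation of $c$. Examples are drawn from the uniform distribution on $X_d$, and $\mathrm{err}_c(h)=\Pr_{x\in X_d}[h(x)\ne c(x)]$. Throughout, $\alpha,\beta\in(0,1/2)$ and $\varepsilon>0$. *SQ learning.* An SQ oracle for $c$ answers a query $(g,\tau)$, where $g:X_d\times\{\pm1\}\to\{\pm1\}$ and $\tau\in(0,1)$, with some $v$ such that $|v-\mathbb E_{x}[g(x,c(x))]|\le\tau$. A (randomized) SQ learner for $\mathcal C$ takes inputs $d,\alpha,\beta$ and, for every $c\in\mathcal C_d$ and every SQ oracle for $c$, asks at most $\mathrm{poly}(d,\mathrm{size}(c),1/\alpha,\log(1/\beta))$ queries, each with tolerance at least $1/\mathrm{poly}(d,\mathrm{size}(c),1/\alpha,\log(1/\beta))$, and outputs $h$ with $\Pr[\mathrm{err}_c(h)\le\alpha]\ge1-\beta$. It is *nonadaptive* if it prepares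 all its queries before it receives any answer; an *adaptive* learner is one that is not required to do so. It is *efficient* if its running time and the time to evaluate each of its queries (and its hypothesis) are polynomial in $d,1/\alpha,\log(1/\beta)$. *Local learning.* An $\varepsilon$-local randomizer on $D=X_d\times\{\pm1\}$ is a randomized map $R$ with discrete output such that $\Pr[R(u)=w]\le e^{\varepsilon}\Pr[R(u')=w]$ for all $u,u'\in D$ and all $w$. An algorithm is $\varepsilon$-local if it accesses its database $z\in D^n$ only by choosing indices $i$ and randomizers $R$ and receiving samples of $R(z_i)$, where the randomizers applied to the same entry are $\varepsilon_j$-local with $\sum_j\varepsilon_j\le\varepsilon$. A local learner for $\mathcal C$ takes inputs $d,\varepsilon,\alpha,\beta$, is $\varepsilon$-local, uses a database of $n\le\mathrm{poly}(d,1/\varepsilon,1/\alpha,\log(1/\beta))$ entries and makes at most $\mathrm{poly}(d,\mathrm{size}(c),1/\varepsilon,1/\alpha,\log(1/\beta))$ such accesses; for every $c\in\mathcal C_d$, if $z_i=(x_i,c(x_i))$ with $x_i$ i.i.d. uniform on $X_d$, it outputs $h$ with $\Pr[\mathrm{err}_c(h)\le\alpha]\ge1-\beta$. It is *noninteractive*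 if it prepares all its accesses before it receives any answer; an *interactive* learner is one that is not required to do so. It is *efficient* if its running time and the time to evaluate each of its randomizers (and its hypothesis) are polynomial in $d,\mathrm{size}(c),1/\varepsilon,1/\alpha,\log(1/\beta)$. **Statement.** Under the uniform distribution: 1. the concept classes learnable by nonadaptive SQ learners are a strict subset of the concept classes learnable by adaptive SQ learners; 2. the concept classes learnable by noninteractive local learners are a strict subset of the concept classes learnable by interactive local learners; 3. the concept classes efficiently learnable by nonadaptive SQ learners are a strict subset of the concept classes efficiently learnable by adaptive SQ learners; 4. the concept classes efficiently learnable by noninteractive local learners are a strict subset of the concept classes efficiently learnable by interactive local learners. -/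

import Mathlib

namespace PrivateLearning

/-! ### Concept classes -/

/-- A concept class: an ensemble of nonempty domains `X_d` of bit strings of length at most `d`,
together with a representation scheme. `rep d s` is the concept on `X_d` represented by the
string `s`, if there is one; labels are Booleans. -/
structure ConceptClass where
  dom : ℕ → Finset (List Bool)
  dom_nonempty : ∀ d, (dom d).Nonempty
  dom_length : ∀ d, ∀ x ∈ dom d, x.length ≤ d
  rep : (d : ℕ) → List Bool → Option (dom d → Bool)

namespace ConceptClass

/-- The examples of size parameter `d`. -/
abbrev X (C : ConceptClass) (d : ℕ) : Type := C.dom d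

instance (C : ConceptClass) (d : ℕ) : Nonempty (C.X d) := (C.dom_nonempty d).to_subtype

/-- The set `C_d` of concepts. -/
def concepts (C : ConceptClass) (d : ℕ) : Set (C.X d → Bool) := {c | ∃ s, C.rep d s = some c}

/-- The length of a shortest representation of a concept. -/
noncomputable def size (C : ConceptClass) (d : ℕ) (c : C.X d → Bool) : ℕ :=
  sInf {l | ∃ s, C.rep d s = some c ∧ s.length = l}

end ConceptClass

/-- Misclassification error of `h` with respect to `c` under the uniform distribution. -/
noncomputable def err {X : Type} [Fintype X] (c h : X → Bool) : ℝ :=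
  ((Finset.univ.filter fun x => h x ≠ c x).card : ℝ) / Fintype.card X

/-- The bound `a * (1 + x) ^ k`. A quantity is bounded by a polynomial in nonnegative variables
`x₁, …, x_j` if and only if it is at most `polyBound a k (x₁ + ⋯ + x_j)` for some `a`, `k`. -/
noncomputable def polyBound (a k : ℕ) (x : ℝ) : ℝ := a * (1 + x) ^ k

/-- The admissible values of the accuracy and confidence parameters. -/
def Admissible (α β : ℝ) : Prop := α ∈ Set.Ioo (0 : ℝ) (1 / 2) ∧ β ∈ Set.Ioo (0 : ℝ) (1 / 2)

/-! ### Randomized algorithms with an oracle -/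

/-- A randomized algorithm without computational restrictions that puts queries of type `Q` to an
oracle, receives answers of type `A` and outputs an element of `H`. It either stops, or makes a
random choice from a discrete distribution, or asks a query and continues with the answer. -/
inductive Alg (Q A H : Type) : Type 1
  | output (h : H) : Alg Q A H
  | sample {ι : Type} (p : PMF ι) (k : ι → Alg Q A H) : Alg Q A H
  | query (q : Q) (k : A → Alg Q A H) : Alg Q A H

namespace Alg

variable {Q A H H' : Type}

/-- Post-processing of the output. -/
noncomputable def mapOutput (f : H → H') : Alg Q A H → Alg Q A H'
  | output h => output (f h)
  | sample p k => sample p fun i => (k i).mapOutput f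
  | query q k => query q fun a => (k a).mapOutput f

/-- Whenever the answer to each query `q` lies in `reach q`, the algorithm asks at most `t`
queries, and all of them satisfy `ok`. -/
def QueriesWithin (reach : Q → Set A) (ok : Q → Prop) : Alg Q A H → ℕ → Prop
  | output _, _ => True
  | sample p k, t => ∀ i ∈ p.support, (k i).QueriesWithin reach ok t
  | query _ _, 0 => False
  | query q k, t + 1 => ok q ∧ ∀ a ∈ reach q, (k a).QueriesWithin reach ok t

/-- The algorithm asks exactly the queries in the given list, in this order, whatever the answers
are, and makes random choices only after it has received all the answers. Only answers to `q` in
`reach q` are considered. -/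
inductive AsksList (reach : Q → Set A) : List Q → Alg Q A H → Prop
  | output (h : H) : AsksList reach [] (output h)
  | sample {ι : Type} (p : PMF ι) (k : ι → Alg Q A H)
      (hk : ∀ i ∈ p.support, AsksList reach [] (k i)) : AsksList reach [] (sample p k)
  | query (q : Q) (qs : List Q) (k : A → Alg Q A H)
      (hk : ∀ a ∈ reach q, AsksList reach qs (k a)) : AsksList reach (q :: qs) (query q k)

/-- The algorithm prepares all its queries before it receives any answer: after its initial random
choices the list of its queries is fixed. -/
inductive Nonadaptive (reach : Q → Set A) : Alg Q A H → Prop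
  | ask (qs : List Q) (P : Alg Q A H) (hP : AsksList reach qs P) : Nonadaptive reach P
  | sample {ι : Type} (p : PMF ι) (k : ι → Alg Q A H)
      (hk : ∀ i ∈ p.support, Nonadaptive reach (k i)) : Nonadaptive reach (sample p k)

end Alg

/-! ### Statistical queries -/

/-- A statistical query on labelled examples: a `±1`-valued function, with `true` standing for `+1`
and `false` for `-1`, and a tolerance in `(0, 1)`. -/
structure SQQuery (X : Type) where
  g : X → Bool → Bool
  τ : ℝ
  τ_pos : 0 < τ
  τ_lt_one : τ < 1

/-- The expectation of `g (x, c x)` for uniformly distributed `x`. -/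
noncomputable def SQQuery.expect {X : Type} [Fintype X] (q : SQQuery X) (c : X → Bool) : ℝ :=
  (∑ x, if q.g x (c x) then (1 : ℝ) else -1) / Fintype.card X

/-- The answers that an SQ oracle for target `c` may give. -/
def SQQuery.valid {X : Type} [Fintype X] (c : X → Bool) (q : SQQuery X) : Set ℝ :=
  {v | |v - q.expect c| ≤ q.τ}

/-- An oracle for statistical queries. Its answer may depend on the earlier queries, so it need not
answer the same query in the same way each time. -/
abbrev SQOracle (X : Type) := List (SQQuery X) → SQQuery X → ℝ

/-- `O` is an SQ oracle for target `c` and the uniform distribution. -/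
def SQOracle.IsFor {X : Type} [Fintype X] (O : SQOracle X) (c : X → Bool) : Prop :=
  ∀ past q, O past q ∈ SQQuery.valid c q

/-- The distribution of the output of an SQ algorithm; `past` lists the earlier queries, the latest
one first. -/
noncomputable def Alg.runSQ {X H : Type} (O : SQOracle X) :
    Alg (SQQuery X) ℝ H → List (SQQuery X) → PMF H
  | .output h, _ => PMF.pure h
  | .sample p k, past => p.bind fun i => (k i).runSQ O past
  | .query q k, past => (k (O past q)).runSQ O (q :: past)

/-- A family of SQ algorithms, one for each choice of the inputs `d`, `α`, `β`. -/
abbrev SQFamily (C : ConceptClass) :=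
  (d : ℕ) → ℝ → ℝ → Alg (SQQuery (C.X d)) ℝ (C.X d → Bool)

/-- `A` learns `C` under the uniform distribution with polynomially many statistical queries, all
of inverse polynomial tolerance, whichever SQ oracle for the target it is given. -/
def SQFamily.Learns {C : ConceptClass} (A : SQFamily C) : Prop :=
  ∃ a k : ℕ, ∀ (d : ℕ) (α β : ℝ), Admissible α β → ∀ c ∈ C.concepts d,
    (A d α β).QueriesWithin (SQQuery.valid c)
      (fun q => 1 / polyBound a k (d + C.size d c + 1 / α + Real.logb 2 (1 / β)) ≤ q.τ)
      ⌊polyBound a k (d + C.size d c + 1 / α + Real.logb 2 (1 / β))⌋₊ ∧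
    ∀ O : SQOracle (C.X d), O.IsFor c →
      ENNReal.ofReal (1 - β) ≤ ((A d α β).runSQ O []).toOuterMeasure {h | err c h ≤ α}

/-- All algorithms of the family are nonadaptive, with respect to the answers that can occur for
targets in the class. -/
def SQFamily.IsNonadaptive {C : ConceptClass} (A : SQFamily C) : Prop :=
  ∀ (d : ℕ) (α β : ℝ), Admissible α β →
    (A d α β).Nonadaptive fun q => {v | ∃ c ∈ C.concepts d, v ∈ q.valid c}

/-! ### Local algorithms -/

/-- A randomizer: to an entry of the database it assigns a discrete distribution on messages. -/
abbrev Randomizer (D : Type) := D → PMF (List Bool)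

/-- `R` is an `ε`-local randomizer. -/
def IsLocalRandomizer {D : Type} (ε : ℝ) (R : Randomizer D) : Prop :=
  ∀ u u' w, R u w ≤ ENNReal.ofReal (Real.exp ε) * R u' w

/-- A query to the oracle `LR_z`, where `z` has `n` entries: an index and a randomizer. -/
abbrev LRQuery (D : Type) (n : ℕ) := Fin n × Randomizer D

/-- The answers to a query to `LR_z` that can occur for some database `z`. -/
def LRQuery.reach {D : Type} {n : ℕ} (q : LRQuery D n) : Set (List Bool) :=
  {w | ∃ u, w ∈ (q.2 u).support}

/-- Along every run, the randomizers applied to entry `i` are `ε_j`-local with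
`∑ j, ε_j ≤ budget i`. -/
def Alg.LocalWithin {D H : Type} {n : ℕ} :
    Alg (LRQuery D n) (List Bool) H → (Fin n → ℝ) → Prop
  | .output _, _ => True
  | .sample p k, budget => ∀ i ∈ p.support, (k i).LocalWithin budget
  | .query q k, budget => ∃ e : ℝ, IsLocalRandomizer e q.2 ∧ e ≤ budget q.1 ∧
      ∀ w ∈ LRQuery.reach q,
        (k w).LocalWithin (Function.update budget q.1 (budget q.1 - e))

/-- An `ε`-local algorithm. -/
def Alg.IsLocal {D H : Type} {n : ℕ} (ε : ℝ) (P : Alg (LRQuery D n) (List Bool) H) : Prop :=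
  P.LocalWithin fun _ => ε

/-- The distribution of the output of a local algorithm on the database `z`. -/
noncomputable def Alg.runLR {D H : Type} {n : ℕ} (z : Fin n → D) :
    Alg (LRQuery D n) (List Bool) H → PMF H
  | .output h => PMF.pure h
  | .sample p k => p.bind fun i => (k i).runLR z
  | .query q k => (q.2 (z q.1)).bind fun w => (k w).runLR z

/-- A family of algorithms with access to `LR_z`, one for each choice of the inputs `d`, `ε`, `α`,
`β`, together with the size `n` of the database. -/
structure LocalFamily (C : ConceptClass) where
  n : ℕ → ℝ → ℝ → ℝ → ℕ
  alg : (d : ℕ) → (ε α β : ℝ) →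
    Alg (LRQuery (C.X d × Bool) (n d ε α β)) (List Bool) (C.X d → Bool)

/-- `A` is a local learner for `C` under the uniform distribution. Drawing `n` independent uniform
examples is the same as drawing a uniform element of `X_d ^ n`. -/
def LocalFamily.Learns {C : ConceptClass} (A : LocalFamily C) : Prop :=
  ∃ a k : ℕ, ∀ (d : ℕ) (ε α β : ℝ), 0 < ε → Admissible α β →
    (A.n d ε α β : ℝ) ≤ polyBound a k (d + 1 / ε + 1 / α + Real.logb 2 (1 / β)) ∧
    (A.alg d ε α β).IsLocal ε ∧
    ∀ c ∈ C.concepts d,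
      (A.alg d ε α β).QueriesWithin LRQuery.reach (fun _ => True)
        ⌊polyBound a k (d + C.size d c + 1 / ε + 1 / α + Real.logb 2 (1 / β))⌋₊ ∧
      ENNReal.ofReal (1 - β) ≤
        ((PMF.uniformOfFintype (Fin (A.n d ε α β) → C.X d)).bind fun x =>
          (A.alg d ε α β).runLR fun i => (x i, c (x i))).toOuterMeasure {h | err c h ≤ α}

/-- All algorithms of the family are noninteractive. -/
def LocalFamily.IsNoninteractive {C : ConceptClass} (A : LocalFamily C) : Prop :=
  ∀ (d : ℕ) (ε α β : ℝ), 0 < ε → Admissible α β →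
    (A.alg d ε α β).Nonadaptive LRQuery.reach

/-! ### Machines

Programs work on registers that hold bit strings and are used as stacks, as a multitape Turing
machine uses its tapes. Every elementary step costs one unit of time. -/

/-- Programs. `flip r` pushes a fair coin onto register `r`; `call` puts the question in registers
`0` and `1` to the oracle and stores the answer in register `2`; `test r c₀ c₁ c₂` branches to
`c₀` if register `r` is empty, to `c₁` if its top bit is `false` and to `c₂` if its top bit is
`true`; `loop r c` repeats `c` as long as register `r` is not empty. -/
inductive Cmd
  | skip
  | push (r : ℕ) (b : Bool)
  | pop (r : ℕ)
  | flip (r : ℕ)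
  | call
  | seq (c c' : Cmd)
  | test (r : ℕ) (c₀ c₁ c₂ : Cmd)
  | loop (r : ℕ) (c : Cmd)

/-- The contents of the registers; the top of a stack is the head of the list. -/
abbrev Store := ℕ → List Bool

/-- A configuration: the commands that are still to be executed, and the store. -/
abbrev Cfg := List Cmd × Store

/-- What happens in one step. -/
inductive Step
  | next (c : Cfg)
  | coin (k : Bool → Cfg)
  | ask (q r : List Bool) (k : List Bool → Cfg)

/-- Execution of one elementary step of the command `c`, to be followed by `K`. -/
def Cmd.step (c : Cmd) (K : List Cmd) (s : Store) : Step :=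
  match c with
  | skip => .next (K, s)
  | push r b => .next (K, Function.update s r (b :: s r))
  | pop r => .next (K, Function.update s r (s r).tail)
  | flip r => .coin fun b => (K, Function.update s r (b :: s r))
  | call => .ask (s 0) (s 1) fun w => (K, Function.update s 2 w)
  | seq c c' => .next (c :: c' :: K, s)
  | test r c₀ c₁ c₂ =>
      match s r with
      | [] => .next (c₀ :: K, s)
      | false :: _ => .next (c₁ :: K, s)
      | true :: _ => .next (c₂ :: K, s)
  | loop r c =>
      match s r with
      | [] => .next (K, s)
      | _ :: _ => .next (c :: loop r c :: K, s)

/-- The configuration in which `M` starts on the given inputs, held in registers `0, 1, 2, …`. -/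
def Cmd.init (M : Cmd) (inputs : List (List Bool)) : Cfg := ([M], fun r => inputs.getD r [])

/-- Deterministic computation for at most `T` steps. The output is the final content of register
`0`; there is none if the time does not suffice, a coin is flipped or the oracle is called. -/
def exec : ℕ → Cfg → Option (List Bool)
  | _, ([], s) => some (s 0)
  | 0, (_ :: _, _) => none
  | T + 1, (c :: K, s) =>
      match c.step K s with
      | .next c' => exec T c'
      | .coin _ => none
      | .ask _ _ _ => none

/-- Randomized computation for at most `T` steps: the distribution of the output. -/
noncomputable def execRandom : ℕ → Cfg → PMF (Option (List Bool))
  | _, ([], s) => PMF.pure (some (s 0))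
  | 0, (_ :: _, _) => PMF.pure none
  | T + 1, (c :: K, s) =>
      match c.step K s with
      | .next c' => execRandom T c'
      | .coin k => (PMF.uniformOfFintype Bool).bind fun b => execRandom T (k b)
      | .ask _ _ _ => PMF.pure none

/-- Randomized computation with an oracle for at most `T` steps, as an algorithm that asks pairs of
strings, is answered by strings, and outputs `none` if the time does not suffice. -/
noncomputable def execOracle :
    ℕ → Cfg → Alg (List Bool × List Bool) (List Bool) (Option (List Bool))
  | _, ([], s) => .output (some (s 0))
  | 0, (_ :: _, _) => .output none
  | T + 1, (c :: K, s) =>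
      match c.step K s with
      | .next c' => execOracle T c'
      | .coin k => .sample (PMF.uniformOfFintype Bool) fun b => execOracle T (k b)
      | .ask q r k => .query (q, r) fun w => execOracle T (k w)

/-- The number `n` in unary. -/
def unary (n : ℕ) : List Bool := List.replicate n true

/-- Whether an output string stands for `true`. -/
def accepts (o : Option (List Bool)) : Bool := o.getD [] |>.headD false

open Classical in
/-- The hypothesis on `X` that the string `s` describes when `E` is used to evaluate hypotheses;
`none` if `E` does not evaluate it in time `T` at every example. -/
noncomputable def decodeHyp (E : Cmd) (T : ℕ) (X : Finset (List Bool)) (s : List Bool) :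
    Option (X → Bool) :=
  if ∀ x : X, exec T (E.init [s, x]) ≠ none then
    some fun x => accepts (exec T (E.init [s, x]))
  else none

/-- The message for a machine that carries the answer `v` to a query of tolerance `τ`: the number
`v + 2`, which is positive, rounded down to a multiple of `τ`, as a multiple of `τ` in unary. -/
noncomputable def encodeAnswer (τ v : ℝ) : List Bool := unary ⌊(v + 2) / τ⌋₊

open Classical in
/-- The SQ algorithm on `X` that a computation performs. The machine asks the statistical query with
tolerance `1 / (l + 2)`, where `l` is the length of register `1`, whose function is described by
register `0`. The program `G` evaluates this function on a description, an example and a label, and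
`E` evaluates hypotheses. The outcome is `none` if an evaluation needs more than `T` steps. -/
noncomputable def toSQ (G E : Cmd) (T : ℕ) (X : Finset (List Bool)) :
    Alg (List Bool × List Bool) (List Bool) (Option (List Bool)) →
      Alg (SQQuery X) ℝ (Option (X → Bool))
  | .output o => .output (o.bind (decodeHyp E T X))
  | .sample p k => .sample p fun i => toSQ G E T X (k i)
  | .query q k =>
      if ∀ (x : X) (y : Bool), exec T (G.init [q.1, x, [y]]) ≠ none then
        .query
          { g := fun x y => accepts (exec T (G.init [q.1, x, [y]]))
            τ := 1 / ((q.2.length : ℝ) + 2)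
            τ_pos := by positivity
            τ_lt_one := by
              rw [div_lt_one (by positivity)]
              have : (0 : ℝ) ≤ q.2.length := Nat.cast_nonneg _
              linarith }
          fun v => toSQ G E T X (k (encodeAnswer (1 / ((q.2.length : ℝ) + 2)) v))
      else .output none

open Classical in
/-- The algorithm with access to `LR_z`, for databases with `n` entries in `X × Bool`, that a
computation performs. The machine asks for the entry whose index is the length of register `1`, and
register `0` describes the randomizer. The program `R` evaluates randomizers on a description, an
example and a label, and `E` evaluates hypotheses. The outcome is `none` if the index is out of range
or an evaluation may need more than `T` steps. -/
noncomputable def toLocal (R E : Cmd) (T n : ℕ) (X : Finset (List Bool)) :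
    Alg (List Bool × List Bool) (List Bool) (Option (List Bool)) →
      Alg (LRQuery (X × Bool) n) (List Bool) (Option (X → Bool))
  | .output o => .output (o.bind (decodeHyp E T X))
  | .sample p k => .sample p fun i => toLocal R E T n X (k i)
  | .query q k =>
      if h : q.2.length < n ∧ ∀ u : X × Bool,
          none ∉ (execRandom T (R.init [q.1, u.1, [u.2]])).support then
        .query
          (⟨q.2.length, h.1⟩,
            fun u => (execRandom T (R.init [q.1, u.1, [u.2]])).map fun o => o.getD [])
          fun w => toLocal R E T n X (k w)
      else .output none

/-- The family of SQ algorithms that the program `M` performs with running time `T`. Its inputs are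
`d`, `⌈1/α⌉` and `⌈log₂ (1/β)⌉` in unary. -/
noncomputable def machineSQ (C : ConceptClass) (M G E : Cmd) (T : ℕ → ℝ → ℝ → ℕ)
    (d : ℕ) (α β : ℝ) : Alg (SQQuery (C.X d)) ℝ (Option (C.X d → Bool)) :=
  toSQ G E (T d α β) (C.dom d)
    (execOracle (T d α β)
      (M.init [unary d, unary ⌈1 / α⌉₊, unary ⌈Real.logb 2 (1 / β)⌉₊]))

/-- The SQ learner `A` is efficient: it is implemented by a program, and the running time of this
program and the times to evaluate its queries and its hypotheses are bounded by a polynomial in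
`d`, `1/α` and `log (1/β)`. -/
def SQFamily.IsEfficient {C : ConceptClass} (A : SQFamily C) : Prop :=
  ∃ (M G E : Cmd) (T : ℕ → ℝ → ℝ → ℕ) (a k : ℕ), ∀ (d : ℕ) (α β : ℝ), Admissible α β →
    (T d α β : ℝ) ≤ polyBound a k (d + 1 / α + Real.logb 2 (1 / β)) ∧
    (∀ c ∈ C.concepts d, ∀ O : SQOracle (C.X d), O.IsFor c →
      none ∉ ((machineSQ C M G E T d α β).runSQ O []).support) ∧
    A d α β = (machineSQ C M G E T d α β).mapOutput fun o => o.getD fun _ => false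

/-- The family of algorithms with access to `LR_z` that the program `M` performs with running time
`T`. Its inputs are `d`, `⌈1/ε⌉`, `⌈1/α⌉` and `⌈log₂ (1/β)⌉` in unary. -/
noncomputable def machineLocal (C : ConceptClass) (M R E : Cmd) (T n : ℕ → ℝ → ℝ → ℝ → ℕ)
    (d : ℕ) (ε α β : ℝ) :
    Alg (LRQuery (C.X d × Bool) (n d ε α β)) (List Bool) (Option (C.X d → Bool)) :=
  toLocal R E (T d ε α β) (n d ε α β) (C.dom d)
    (execOracle (T d ε α β)
      (M.init [unary d, unary ⌈1 / ε⌉₊, unary ⌈1 / α⌉₊, unary ⌈Real.logb 2 (1 / β)⌉₊]))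

/-- The local learner `A` is efficient: it is implemented by a program, and the running time of this
program and the times to evaluate its randomizers and its hypotheses are bounded by a polynomial in
`d`, the size of the target, `1/ε`, `1/α` and `log (1/β)`. -/
def LocalFamily.IsEfficient {C : ConceptClass} (A : LocalFamily C) : Prop :=
  ∃ (M R E : Cmd) (T : ℕ → ℝ → ℝ → ℝ → ℕ) (a k : ℕ),
    ∀ (d : ℕ) (ε α β : ℝ), 0 < ε → Admissible α β →
      (∀ c ∈ C.concepts d, (T d ε α β : ℝ) ≤
        polyBound a k (d + C.size d c + 1 / ε + 1 / α + Real.logb 2 (1 / β))) ∧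
      (∀ z, none ∉ ((machineLocal C M R E T A.n d ε α β).runLR z).support) ∧
      A.alg d ε α β =
        (machineLocal C M R E T A.n d ε α β).mapOutput fun o => o.getD fun _ => false

/-! ### Classes of learnable concept classes, under the uniform distribution -/

/-- Concept classes learnable by SQ learners, which may be adaptive. -/
def AdaptiveSQ : Set ConceptClass := {C | ∃ A : SQFamily C, A.Learns}

/-- Concept classes learnable by nonadaptive SQ learners. -/
def NonadaptiveSQ : Set ConceptClass := {C | ∃ A : SQFamily C, A.Learns ∧ A.IsNonadaptive}

/-- Concept classes learnable by local learners, which may be interactive. -/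
def InteractiveLocal : Set ConceptClass := {C | ∃ A : LocalFamily C, A.Learns}

/-- Concept classes learnable by noninteractive local learners. -/
def NoninteractiveLocal : Set ConceptClass :=
  {C | ∃ A : LocalFamily C, A.Learns ∧ A.IsNoninteractive}

/-- Concept classes efficiently learnable by SQ learners, which may be adaptive. -/
def EffAdaptiveSQ : Set ConceptClass := {C | ∃ A : SQFamily C, A.Learns ∧ A.IsEfficient}

/-- Concept classes efficiently learnable by nonadaptive SQ learners. -/
def EffNonadaptiveSQ : Set ConceptClass :=
  {C | ∃ A : SQFamily C, A.Learns ∧ A.IsNonadaptive ∧ A.IsEfficient}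

/-- Concept classes efficiently learnable by local learners, which may be interactive. -/
def EffInteractiveLocal : Set ConceptClass := {C | ∃ A : LocalFamily C, A.Learns ∧ A.IsEfficient}

/-- Concept classes efficiently learnable by noninteractive local learners. -/
def EffNoninteractiveLocal : Set ConceptClass :=
  {C | ∃ A : LocalFamily C, A.Learns ∧ A.IsNoninteractive ∧ A.IsEfficient}

end PrivateLearning

namespace PrivateLearning

/-! ### Execution of programs -/

/-- The second configuration is reached from the first one in at most `B` steps, without coins and
oracle calls. -/
inductive Reach : ℕ → Cfg → Cfg → Prop
  | refl (B : ℕ) (x : Cfg) : Reach B x x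
  | step {B : ℕ} {c : Cmd} {K : List Cmd} {s : Store} {x y : Cfg} (h : c.step K s = .next x)
      (h' : Reach B x y) : Reach (B + 1) (c :: K, s) y

theorem Reach.mono {B B' : ℕ} {x y : Cfg} (h : Reach B x y) (hB : B ≤ B') : Reach B' x y := by
  induction h generalizing B' with
  | refl => exact .refl _ _
  | step h _ ih =>
    obtain ⟨m, rfl⟩ : ∃ m, B' = m + 1 := ⟨B' - 1, by omega⟩
    exact .step h (ih (by omega))

theorem Reach.trans {B B' : ℕ} {x y z : Cfg} (h : Reach B x y) (h' : Reach B' y z) :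
    Reach (B + B') x z := by
  induction h with
  | refl => exact h'.mono (by omega)
  | step h _ ih => exact (Reach.step h (ih h')).mono (by omega)

/-- A property of timed configurations passes back along `Reach` if it does so along single
steps. -/
theorem Reach.back {α : Type*} {F : ℕ → Cfg → α}
    (hF : ∀ T c K s x, Cmd.step c K s = .next x → F (T + 1) (c :: K, s) = F T x)
    {B : ℕ} {x y : Cfg} (h : Reach B x y) (T : ℕ) : ∃ T', T ≤ T' ∧ F (T + B) x = F T' y := by
  induction h with
  | refl B x => exact ⟨T + B, by omega, rfl⟩
  | step h _ ih =>
    obtain ⟨T', h1, h2⟩ := ih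
    exact ⟨T', h1, by rw [← add_assoc, hF _ _ _ _ _ h, h2]⟩

theorem exec_next (T : ℕ) (c : Cmd) (K : List Cmd) (s : Store) (x : Cfg)
    (h : c.step K s = .next x) : exec (T + 1) (c :: K, s) = exec T x := by
  simp [exec, h]

theorem execRandom_next (T : ℕ) (c : Cmd) (K : List Cmd) (s : Store) (x : Cfg)
    (h : c.step K s = .next x) : execRandom (T + 1) (c :: K, s) = execRandom T x := by
  simp [execRandom, h]

theorem execOracle_next (T : ℕ) (c : Cmd) (K : List Cmd) (s : Store) (x : Cfg)
    (h : c.step K s = .next x) : execOracle (T + 1) (c :: K, s) = execOracle T x := by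
  simp [execOracle, h]

theorem exec_nil (T : ℕ) (s : Store) : exec T ([], s) = some (s 0) := by
  cases T <;> simp [exec]

theorem execRandom_nil (T : ℕ) (s : Store) : execRandom T ([], s) = PMF.pure (some (s 0)) := by
  cases T <;> simp [execRandom]

theorem execOracle_nil (T : ℕ) (s : Store) : execOracle T ([], s) = .output (some (s 0)) := by
  cases T <;> simp [execOracle]

/-- The command `c` leads from the store `s` to the store `s'` in at most `B` steps. -/
def Runs (c : Cmd) (s s' : Store) (B : ℕ) : Prop := ∀ K, Reach B (c :: K, s) (K, s')

theorem Runs.mono {c : Cmd} {s s' : Store} {B B' : ℕ} (h : Runs c s s' B) (hB : B ≤ B') :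
    Runs c s s' B' := fun K => (h K).mono hB

theorem Runs.of_eq {c : Cmd} {s s' s'' : Store} {B : ℕ} (h : Runs c s s' B) (hs : s' = s'') :
    Runs c s s'' B := hs ▸ h

theorem Runs.seq {c c' : Cmd} {s s' s'' : Store} {B B' : ℕ} (h : Runs c s s' B)
    (h' : Runs c' s' s'' B') : Runs (.seq c c') s s'' (B + B' + 1) :=
  fun K => .step rfl ((h (c' :: K)).trans (h' K))

theorem Runs.loop_nil {r : ℕ} {c : Cmd} {s : Store} (h : s r = []) : Runs (.loop r c) s s 1 :=
  fun K => .step (x := (K, s)) (by simp [Cmd.step, h]) (.refl 0 _)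

theorem Runs.loop_cons {r : ℕ} {c : Cmd} {s s' s'' : Store} {B B' : ℕ} (h : s r ≠ [])
    (h1 : Runs c s s' B) (h2 : Runs (.loop r c) s' s'' B') :
    Runs (.loop r c) s s'' (B + B' + 1) := by
  intro K
  obtain ⟨b, l, hl⟩ := List.exists_cons_of_ne_nil h
  exact .step (x := (c :: Cmd.loop r c :: K, s)) (by simp [Cmd.step, hl]) ((h1 _).trans (h2 K))

/-- Commands without loops, coins and oracle calls. -/
def Cmd.Straight : Cmd → Prop
  | .skip => True
  | .push _ _ => True
  | .pop _ => True
  | .flip _ => False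
  | .call => False
  | .seq c c' => c.Straight ∧ c'.Straight
  | .test _ c₀ c₁ c₂ => c₀.Straight ∧ c₁.Straight ∧ c₂.Straight
  | .loop _ _ => False

/-- The effect of a straight command. -/
def Cmd.eval : Cmd → Store → Store
  | .push r b, s => Function.update s r (b :: s r)
  | .pop r, s => Function.update s r (s r).tail
  | .seq c c', s => c'.eval (c.eval s)
  | .test r c₀ c₁ c₂, s =>
      match s r with
      | [] => c₀.eval s
      | false :: _ => c₁.eval s
      | true :: _ => c₂.eval s
  | _, s => s

/-- A bound on the running time of a straight command. -/
def Cmd.cost : Cmd → ℕ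
  | .seq c c' => c.cost + c'.cost + 1
  | .test _ c₀ c₁ c₂ => c₀.cost + c₁.cost + c₂.cost + 1
  | _ => 1

theorem Cmd.Straight.runs {c : Cmd} (h : c.Straight) (s : Store) : Runs c s (c.eval s) c.cost := by
  induction c generalizing s with
  | skip => exact fun K => .step rfl (.refl _ _)
  | push r b => exact fun K => .step rfl (.refl _ _)
  | pop r => exact fun K => .step rfl (.refl _ _)
  | flip r => exact h.elim
  | call => exact h.elim
  | seq c c' ih ih' => exact (ih h.1 s).seq (ih' h.2 _)
  | test r c₀ c₁ c₂ ih0 ih1 ih2 =>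
    intro K
    rcases hs : s r with _ | ⟨_ | _, l⟩
    · refine .step (x := (c₀ :: K, s)) (by simp [Cmd.step, hs]) ?_
      simpa [Cmd.eval, hs] using (ih0 h.1 s K).mono (by omega)
    · refine .step (x := (c₁ :: K, s)) (by simp [Cmd.step, hs]) ?_
      simpa [Cmd.eval, hs] using (ih1 h.2.1 s K).mono (by omega)
    · refine .step (x := (c₂ :: K, s)) (by simp [Cmd.step, hs]) ?_
      simpa [Cmd.eval, hs] using (ih2 h.2.2 s K).mono (by omega)
  | loop r c => exact h.elim

theorem Cmd.Straight.runs_of_eq {c : Cmd} (h : c.Straight) {s s' : Store} (hs : c.eval s = s') :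
    Runs c s s' c.cost := hs ▸ h.runs s

/-- The store with the given contents of the first registers. -/
def st (l : List (List Bool)) : Store := fun r => l.getD r []

theorem st_apply (l : List (List Bool)) (r : ℕ) : st l r = l.getD r [] := rfl

theorem update_st (l : List (List Bool)) (r : ℕ) (v : List Bool) (h : r < l.length) :
    Function.update (st l) r v = st (l.set r v) := by
  funext i
  by_cases hi : i = r
  · subst hi; simp [st, h]
  · rw [Function.update_of_ne hi]
    simp [st, Ne.symm hi]

theorem init_eq (M : Cmd) (l : List (List Bool)) (m : ℕ) :
    M.init l = ([M], st (l ++ List.replicate m [])) := by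
  simp only [Cmd.init, Prod.mk.injEq, true_and]
  funext r
  simp only [st, List.getD_eq_getElem?_getD, List.getElem?_append, List.getElem?_replicate]
  split_ifs with h1 h2 <;> simp_all

/-! ### Elementary programs -/

/-- Empty the register `r`. -/
def clear (r : ℕ) : Cmd := .loop r (.pop r)

theorem runs_clear (r : ℕ) (s : Store) :
    Runs (clear r) s (Function.update s r []) (2 * (s r).length + 1) := by
  generalize hl : s r = l
  induction l generalizing s with
  | nil =>
    rw [← hl, Function.update_eq_self]
    exact (Runs.loop_nil hl).mono (by simp)
  | cons b l ih =>
    have h1 : Runs (.pop r) s (Function.update s r l) 1 :=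
      Cmd.Straight.runs_of_eq (c := .pop r) trivial (by simp [Cmd.eval, hl])
    have h2 := ih (Function.update s r l) (by simp)
    rw [Function.update_idem] at h2
    exact (Runs.loop_cons (by simp [hl]) h1 h2).mono (by simp; omega)

/-- Move the register `a` to `b`, in reverse order. -/
def moveRev (a b : ℕ) : Cmd :=
  .loop a (.test a .skip (.seq (.pop a) (.push b false)) (.seq (.pop a) (.push b true)))

theorem runs_moveRev {a b : ℕ} (hab : a ≠ b) (s : Store) :
    Runs (moveRev a b) s (Function.update (Function.update s a []) b ((s a).reverse ++ s b))
      (9 * (s a).length + 1) := by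
  generalize hl : s a = l
  induction l generalizing s with
  | nil =>
    refine ((Runs.loop_nil hl).mono (by simp)).of_eq ?_
    funext i
    simp only [Function.update_apply]
    split_ifs <;> simp_all
  | cons v l ih =>
    have h1 : Runs (.test a .skip (.seq (.pop a) (.push b false)) (.seq (.pop a) (.push b true)))
        s (Function.update (Function.update s a l) b (v :: s b)) 8 := by
      refine (Cmd.Straight.runs_of_eq ?_ ?_).mono (by simp [Cmd.cost])
      · simp [Cmd.Straight]
      · cases v <;> simp [Cmd.eval, hl, hab.symm]
    have h2 := ih (Function.update (Function.update s a l) b (v :: s b)) (by simp [hab])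
    refine ((Runs.loop_cons (by simp [hl]) h1 h2).mono (by simp; omega)).of_eq ?_
    funext i
    simp only [Function.update_apply]
    split_ifs <;> simp_all

/-- Move the register `a` to both `b` and `c`, in reverse order. -/
def moveRevBoth (a b c : ℕ) : Cmd :=
  .loop a (.test a .skip (.seq (.pop a) (.seq (.push b false) (.push c false)))
    (.seq (.pop a) (.seq (.push b true) (.push c true))))

theorem runs_moveRevBoth {a b c : ℕ} (hab : a ≠ b) (hac : a ≠ c) (hbc : b ≠ c) (s : Store) :
    Runs (moveRevBoth a b c) s (Function.update (Function.update (Function.update s a []) b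
      ((s a).reverse ++ s b)) c ((s a).reverse ++ s c)) (13 * (s a).length + 1) := by
  generalize hl : s a = l
  induction l generalizing s with
  | nil =>
    refine ((Runs.loop_nil hl).mono (by simp)).of_eq ?_
    funext i
    simp only [Function.update_apply]
    split_ifs <;> simp_all
  | cons v l ih =>
    have h1 : Runs (.test a .skip (.seq (.pop a) (.seq (.push b false) (.push c false)))
        (.seq (.pop a) (.seq (.push b true) (.push c true)))) s
        (Function.update (Function.update (Function.update s a l) b (v :: s b)) c (v :: s c))
        12 := by
      refine (Cmd.Straight.runs_of_eq ?_ ?_).mono (by simp [Cmd.cost])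
      · simp [Cmd.Straight]
      · cases v <;> simp [Cmd.eval, hl, hab.symm, hac.symm, hbc.symm]
    have h2 := ih (Function.update (Function.update (Function.update s a l) b (v :: s b)) c
      (v :: s c)) (by simp [hab, hac])
    refine ((Runs.loop_cons (by simp [hl]) h1 h2).mono (by simp; omega)).of_eq ?_
    funext i
    simp only [Function.update_apply]
    split_ifs <;> simp_all

/-- Append the contents of `a` in front of `b`, using the empty register `t`. -/
def app (a t b : ℕ) : Cmd := .seq (moveRev a t) (moveRevBoth t a b)

theorem runs_app {a t b : ℕ} (hat : a ≠ t) (hab : a ≠ b) (htb : t ≠ b) {s : Store} (ht : s t = []) :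
    Runs (app a t b) s (Function.update s b (s a ++ s b)) (22 * (s a).length + 3) := by
  have h1 := runs_moveRev hat s
  have h2 := runs_moveRevBoth hat.symm htb hab
    (Function.update (Function.update s a []) t ((s a).reverse ++ s t))
  refine ((h1.seq h2).mono (by simp [ht]; omega)).of_eq ?_
  funext i
  simp only [Function.update_apply]
  split_ifs <;> simp_all

/-! ### Masked parities -/

/-- The inner product modulo two of two bit strings, of which the longer one is truncated. -/
def ip : List Bool → List Bool → Bool
  | a :: s, b :: x => xor (a && b) (ip s x)
  | _, _ => false

@[simp] theorem ip_nil_left (x : List Bool) : ip [] x = false := by simp [ip]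

@[simp] theorem ip_nil_right (s : List Bool) : ip s [] = false := by cases s <;> simp [ip]

@[simp] theorem ip_cons (a b : Bool) (s x : List Bool) :
    ip (a :: s) (b :: x) = xor (a && b) (ip s x) := rfl

theorem ip_append {s x : List Bool} (h : s.length ≤ x.length) (y : List Bool) :
    ip s (x ++ y) = ip s x := by
  induction s generalizing x with
  | nil => simp
  | cons a s ih =>
    cases x with
    | nil => simp at h
    | cons b x => simp [ih (by simpa using h)]

/-- The unit vector with a one at `i`. -/
def unitVec {n : ℕ} (i : Fin n) : List Bool := List.ofFn fun j => decide (j = i)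

theorem ip_replicate_false (n : ℕ) (s : List Bool) : ip s (List.replicate n false) = false := by
  induction n generalizing s with
  | zero => simp
  | succ n ih => cases s <;> simp [List.replicate_succ, ih]

theorem ip_ofFn_unitVec {n : ℕ} (r : Fin n → Bool) (i : Fin n) :
    ip (List.ofFn r) (unitVec i) = r i := by
  induction n with
  | zero => exact i.elim0
  | succ n ih =>
    refine Fin.cases ?_ (fun i => ?_) i
    · simp [unitVec, List.ofFn_succ, Fin.succ_ne_zero, ip_replicate_false]
    · have := ih (fun j => r j.succ) i
      simp only [unitVec] at this
      simp [unitVec, List.ofFn_succ, (Fin.succ_ne_zero i).symm, this]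

/-- The selector `0 … 0 1` of the entry `i`. -/
def selector (i : ℕ) : List Bool := List.replicate i false ++ [true]

theorem ip_selector (i : ℕ) (x : List Bool) : ip (selector i) x = x.getD i false := by
  induction i generalizing x with
  | zero => cases x <;> simp [selector]
  | succ i ih =>
    cases x with
    | nil => simp
    | cons b x =>
      have := ih x
      simp only [selector] at this
      simp [selector, List.replicate_succ, this]

/-- The points of the domain, before they are encoded: a mask bit, an index and a vector. -/
abbrev MaskedPoint (n : ℕ) : Type := Bool × Fin n × (Fin n → Bool)

/-- The string that encodes a point. It starts with the mask bit. If this is set, the vector comes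
next and the index serves as padding; otherwise it is the other way around. -/
def maskedString {n : ℕ} (u : MaskedPoint n) : List Bool :=
  u.1 :: if u.1 then List.ofFn u.2.2 ++ unitVec u.2.1 else unitVec u.2.1 ++ List.ofFn u.2.2

theorem length_unitVec {n : ℕ} (i : Fin n) : (unitVec i).length = n := by simp [unitVec]

theorem length_maskedString {n : ℕ} (u : MaskedPoint n) : (maskedString u).length = 2 * n + 1 := by
  unfold maskedString
  split_ifs <;> simp [length_unitVec] <;> omega

theorem unitVec_injective {n : ℕ} : Function.Injective (unitVec (n := n)) := by
  intro i j h
  have := congrFun (List.ofFn_injective h) i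
  simpa using this

theorem maskedString_injective {n : ℕ} : Function.Injective (maskedString (n := n)) := by
  rintro ⟨b, i, x⟩ ⟨b', i', x'⟩ h
  simp only [maskedString, List.cons.injEq] at h
  obtain ⟨rfl, h⟩ := h
  cases b
  · obtain ⟨h1, h2⟩ := List.append_inj (by simpa using h) (by simp [length_unitVec])
    rw [unitVec_injective h1, List.ofFn_injective h2]
  · obtain ⟨h1, h2⟩ := List.append_inj (by simpa using h) (by simp)
    rw [unitVec_injective h2, List.ofFn_injective h1]

/-- The number of secret bits of a masked parity, apart from the constant term. -/
def dim (d : ℕ) : ℕ := (d - 1) / 2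

/-- The class of masked parities. The concept with representation `a :: r` has the value `r i` at
points with index `i` whose mask bit is not set, and the value `a + ⟨r, x⟩` at points with vector
`x` whose mask bit is set. -/
def maskedParity : ConceptClass where
  dom d := if dim d = 0 then {[]} else Finset.univ.image (maskedString (n := dim d))
  dom_nonempty d := by
    split_ifs with h
    · simp
    · have : NeZero (dim d) := ⟨h⟩
      simp
  dom_length d x hx := by
    split_ifs at hx with h
    · simp_all
    · obtain ⟨u, -, rfl⟩ := Finset.mem_image.1 hx
      rw [length_maskedString]
      unfold dim at h ⊢
      omega
  rep d s := if dim d ≠ 0 ∧ s.length = dim d + 1 then some fun x => ip s x else none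

theorem maskedParity_rep (d : ℕ) (s : List Bool) : maskedParity.rep d s =
    if dim d ≠ 0 ∧ s.length = dim d + 1 then some (fun x => ip s x.1) else none := rfl

theorem maskedParity_mem_concepts {d : ℕ} {c : maskedParity.X d → Bool} :
    c ∈ maskedParity.concepts d ↔
      dim d ≠ 0 ∧ ∃ s : List Bool, s.length = dim d + 1 ∧ c = fun x => ip s x.1 := by
  constructor
  · rintro ⟨s, hs⟩
    rw [maskedParity_rep] at hs
    by_cases h : dim d ≠ 0 ∧ s.length = dim d + 1
    · rw [if_pos h] at hs
      exact ⟨h.1, s, h.2, (Option.some.inj hs).symm⟩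
    · rw [if_neg h] at hs
      cases hs
  · rintro ⟨h, s, hs, rfl⟩
    exact ⟨s, by rw [maskedParity_rep, if_pos ⟨h, hs⟩]⟩

theorem maskedParity_size_le {d : ℕ} {c : maskedParity.X d → Bool}
    (h : c ∈ maskedParity.concepts d) : maskedParity.size d c ≤ d := by
  obtain ⟨h0, s, hs, rfl⟩ := maskedParity_mem_concepts.1 h
  have h1 : maskedParity.size d (fun x => ip s x.1) ≤ s.length :=
    Nat.sInf_le ⟨s, by rw [maskedParity_rep, if_pos ⟨h0, hs⟩], rfl⟩
  refine h1.trans ?_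
  rw [hs]
  unfold dim at h0 ⊢
  omega

/-- The points of the domain and their encodings. -/
noncomputable def maskedEquiv (d : ℕ) (h : dim d ≠ 0) :
    MaskedPoint (dim d) ≃ maskedParity.X d :=
  (Equiv.ofInjective _ (maskedString_injective (n := dim d))).trans
    (Equiv.subtypeEquivRight fun x => by simp [maskedParity, h])

theorem coe_maskedEquiv {d : ℕ} (h : dim d ≠ 0) (u : MaskedPoint (dim d)) :
    (maskedEquiv d h u : List Bool) = maskedString u := rfl

/-- The value of a masked parity. -/
def maskedValue {n : ℕ} (a : Bool) (r : Fin n → Bool) (u : MaskedPoint n) : Bool :=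
  if u.1 then xor a (ip (List.ofFn r) (List.ofFn u.2.2)) else r u.2.1

theorem ip_maskedString {n : ℕ} (a : Bool) (r : Fin n → Bool) (u : MaskedPoint n) :
    ip (a :: List.ofFn r) (maskedString u) = maskedValue a r u := by
  obtain ⟨_ | _, i, x⟩ := u
  · simp [maskedString, maskedValue, ip_append, length_unitVec, ip_ofFn_unitVec]
  · simp [maskedString, maskedValue, ip_append]

/-! ### Parities are orthogonal -/

/-- The sign that belongs to a bit. -/
def sign (b : Bool) : ℝ := if b then -1 else 1

theorem sign_xor (a b : Bool) : sign (xor a b) = sign a * sign b := by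
  cases a <;> cases b <;> simp [sign]

theorem sign_ip_ofFn {n : ℕ} (r x : Fin n → Bool) :
    sign (ip (List.ofFn r) (List.ofFn x)) = ∏ j, sign (r j && x j) := by
  induction n with
  | zero => simp [sign]
  | succ n ih => simp [List.ofFn_succ, sign_xor, ih, Fin.prod_univ_succ]

theorem sum_sign_ip_mul {n : ℕ} (x y : Fin n → Bool) :
    ∑ r : Fin n → Bool, sign (ip (List.ofFn r) (List.ofFn x)) * sign (ip (List.ofFn r) (List.ofFn y))
      = if x = y then 2 ^ n else 0 := by
  simp only [sign_ip_ofFn, ← Finset.prod_mul_distrib]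
  rw [← Fintype.prod_sum (fun j (b : Bool) => sign (b && x j) * sign (b && y j))]
  split_ifs with h
  · subst h
    rw [Finset.prod_congr rfl (g := fun _ => (2 : ℝ))]
    · simp
    · intro j _
      cases x j <;> norm_num [sign]
  · obtain ⟨j, hj⟩ := Function.ne_iff.1 h
    refine Finset.prod_eq_zero (Finset.mem_univ j) ?_
    revert hj
    cases x j <;> cases y j <;> simp [sign]

theorem sum_sq_sum_sign {n : ℕ} (F : (Fin n → Bool) → ℝ) :
    ∑ r : Fin n → Bool, (∑ x, sign (ip (List.ofFn r) (List.ofFn x)) * F x) ^ 2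
      = 2 ^ n * ∑ x, F x ^ 2 := by
  have h1 : ∀ r : Fin n → Bool, (∑ x, sign (ip (List.ofFn r) (List.ofFn x)) * F x) ^ 2 =
      ∑ x, ∑ y, F x * F y *
        (sign (ip (List.ofFn r) (List.ofFn x)) * sign (ip (List.ofFn r) (List.ofFn y))) := by
    intro r
    rw [sq, Finset.sum_mul_sum]
    exact Finset.sum_congr rfl fun x _ => Finset.sum_congr rfl fun y _ => by ring
  simp only [h1]
  rw [Finset.sum_comm, Finset.mul_sum]
  refine Finset.sum_congr rfl fun x _ => ?_
  rw [Finset.sum_comm]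
  simp only [← Finset.mul_sum, sum_sign_ip_mul]
  simp only [mul_ite, mul_zero, Finset.sum_ite_eq, Finset.mem_univ, if_true]
  ring

/-- The average of `f` over a finite type. -/
noncomputable def avg {X : Type} [Fintype X] (f : X → ℝ) : ℝ := (∑ x, f x) / Fintype.card X

theorem avg_equiv {X Y : Type} [Fintype X] [Fintype Y] (e : Y ≃ X) (f : X → ℝ) :
    avg f = avg fun y => f (e y) := by
  rw [avg, avg, Fintype.card_congr e, e.sum_comp]

theorem avg_maskedPoint {n : ℕ} (f : MaskedPoint n → ℝ) :
    avg f = (∑ b, ∑ i, ∑ x, f (b, i, x)) / (2 * n * 2 ^ n) := by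
  rw [avg, Fintype.sum_prod_type]
  simp only [Fintype.sum_prod_type, Fintype.card_prod, Fintype.card_bool, Fintype.card_fin,
    Fintype.card_pi, Finset.prod_const, Finset.card_univ]
  push_cast
  ring

/-- On average over `r`, the constant term of a masked parity has little influence. -/
theorem sum_sq_avg_sub_le {X : Type} [Fintype X] {n : ℕ} (hn : n ≠ 0) (e : MaskedPoint n ≃ X)
    (f : X → Bool → ℝ) (M : ℝ) (hM : ∀ x, |f x false - f x true| ≤ M) :
    ∑ r : Fin n → Bool, ((avg fun x => f x (maskedValue false r (e.symm x)))
      - avg fun x => f x (maskedValue true r (e.symm x))) ^ 2 ≤ M ^ 2 / 4 := by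
  set F : (Fin n → Bool) → ℝ := fun x => ∑ i, (f (e (true, i, x)) false - f (e (true, i, x)) true)
    with hF
  have hn' : (n : ℝ) ≠ 0 := Nat.cast_ne_zero.2 hn
  have h1 : ∀ r : Fin n → Bool, ((avg fun x => f x (maskedValue false r (e.symm x)))
      - avg fun x => f x (maskedValue true r (e.symm x)))
      = (∑ x, sign (ip (List.ofFn r) (List.ofFn x)) * F x) / (2 * n * 2 ^ n) := by
    intro r
    rw [avg_equiv e, avg_equiv e, avg_maskedPoint, avg_maskedPoint, ← sub_div]
    congr 1
    simp only [Fintype.sum_bool, maskedValue, Equiv.symm_apply_apply, Bool.false_eq_true, if_true,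
      if_false, add_sub_add_right_eq_sub]
    rw [Finset.sum_comm, Finset.sum_comm (f := fun i x => f (e (true, i, x)) _),
      ← Finset.sum_sub_distrib]
    refine Finset.sum_congr rfl fun x _ => ?_
    rw [hF, Finset.mul_sum, ← Finset.sum_sub_distrib]
    refine Finset.sum_congr rfl fun i _ => ?_
    cases ip (List.ofFn r) (List.ofFn x) <;> simp [sign]
  simp only [h1, div_pow]
  rw [← Finset.sum_div, sum_sq_sum_sign, div_le_iff₀ (by positivity)]
  have h2 : ∀ x, F x ^ 2 ≤ (n * M) ^ 2 := by
    intro x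
    rw [← sq_abs]
    refine pow_le_pow_left₀ (abs_nonneg _) ?_ 2
    refine (Finset.abs_sum_le_sum_abs _ _).trans ?_
    refine (Finset.sum_le_sum fun i _ => hM (e (true, i, x))).trans ?_
    simp
  have h3 : ∑ x, F x ^ 2 ≤ 2 ^ n * (n * M) ^ 2 := by
    refine (Finset.sum_le_sum fun x _ => h2 x).trans ?_
    simp
  calc (2 : ℝ) ^ n * ∑ x, F x ^ 2 ≤ 2 ^ n * (2 ^ n * (n * M) ^ 2) := by gcongr
    _ = _ := by ring

/-- No hypothesis has error less than `1/4` for both values of the constant term. -/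
theorem half_le_err_add_err {X : Type} [Fintype X] {n : ℕ} (hn : n ≠ 0) (e : MaskedPoint n ≃ X)
    (r : Fin n → Bool) (h : X → Bool) :
    1 / 2 ≤ err (fun x => maskedValue false r (e.symm x)) h
      + err (fun x => maskedValue true r (e.symm x)) h := by
  have key : ∀ c : X → Bool, err c h = avg fun x => if h x ≠ c x then (1 : ℝ) else 0 := by
    intro c
    rw [err, avg, Finset.sum_boole]
  have hn' : (0 : ℝ) < n := Nat.cast_pos.2 (Nat.pos_of_ne_zero hn)
  rw [key, key, avg_equiv e, avg_equiv e, avg_maskedPoint, avg_maskedPoint, ← add_div,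
    le_div_iff₀ (by positivity)]
  simp only [Fintype.sum_bool, Equiv.symm_apply_apply]
  have h1 : ∑ i : Fin n, ∑ x : Fin n → Bool,
        (if h (e (true, i, x)) ≠ maskedValue false r (true, i, x) then (1 : ℝ) else 0)
      + ∑ i : Fin n, ∑ x : Fin n → Bool,
        (if h (e (true, i, x)) ≠ maskedValue true r (true, i, x) then (1 : ℝ) else 0)
      = n * 2 ^ n := by
    rw [← Finset.sum_add_distrib]
    simp only [← Finset.sum_add_distrib]
    rw [Finset.sum_congr rfl (g := fun _ => (2 : ℝ) ^ n)]
    · simp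
    · intro i _
      rw [Finset.sum_congr rfl (g := fun _ => (1 : ℝ))]
      · simp
      · intro x _
        simp only [maskedValue, if_true]
        cases h (e (true, i, x)) <;> cases ip (List.ofFn r) (List.ofFn x) <;> simp
  have h2 : ∀ c : MaskedPoint n → Bool, 0 ≤ ∑ i : Fin n, ∑ x : Fin n → Bool,
        (if h (e (false, i, x)) ≠ c (false, i, x) then (1 : ℝ) else 0) := by
    intro c; positivity
  have := h2 (maskedValue false r)
  have := h2 (maskedValue true r)
  linarith

/-! ### Nonadaptive SQ learners cannot learn masked parities -/

theorem exists_pow_lt_sqrt_two_pow (A : ℝ) (j : ℕ) : ∃ n : ℕ, n ≠ 0 ∧ A * (n : ℝ) ^ j < √2 ^ n := by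
  have h2 : (1 : ℝ) < √2 := Real.one_lt_sqrt_two
  have h := (tendsto_pow_const_div_const_pow_of_one_lt j h2).const_mul A
  rw [mul_zero] at h
  obtain ⟨n, hn, hn1⟩ :=
    ((h.eventually (gt_mem_nhds one_pos)).and (Filter.eventually_ge_atTop 1)).exists
  refine ⟨n, by omega, ?_⟩
  have hp : (0 : ℝ) < √2 ^ n := by positivity
  rwa [← mul_div_assoc, div_lt_one hp] at hn

theorem polyBound_mono {a k : ℕ} {x y : ℝ} (hx : 0 ≤ x) (h : x ≤ y) :
    polyBound a k x ≤ polyBound a k y := by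
  unfold polyBound
  gcongr

theorem polyBound_nonneg {a k : ℕ} {x : ℝ} (hx : 0 ≤ x) : 0 ≤ polyBound a k x := by
  unfold polyBound
  positivity

theorem logb_two_five_le : Real.logb 2 (1 / (1 / 5)) ≤ 3 := by
  rw [Real.logb_le_iff_le_rpow (by norm_num) (by norm_num)]
  norm_num

theorem logb_two_five_nonneg : 0 ≤ Real.logb 2 (1 / (1 / 5)) :=
  Real.logb_nonneg (by norm_num) (by norm_num)

theorem dim_two_mul_add_one (n : ℕ) : dim (2 * n + 1) = n := by
  unfold dim; omega

theorem Alg.QueriesWithin.mono {Q A H : Type} {reach : Q → Set A} {ok ok' : Q → Prop}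
    (hok : ∀ q, ok q → ok' q) {P : Alg Q A H} {t t' : ℕ} (ht : t ≤ t')
    (h : P.QueriesWithin reach ok t) : P.QueriesWithin reach ok' t' := by
  induction P generalizing t t' with
  | output _ => trivial
  | sample p k ih => exact fun i hi => ih i ht (h i hi)
  | query q k ih =>
    cases t with
    | zero => exact h.elim
    | succ t =>
      obtain ⟨t', rfl⟩ : ∃ m, t' = m + 1 := ⟨t' - 1, by omega⟩
      exact ⟨hok q h.1, fun a ha => ih a (by omega) (h.2 a ha)⟩

theorem Alg.AsksList.length_le {Q A H : Type} {reach reach' : Q → Set A} {ok : Q → Prop}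
    (hr : ∀ q, ∃ a ∈ reach' q, a ∈ reach q) {qs : List Q} {P : Alg Q A H}
    (hP : P.AsksList reach qs) {t : ℕ} (h : P.QueriesWithin reach' ok t) :
    qs.length ≤ t ∧ ∀ q ∈ qs, ok q := by
  induction hP generalizing t with
  | output h => simp
  | sample p k hk ih => simp
  | query q qs k hk ih =>
    cases t with
    | zero => exact h.elim
    | succ t =>
      obtain ⟨a, ha', ha⟩ := hr q
      obtain ⟨h1, h2⟩ := ih a ha (h.2 a ha')
      refine ⟨by simpa using h1, ?_⟩
      simpa using ⟨h.1, h2⟩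

theorem PMF.toOuterMeasure_add_le_one {H : Type} (p : PMF H) {S S' : Set H} (h : Disjoint S S') :
    p.toOuterMeasure S + p.toOuterMeasure S' ≤ 1 := by
  rw [PMF.toOuterMeasure_apply, PMF.toOuterMeasure_apply, ← ENNReal.tsum_add, ← p.tsum_coe]
  refine ENNReal.tsum_le_tsum fun x => ?_
  by_cases h1 : x ∈ S
  · simp [h1, Set.disjoint_left.1 h h1]
  · simpa [h1] using Set.indicator_le_self _ _ x

theorem PMF.toOuterMeasure_le_one {H : Type} (p : PMF H) (S : Set H) : p.toOuterMeasure S ≤ 1 := by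
  simpa using PMF.toOuterMeasure_add_le_one p (disjoint_bot_right (a := S))

section

variable {X : Type} [Fintype X] {n : ℕ} (e : MaskedPoint n ≃ X)

/-- The masked parity on a copy of the domain. -/
def target (a : Bool) (r : Fin n → Bool) (x : X) : Bool := maskedValue a r (e.symm x)

/-- An SQ oracle that hides the constant term of the target if it can. -/
noncomputable def hidingOracle (r : Fin n → Bool) (a : Bool) : SQOracle X := fun _ q =>
  open Classical in
  if |q.expect (target e false r) - q.expect (target e true r)| ≤ q.τ then
    q.expect (target e false r) else q.expect (target e a r)

theorem hidingOracle_isFor (r : Fin n → Bool) (a : Bool) :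
    (hidingOracle e r a).IsFor (target e a r) := by
  intro past q
  unfold hidingOracle SQQuery.valid
  have := q.τ_pos
  split_ifs with h
  · cases a
    · simp [this.le]
    · exact h
  · simp [this.le]

theorem runSQ_hidingOracle {H : Type} {reach : SQQuery X → Set ℝ}
    (hreach : ∀ q a r, SQQuery.valid (target e a r) q ⊆ reach q) {r : Fin n → Bool}
    {qs : List (SQQuery X)} {P : Alg (SQQuery X) ℝ H} (hP : P.AsksList reach qs)
    (hq : ∀ q ∈ qs, |q.expect (target e false r) - q.expect (target e true r)| ≤ q.τ)
    (past : List (SQQuery X)) :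
    P.runSQ (hidingOracle e r false) past = P.runSQ (hidingOracle e r true) past := by
  induction hP generalizing past with
  | output h => rfl
  | sample p k hk ih =>
    simp only [Alg.runSQ]
    ext h
    rw [PMF.bind_apply, PMF.bind_apply]
    refine tsum_congr fun i => ?_
    by_cases hi : i ∈ p.support
    · rw [ih i hi hq]
    · rw [(p.apply_eq_zero_iff i).2 hi, zero_mul, zero_mul]
  | query q qs k hk ih =>
    simp only [Alg.runSQ]
    have h1 : hidingOracle e r false past q = hidingOracle e r true past q := by
      simp [hidingOracle, hq q (by simp)]
    rw [← h1]
    exact ih _ (hreach _ _ _ (hidingOracle_isFor e r false past q))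
      (fun q hq' => hq q (by simp [hq'])) _

open Classical in
theorem card_revealing_le (hn : n ≠ 0) (q : SQQuery X) {τ : ℝ} (hτ : 0 < τ) (hq : τ ≤ q.τ) :
    ((Finset.univ.filter fun r : Fin n → Bool =>
      ¬ |q.expect (target e false r) - q.expect (target e true r)| ≤ q.τ).card : ℝ) ≤ 1 / τ ^ 2 := by
  have h := sum_sq_avg_sub_le hn e (fun x y => if q.g x y then (1 : ℝ) else -1) 2 (fun x => by
    split_ifs <;> norm_num)
  rw [le_div_iff₀ (by positivity)]
  refine le_trans ?_ (h.trans_eq (by norm_num))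
  rw [← nsmul_eq_mul, ← Finset.sum_const]
  refine (Finset.sum_le_sum fun r hr => ?_).trans
    (Finset.sum_le_sum_of_subset_of_nonneg (Finset.filter_subset _ _) fun r _ _ => sq_nonneg _)
  rw [Finset.mem_filter, not_le] at hr
  rw [← sq_abs (_ - _)]
  exact pow_le_pow_left₀ hτ.le (hq.trans hr.2.le) 2

theorem disjoint_err_le (hn : n ≠ 0) (r : Fin n → Bool) :
    Disjoint {h | err (target e false r) h ≤ 1 / 5} {h | err (target e true r) h ≤ 1 / 5} := by
  rw [Set.disjoint_left]
  intro h h1 h2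
  have h3 := half_le_err_add_err hn e r h
  simp only [Set.mem_ofPred_eq] at h1 h2
  change 1 / 2 ≤ err (target e false r) h + err (target e true r) h at h3
  linarith

/-- The success probability against the hiding oracle. -/
noncomputable def sqSuccess (P : Alg (SQQuery X) ℝ (X → Bool)) (r : Fin n → Bool) (a : Bool) :
    ENNReal :=
  (P.runSQ (hidingOracle e r a) []).toOuterMeasure {h | err (target e a r) h ≤ 1 / 5}

theorem sum_sqSuccess_le_of_asksList (hn : n ≠ 0) {reach : SQQuery X → Set ℝ}
    (hreach : ∀ q a r, SQQuery.valid (target e a r) q ⊆ reach q)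
    {P : Alg (SQQuery X) ℝ (X → Bool)} {qs : List (SQQuery X)} (hP : P.AsksList reach qs)
    {τ : ℝ} (hτ : 0 < τ) {m : ℕ}
    (hQ : ∀ a r, P.QueriesWithin (SQQuery.valid (target e a r)) (fun q => τ ≤ q.τ) m) :
    ∑ r, (sqSuccess e P r false + sqSuccess e P r true)
      ≤ ENNReal.ofReal (2 ^ n + m * (1 / τ ^ 2)) := by
  classical
  obtain ⟨hlen, hok⟩ := hP.length_le (fun q => ⟨q.expect (target e false fun _ => false),
    by simp [SQQuery.valid, q.τ_pos.le],
    hreach q false (fun _ => false) (by simp [SQQuery.valid, q.τ_pos.le])⟩)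
    (hQ false fun _ => false)
  set bad : SQQuery X → Finset (Fin n → Bool) := fun q => Finset.univ.filter fun r =>
      ¬ |q.expect (target e false r) - q.expect (target e true r)| ≤ q.τ with hbad
  set B : Finset (Fin n → Bool) := qs.toFinset.biUnion bad with hB
  have hcard : (B.card : ℝ) ≤ m * (1 / τ ^ 2) := by
    calc (B.card : ℝ) ≤ ∑ q ∈ qs.toFinset, ((bad q).card : ℝ) := by
          exact_mod_cast Finset.card_biUnion_le
      _ ≤ ∑ q ∈ qs.toFinset, 1 / τ ^ 2 := Finset.sum_le_sum fun q hq =>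
          card_revealing_le e hn q hτ (hok q (by simpa using hq))
      _ = (qs.toFinset.card : ℝ) * (1 / τ ^ 2) := by simp
      _ ≤ m * (1 / τ ^ 2) := by
          gcongr
          exact (List.toFinset_card_le qs).trans hlen
  have h1 : ∀ r, sqSuccess e P r false + sqSuccess e P r true ≤ 1 + if r ∈ B then 1 else 0 := by
    intro r
    split_ifs with hr
    · exact add_le_add (PMF.toOuterMeasure_le_one _ _) (PMF.toOuterMeasure_le_one _ _)
    · rw [add_zero]
      have h2 : ∀ q ∈ qs, |q.expect (target e false r) - q.expect (target e true r)| ≤ q.τ := by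
        intro q hq
        by_contra hc
        exact hr (Finset.mem_biUnion.2 ⟨q, by simpa using hq, by simpa [hbad] using hc⟩)
      unfold sqSuccess
      rw [runSQ_hidingOracle e hreach hP h2]
      exact PMF.toOuterMeasure_add_le_one _ (disjoint_err_le e hn r)
  refine (Finset.sum_le_sum fun r _ => h1 r).trans ?_
  rw [Finset.sum_add_distrib, Finset.sum_boole, ENNReal.ofReal_add (by positivity) (by positivity)]
  refine add_le_add ?_ ?_
  · simp [ENNReal.ofReal_pow]
  · rw [← ENNReal.ofReal_natCast]
    refine ENNReal.ofReal_le_ofReal (le_trans ?_ hcard)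
    simp

theorem sum_sqSuccess_le (hn : n ≠ 0) {reach : SQQuery X → Set ℝ}
    (hreach : ∀ q a r, SQQuery.valid (target e a r) q ⊆ reach q)
    {P : Alg (SQQuery X) ℝ (X → Bool)} (hP : P.Nonadaptive reach)
    {τ : ℝ} (hτ : 0 < τ) {m : ℕ}
    (hQ : ∀ a r, P.QueriesWithin (SQQuery.valid (target e a r)) (fun q => τ ≤ q.τ) m) :
    ∑ r, (sqSuccess e P r false + sqSuccess e P r true)
      ≤ ENNReal.ofReal (2 ^ n + m * (1 / τ ^ 2)) := by
  induction hP with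
  | ask qs P hP => exact sum_sqSuccess_le_of_asksList e hn hreach hP hτ hQ
  | sample p k hk ih =>
    have h1 : ∀ r a, sqSuccess e (.sample p k) r a = ∑' i, p i * sqSuccess e (k i) r a := by
      intro r a
      simp only [sqSuccess, Alg.runSQ]
      rw [PMF.toOuterMeasure_bind_apply]
    simp only [h1, ← ENNReal.tsum_add, ← mul_add]
    rw [← Summable.tsum_finsetSum fun _ _ => ENNReal.summable]
    calc _ ≤ ∑' i, p i * ENNReal.ofReal (2 ^ n + m * (1 / τ ^ 2)) := by
          refine ENNReal.tsum_le_tsum fun i => ?_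
          rw [← Finset.mul_sum]
          by_cases hi : i ∈ p.support
          · gcongr
            exact ih i hi fun a r => hQ a r i hi
          · rw [(p.apply_eq_zero_iff i).2 hi, zero_mul, zero_mul]
      _ = _ := by rw [ENNReal.tsum_mul_right, p.tsum_coe, one_mul]

end

theorem target_maskedEquiv {d : ℕ} (hd : dim d ≠ 0) (a : Bool) (r : Fin (dim d) → Bool) :
    target (maskedEquiv d hd) a r = fun x => ip (a :: List.ofFn r) x.1 := by
  funext x
  obtain ⟨u, rfl⟩ := (maskedEquiv d hd).surjective x
  rw [target, Equiv.symm_apply_apply, coe_maskedEquiv, ip_maskedString]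

theorem target_mem_concepts {d : ℕ} (hd : dim d ≠ 0) (a : Bool) (r : Fin (dim d) → Bool) :
    target (maskedEquiv d hd) a r ∈ maskedParity.concepts d :=
  maskedParity_mem_concepts.2 ⟨hd, _, by simp, target_maskedEquiv hd a r⟩

theorem admissible_fifth : Admissible (1 / 5) (1 / 5) := by
  constructor <;> constructor <;> norm_num

/-- Lower bound for the sum of the success probabilities of a learner with confidence `4/5`. -/
theorem le_sum_success {n : ℕ} {f : (Fin n → Bool) → Bool → ENNReal}
    (h : ∀ r a, ENNReal.ofReal (1 - 1 / 5) ≤ f r a) :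
    ENNReal.ofReal (8 / 5 * 2 ^ n) ≤ ∑ r, (f r false + f r true) := by
  calc ENNReal.ofReal (8 / 5 * 2 ^ n)
      = ∑ r : Fin n → Bool, (ENNReal.ofReal (1 - 1 / 5) + ENNReal.ofReal (1 - 1 / 5)) := by
        rw [← ENNReal.ofReal_add (by norm_num) (by norm_num), Finset.sum_const, nsmul_eq_mul,
          ← ENNReal.ofReal_natCast, ← ENNReal.ofReal_mul (by positivity)]
        congr 1
        simp
        ring
    _ ≤ _ := Finset.sum_le_sum fun r _ => add_le_add (h r _) (h r _)

theorem maskedParity_not_mem_nonadaptiveSQ : maskedParity ∉ NonadaptiveSQ := by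
  rintro ⟨A, ⟨a, k, hA⟩, hna⟩
  obtain ⟨n, hn, hlt⟩ := exists_pow_lt_sqrt_two_pow (2 * (a * 15 ^ k + 1) ^ 3) (3 * k)
  obtain ⟨d, rfl, hdn⟩ : ∃ d, n = dim d ∧ d = 2 * n + 1 :=
    ⟨2 * n + 1, (dim_two_mul_add_one n).symm, rfl⟩
  set P : ℝ := (a * 15 ^ k + 1) * (dim d : ℝ) ^ k with hP
  have hn1 : (1 : ℝ) ≤ dim d := by exact_mod_cast Nat.one_le_iff_ne_zero.2 hn
  have hPpos : 0 < P := by positivity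
  have hL := logb_two_five_nonneg
  have hL' := logb_two_five_le
  have hbound : ∀ c ∈ maskedParity.concepts d, polyBound a k
      (d + maskedParity.size d c + 1 / (1 / 5) + Real.logb 2 (1 / (1 / 5))) ≤ P := by
    intro c hc
    have hs : (maskedParity.size d c : ℝ) ≤ d := by exact_mod_cast maskedParity_size_le hc
    have hd : (d : ℝ) = 2 * dim d + 1 := by exact_mod_cast hdn
    refine (polyBound_mono (y := 15 * dim d - 1) (by positivity) (by linarith)).trans ?_
    rw [polyBound, add_sub_cancel, mul_pow, ← mul_assoc, hP]
    gcongr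
    linarith
  have hQ : ∀ b r, (A d (1 / 5) (1 / 5)).QueriesWithin
      (SQQuery.valid (target (maskedEquiv d hn) b r)) (fun q => 1 / P ≤ q.τ) ⌊P⌋₊ := by
    intro b r
    have hc := target_mem_concepts hn b r
    by_cases h0 : polyBound a k (d + maskedParity.size d (target (maskedEquiv d hn) b r)
      + 1 / (1 / 5) + Real.logb 2 (1 / (1 / 5))) = 0
    · have := (hA d _ _ admissible_fifth _ hc).1
      rw [h0, Nat.floor_zero] at this
      generalize A d (1 / 5) (1 / 5) = B at this
      refine Alg.QueriesWithin.mono (ok := fun _ => False) (fun _ h => h.elim)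
        (Nat.zero_le _) ?_
      clear h0 hc
      induction B with
      | output _ => trivial
      | sample p k ih => exact fun i hi => ih i (this i hi)
      | query q k => exact this.elim
    · refine (hA d _ _ admissible_fifth _ hc).1.mono (fun q hq => le_trans ?_ hq)
        (Nat.floor_le_floor (hbound _ hc))
      have : 0 ≤ polyBound a k (d + maskedParity.size d (target (maskedEquiv d hn) b r)
        + 1 / (1 / 5) + Real.logb 2 (1 / (1 / 5))) := polyBound_nonneg (by positivity)
      exact one_div_le_one_div_of_le (lt_of_le_of_ne this (Ne.symm h0)) (hbound _ hc)
  have hreach : ∀ q a r, SQQuery.valid (target (maskedEquiv d hn) a r) q ⊆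
      {v | ∃ c ∈ maskedParity.concepts d, v ∈ q.valid c} :=
    fun q a r v hv => ⟨_, target_mem_concepts hn a r, hv⟩
  have hup := sum_sqSuccess_le (maskedEquiv d hn) hn hreach (hna d _ _ admissible_fifth)
    (one_div_pos.2 hPpos) hQ
  have hlow := le_sum_success (f := sqSuccess (maskedEquiv d hn) (A d (1 / 5) (1 / 5)))
    fun r a => (hA d _ _ admissible_fifth _ (target_mem_concepts hn a r)).2 _
      (hidingOracle_isFor _ r a)
  have h := (ENNReal.ofReal_le_ofReal_iff (by positivity)).1 (hlow.trans hup)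
  have h1 : (⌊P⌋₊ : ℝ) * (1 / (1 / P) ^ 2) ≤ P ^ 3 := by
    have := Nat.floor_le hPpos.le
    have h3 : (1 : ℝ) / (1 / P) ^ 2 = P ^ 2 := by simp
    rw [h3]
    calc (⌊P⌋₊ : ℝ) * P ^ 2 ≤ P * P ^ 2 := by gcongr
      _ = P ^ 3 := by ring
  have h2 : 2 * P ^ 3 < 2 ^ dim d := by
    calc 2 * P ^ 3 = 2 * (a * 15 ^ k + 1) ^ 3 * (dim d : ℝ) ^ (3 * k) := by rw [hP]; ring
      _ < √2 ^ dim d := hlt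
      _ ≤ 2 ^ dim d := by
        gcongr
        rw [Real.sqrt_le_left (by norm_num)]
        norm_num
  have h4 : (0 : ℝ) < 2 ^ dim d := by positivity
  linarith

/-! ### Noninteractive local learners cannot learn masked parities -/

theorem PMF.bind_congr {α β : Type} {p : PMF α} {f g : α → PMF β}
    (h : ∀ i ∈ p.support, f i = g i) : p.bind f = p.bind g := by
  ext b
  rw [PMF.bind_apply, PMF.bind_apply]
  refine tsum_congr fun i => ?_
  by_cases hi : i ∈ p.support
  · rw [h i hi]
  · rw [(p.apply_eq_zero_iff i).2 hi, zero_mul, zero_mul]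

/-- Resampling one coordinate of a uniform vector. -/
theorem uniform_bind_update {ι X H : Type} [Fintype ι] [DecidableEq ι] [Fintype X] [Nonempty X]
    (j : ι) (g : (ι → X) → PMF H) :
    ((PMF.uniformOfFintype (ι → X)).bind fun x =>
      (PMF.uniformOfFintype X).bind fun u => g (Function.update x j u))
      = (PMF.uniformOfFintype (ι → X)).bind g := by
  ext h
  simp only [PMF.bind_apply, PMF.uniformOfFintype_apply, tsum_fintype]
  let σ : ((ι → X) × X) ≃ ((ι → X) × X) :=
    { toFun := fun p => (Function.update p.1 j p.2, p.1 j)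
      invFun := fun p => (Function.update p.1 j p.2, p.1 j)
      left_inv := fun p => by simp
      right_inv := fun p => by simp }
  simp only [← Finset.mul_sum]
  congr 1
  have h1 : ∑ x : ι → X, ∑ u : X, g (Function.update x j u) h = ∑ x : ι → X, ∑ _u : X, g x h := by
    rw [← Fintype.sum_prod_type', ← Fintype.sum_prod_type']
    exact σ.sum_comp (fun p => g p.1 h)
  rw [h1, Finset.sum_comm, Finset.sum_const, nsmul_eq_mul, ← mul_assoc, Finset.card_univ,
    ENNReal.inv_mul_cancel (by simp) (by simp), one_mul]

/-- The answers to those of the queries that concern the entry `i`, if this entry is `u`. -/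
noncomputable def entryRun {D : Type} {N : ℕ} (i : Fin N) :
    List (LRQuery D N) → D → PMF (List (List Bool))
  | [], _ => PMF.pure []
  | q :: qs, u =>
      if q.1 = i then (q.2 u).bind fun w => (entryRun i qs u).map fun ws => w :: ws
      else entryRun i qs u

theorem PMF.bind_map_cons_apply {α : Type} (p : PMF α) (E : PMF (List α)) (w : α) (ws : List α) :
    (p.bind fun w => E.map fun ws => w :: ws) (w :: ws) = p w * E ws := by
  classical
  rw [PMF.bind_apply, tsum_eq_single w]
  · rw [PMF.map_apply, tsum_eq_single ws]
    · simp
    · intro ws' h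
      simp [h.symm]
  · intro w' h
    rw [PMF.map_apply, ENNReal.tsum_eq_zero.2, mul_zero]
    intro ws'
    simp [h.symm]

theorem PMF.bind_map_cons_apply_nil {α : Type} (p : PMF α) (E : PMF (List α)) :
    (p.bind fun w => E.map fun ws => w :: ws) [] = 0 := by
  simp [PMF.bind_apply, PMF.map_apply]

/-- As a function of one entry of the database, the output of a noninteractive algorithm arises by
post-processing of the answers that concern this entry. -/
theorem Alg.AsksList.exists_runLR_eq {D H : Type} {N : ℕ} {qs : List (LRQuery D N)}
    {P : Alg (LRQuery D N) (List Bool) H} (hP : P.AsksList LRQuery.reach qs)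
    (z : Fin N → D) (i : Fin N) :
    ∃ B : List (List Bool) → PMF H,
      ∀ u, P.runLR (Function.update z i u) = (entryRun i qs u).bind B := by
  induction hP with
  | output h => exact ⟨fun _ => PMF.pure h, fun u => by simp [entryRun, Alg.runLR]⟩
  | sample p k hk ih =>
    refine ⟨fun _ => p.bind fun j => (k j).runLR z, fun u => ?_⟩
    simp only [entryRun, Alg.runLR, PMF.pure_bind]
    refine PMF.bind_congr fun j hj => ?_
    obtain ⟨B, hB⟩ := ih j hj
    have h := hB (z i)
    rw [Function.update_eq_self] at h
    rw [h, hB u]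
    simp [entryRun]
  | query q qs k hk ih =>
    have : ∀ w, ∃ B : List (List Bool) → PMF H, w ∈ LRQuery.reach q →
        ∀ u, (k w).runLR (Function.update z i u) = (entryRun i qs u).bind B := by
      intro w
      by_cases hw : w ∈ LRQuery.reach q
      · obtain ⟨B, hB⟩ := ih w hw
        exact ⟨B, fun _ => hB⟩
      · exact ⟨fun _ => (k w).runLR z, fun h => (hw h).elim⟩
    choose B hB using this
    by_cases hi : q.1 = i
    · refine ⟨fun l => B (l.headD []) l.tail, fun u => ?_⟩
      simp only [entryRun, Alg.runLR, if_pos hi, PMF.bind_bind, PMF.bind_map]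
      rw [hi, Function.update_self]
      refine PMF.bind_congr fun w hw => ?_
      rw [hB w ⟨u, hw⟩ u]
      rfl
    · refine ⟨fun l => (q.2 (z q.1)).bind fun w => B w l, fun u => ?_⟩
      simp only [entryRun, Alg.runLR, if_neg hi]
      rw [PMF.bind_comm, Function.update_of_ne hi]
      exact PMF.bind_congr fun w hw => hB w ⟨z q.1, hw⟩ u

theorem entryRun_le {D H : Type} [Nonempty D] {N : ℕ} {qs : List (LRQuery D N)}
    {P : Alg (LRQuery D N) (List Bool) H} (hP : P.AsksList LRQuery.reach qs)
    {budget : Fin N → ℝ} (hb : ∀ i, 0 ≤ budget i) (hL : P.LocalWithin budget)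
    (i : Fin N) (u u' : D) (ws : List (List Bool)) :
    entryRun i qs u ws ≤ ENNReal.ofReal (Real.exp (budget i)) * entryRun i qs u' ws := by
  have one_le : ∀ x : ℝ, 0 ≤ x → 1 ≤ ENNReal.ofReal (Real.exp x) := fun x hx => by
    rw [← ENNReal.ofReal_one]
    exact ENNReal.ofReal_le_ofReal (Real.one_le_exp hx)
  induction hP generalizing budget ws with
  | output h => exact le_mul_of_one_le_left' (one_le _ (hb i))
  | sample p k hk ih => exact le_mul_of_one_le_left' (one_le _ (hb i))
  | query q qs k hk ih =>
    obtain ⟨e, he, hle, hk'⟩ := hL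
    obtain ⟨w₀, hw₀⟩ := (q.2 u).support_nonempty
    have hw : w₀ ∈ LRQuery.reach q := ⟨u, hw₀⟩
    have hb' : ∀ j, 0 ≤ Function.update budget q.1 (budget q.1 - e) j := by
      intro j
      by_cases hj : j = q.1
      · subst hj; simpa using hle
      · simpa [hj] using hb j
    by_cases hi : q.1 = i
    · simp only [entryRun, if_pos hi]
      cases ws with
      | nil => rw [PMF.bind_map_cons_apply_nil]; simp
      | cons w ws =>
        rw [PMF.bind_map_cons_apply, PMF.bind_map_cons_apply]
        have h1 := ih w₀ hw hb' (hk' w₀ hw) ws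
        rw [hi, Function.update_self] at h1
        refine (mul_le_mul' (he u u' w) h1).trans_eq ?_
        have h2 : Real.exp (budget i) = Real.exp e * Real.exp (budget i - e) := by
          rw [← Real.exp_add]; congr 1; ring
        rw [h2, ENNReal.ofReal_mul (Real.exp_pos _).le]
        ring
    · simp only [entryRun, if_neg hi]
      have h1 := ih w₀ hw hb' (hk' w₀ hw) ws
      rwa [Function.update_of_ne (Ne.symm hi)] at h1

/-- The statistical distance of two discrete distributions, times two. -/
noncomputable def l1Dist {α : Type} (p q : PMF α) : ENNReal :=
  ∑' w, ENNReal.ofReal |(p w).toReal - (q w).toReal|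

theorem bind_toOuterMeasure_le {α H : Type} (p q : PMF α) (B : α → PMF H) (S : Set H) :
    (p.bind B).toOuterMeasure S ≤ (q.bind B).toOuterMeasure S + l1Dist p q := by
  rw [PMF.toOuterMeasure_bind_apply, PMF.toOuterMeasure_bind_apply, l1Dist, ← ENNReal.tsum_add]
  refine ENNReal.tsum_le_tsum fun w => ?_
  have h : p w ≤ q w + ENNReal.ofReal |(p w).toReal - (q w).toReal| := by
    rw [← ENNReal.ofReal_toReal (p.apply_ne_top w)]
    conv_rhs => rw [← ENNReal.ofReal_toReal (q.apply_ne_top w)]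
    rw [← ENNReal.ofReal_add ENNReal.toReal_nonneg (abs_nonneg _)]
    refine ENNReal.ofReal_le_ofReal ?_
    simp only [ENNReal.toReal_ofReal ENNReal.toReal_nonneg]
    have := le_abs_self ((p w).toReal - (q w).toReal)
    linarith
  calc p w * (B w).toOuterMeasure S
      ≤ (q w + ENNReal.ofReal |(p w).toReal - (q w).toReal|) * (B w).toOuterMeasure S := by gcongr
    _ ≤ _ := by
      rw [add_mul]
      gcongr
      exact mul_le_of_le_one_right' (PMF.toOuterMeasure_le_one _ _)

section

variable {X : Type} [Fintype X] [Nonempty X] {N : ℕ}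

/-- The answers that concern the entry `i` if this is a random example of `c`. -/
noncomputable def entryDist (qs : List (LRQuery (X × Bool) N)) (i : Fin N) (c : X → Bool) :
    PMF (List (List Bool)) :=
  (PMF.uniformOfFintype X).bind fun x => entryRun i qs (x, c x)

/-- The output of a local algorithm on random examples of `c`. -/
noncomputable def localOutput {H : Type} (P : Alg (LRQuery (X × Bool) N) (List Bool) H)
    (c : X → Bool) : PMF H :=
  (PMF.uniformOfFintype (Fin N → X)).bind fun x => P.runLR fun i => (x i, c (x i))

theorem localOutput_toOuterMeasure_le {H : Type} {qs : List (LRQuery (X × Bool) N)}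
    {P : Alg (LRQuery (X × Bool) N) (List Bool) H} (hP : P.AsksList LRQuery.reach qs)
    (c c' : X → Bool) (S : Set H) :
    (localOutput P c).toOuterMeasure S ≤ (localOutput P c').toOuterMeasure S
      + ∑ i, l1Dist (entryDist qs i c) (entryDist qs i c') := by
  classical
  set z : Finset (Fin N) → (Fin N → X) → Fin N → X × Bool := fun s x i =>
    (x i, if i ∈ s then c (x i) else c' (x i)) with hz
  have key : ∀ s : Finset (Fin N),
      ((PMF.uniformOfFintype (Fin N → X)).bind fun x => P.runLR (z s x)).toOuterMeasure S
      ≤ (localOutput P c').toOuterMeasure S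
        + ∑ i ∈ s, l1Dist (entryDist qs i c) (entryDist qs i c') := by
    intro s
    induction s using Finset.induction_on with
    | empty => simp [hz, localOutput]
    | insert j s hj ih =>
      rw [Finset.sum_insert hj, add_comm (l1Dist _ _), ← add_assoc]
      refine le_trans ?_ (add_le_add_left ih _)
      rw [← uniform_bind_update j, ← uniform_bind_update j (fun x => P.runLR (z s x)),
        PMF.toOuterMeasure_bind_apply, PMF.toOuterMeasure_bind_apply]
      calc _ ≤ ∑' x, PMF.uniformOfFintype (Fin N → X) x *
              (((PMF.uniformOfFintype X).bind fun u =>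
                P.runLR (z s (Function.update x j u))).toOuterMeasure S
                + l1Dist (entryDist qs j c) (entryDist qs j c')) := by
            refine ENNReal.tsum_le_tsum fun x => ?_
            gcongr
            obtain ⟨B, hB⟩ := hP.exists_runLR_eq (z s x) j
            have h1 : ∀ u, z (insert j s) (Function.update x j u)
                = Function.update (z s x) j (u, c u) := by
              intro u
              funext i
              by_cases hi : i = j
              · subst hi; simp [hz]
              · simp [hz, hi]
            have h2 : ∀ u, z s (Function.update x j u)
                = Function.update (z s x) j (u, c' u) := by
              intro u
              funext i
              by_cases hi : i = j
              · subst hi; simp [hz, hj]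
              · simp [hz, hi]
            simp only [h1, h2, hB]
            have h3 := bind_toOuterMeasure_le (entryDist qs j c) (entryDist qs j c') B S
            simpa only [entryDist, PMF.bind_bind] using h3
        _ = _ := by
            simp only [mul_add]
            rw [ENNReal.tsum_add, ENNReal.tsum_mul_right, PMF.tsum_coe, one_mul]
  have h := key Finset.univ
  simpa [hz, localOutput] using h

theorem entryDist_toReal (qs : List (LRQuery (X × Bool) N)) (i : Fin N) (c : X → Bool)
    (ws : List (List Bool)) :
    (entryDist qs i c ws).toReal = avg fun x => (entryRun i qs (x, c x) ws).toReal := by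
  rw [entryDist, PMF.bind_apply, tsum_fintype, ENNReal.toReal_sum
    (fun x _ => ENNReal.mul_ne_top (PMF.apply_ne_top _ _) (PMF.apply_ne_top _ _)), avg,
    Finset.sum_div]
  refine Finset.sum_congr rfl fun x _ => ?_
  rw [ENNReal.toReal_mul, PMF.uniformOfFintype_apply, ENNReal.toReal_inv, ENNReal.toReal_natCast]
  ring

variable {n : ℕ} (e : MaskedPoint n ≃ X)

theorem sum_l1Dist_le (hn : n ≠ 0) {H : Type} {qs : List (LRQuery (X × Bool) N)}
    {P : Alg (LRQuery (X × Bool) N) (List Bool) H} (hP : P.AsksList LRQuery.reach qs)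
    {ε : ℝ} (hε : 0 ≤ ε) (hL : P.IsLocal ε) (i : Fin N) :
    ∑ r, l1Dist (entryDist qs i (target e false r)) (entryDist qs i (target e true r))
      ≤ ENNReal.ofReal (√2 ^ n * Real.exp ε / 2) := by
  obtain ⟨x₀⟩ := ‹Nonempty X›
  unfold l1Dist
  rw [← Summable.tsum_finsetSum fun _ _ => ENNReal.summable]
  have key : ∀ ws, ∑ r, ENNReal.ofReal |(entryDist qs i (target e false r) ws).toReal
        - (entryDist qs i (target e true r) ws).toReal|
      ≤ ENNReal.ofReal (√2 ^ n * Real.exp ε / 2) * entryRun i qs (x₀, false) ws := by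
    intro ws
    set m : ℝ := (entryRun i qs (x₀, false) ws).toReal with hm
    set D : (Fin n → Bool) → ℝ := fun r => (entryDist qs i (target e false r) ws).toReal
        - (entryDist qs i (target e true r) ws).toReal with hD
    have hle : ∀ u, (entryRun i qs u ws).toReal ≤ Real.exp ε * m := by
      intro u
      have h := entryRun_le hP (fun _ => hε) hL i u (x₀, false) ws
      have h' := ENNReal.toReal_mono
        (ENNReal.mul_ne_top ENNReal.ofReal_ne_top (PMF.apply_ne_top _ _)) h
      rwa [ENNReal.toReal_mul, ENNReal.toReal_ofReal (Real.exp_pos _).le] at h'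
    have hm0 : 0 ≤ m := ENNReal.toReal_nonneg
    have h1 : ∑ r, D r ^ 2 ≤ (Real.exp ε * m) ^ 2 / 4 := by
      have := sum_sq_avg_sub_le hn e (fun x y => (entryRun i qs (x, y) ws).toReal)
        (Real.exp ε * m) (fun x => by
          rw [abs_le]
          have h1 := hle (x, false)
          have h2 := hle (x, true)
          have h3 : 0 ≤ (entryRun i qs (x, false) ws).toReal := ENNReal.toReal_nonneg
          have h4 : 0 ≤ (entryRun i qs (x, true) ws).toReal := ENNReal.toReal_nonneg
          constructor <;> linarith)
      simpa only [hD, entryDist_toReal, target] using this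
    have h2 : ∑ r, |D r| ≤ √2 ^ n * Real.exp ε / 2 * m := by
      refine abs_le_of_sq_le_sq' ?_ (by positivity) |>.2
      have h3 := sq_sum_le_card_mul_sum_sq (s := Finset.univ) (f := fun r => |D r|)
      refine h3.trans ?_
      simp only [sq_abs, Finset.card_univ, Fintype.card_pi, Fintype.card_bool, Finset.prod_const,
        Fintype.card_fin]
      push_cast
      calc (2 : ℝ) ^ n * ∑ r, D r ^ 2 ≤ 2 ^ n * ((Real.exp ε * m) ^ 2 / 4) := by gcongr
        _ = (√2 ^ 2) ^ n * ((Real.exp ε * m) ^ 2 / 4) := by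
          rw [Real.sq_sqrt (by norm_num)]
        _ = _ := by rw [← pow_mul, mul_comm 2 n, pow_mul]; ring
    rw [← ENNReal.ofReal_sum_of_nonneg fun r _ => abs_nonneg _,
      ← ENNReal.ofReal_toReal (PMF.apply_ne_top (entryRun i qs (x₀, false)) ws), ← hm,
      ← ENNReal.ofReal_mul (by positivity)]
    exact ENNReal.ofReal_le_ofReal h2
  refine (ENNReal.tsum_le_tsum key).trans_eq ?_
  rw [ENNReal.tsum_mul_left, PMF.tsum_coe, mul_one]

/-- The success probability of a local algorithm with target `a :: r`. -/
noncomputable def localSuccess (P : Alg (LRQuery (X × Bool) N) (List Bool) (X → Bool))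
    (r : Fin n → Bool) (a : Bool) : ENNReal :=
  (localOutput P (target e a r)).toOuterMeasure {h | err (target e a r) h ≤ 1 / 5}

theorem sum_localSuccess_le (hn : n ≠ 0) {P : Alg (LRQuery (X × Bool) N) (List Bool) (X → Bool)}
    (hP : P.Nonadaptive LRQuery.reach) {ε : ℝ} (hε : 0 ≤ ε) (hL : P.IsLocal ε) :
    ∑ r, (localSuccess e P r false + localSuccess e P r true)
      ≤ ENNReal.ofReal (2 ^ n + N * (√2 ^ n * Real.exp ε / 2)) := by
  induction hP with
  | ask qs P hP =>
    have h1 : ∀ r, localSuccess e P r false + localSuccess e P r true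
        ≤ 1 + ∑ i, l1Dist (entryDist qs i (target e false r)) (entryDist qs i (target e true r)) := by
      intro r
      have h2 := localOutput_toOuterMeasure_le hP (target e false r) (target e true r)
        {h | err (target e false r) h ≤ 1 / 5}
      have h3 := PMF.toOuterMeasure_add_le_one (localOutput P (target e true r))
        (disjoint_err_le e hn r)
      calc localSuccess e P r false + localSuccess e P r true ≤ _ := add_le_add_left h2 _
        _ = _ := add_right_comm _ _ _
        _ ≤ _ := add_le_add_left h3 _
    refine (Finset.sum_le_sum fun r _ => h1 r).trans ?_
    rw [Finset.sum_add_distrib, Finset.sum_comm,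
      ENNReal.ofReal_add (by positivity) (by positivity)]
    refine add_le_add (by simp [ENNReal.ofReal_pow]) ?_
    refine (Finset.sum_le_sum fun i _ => sum_l1Dist_le e hn hP hε hL i).trans ?_
    rw [Finset.sum_const, Finset.card_univ, Fintype.card_fin, nsmul_eq_mul,
      ENNReal.ofReal_mul (by positivity), ENNReal.ofReal_natCast]
  | sample p k hk ih =>
    have h1 : ∀ r a, localSuccess e (.sample p k) r a = ∑' i, p i * localSuccess e (k i) r a := by
      intro r a
      simp only [localSuccess, localOutput, Alg.runLR]
      rw [PMF.bind_comm, PMF.toOuterMeasure_bind_apply]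
    simp only [h1, ← ENNReal.tsum_add, ← mul_add]
    rw [← Summable.tsum_finsetSum fun _ _ => ENNReal.summable]
    calc _ ≤ ∑' i, p i * ENNReal.ofReal (2 ^ n + N * (√2 ^ n * Real.exp ε / 2)) := by
          refine ENNReal.tsum_le_tsum fun i => ?_
          rw [← Finset.mul_sum]
          by_cases hi : i ∈ p.support
          · gcongr
            exact ih i hi (hL i hi)
          · rw [(p.apply_eq_zero_iff i).2 hi, zero_mul, zero_mul]
      _ = _ := by rw [ENNReal.tsum_mul_right, p.tsum_coe, one_mul]

end

theorem maskedParity_not_mem_noninteractiveLocal : maskedParity ∉ NoninteractiveLocal := by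
  rintro ⟨A, ⟨a, k, hA⟩, hna⟩
  obtain ⟨n, hn, hlt⟩ := exists_pow_lt_sqrt_two_pow (3 * (a * 15 ^ k)) k
  obtain ⟨d, rfl, hdn⟩ : ∃ d, n = dim d ∧ d = 2 * n + 1 :=
    ⟨2 * n + 1, (dim_two_mul_add_one n).symm, rfl⟩
  have hn1 : (1 : ℝ) ≤ dim d := by exact_mod_cast Nat.one_le_iff_ne_zero.2 hn
  have hL := logb_two_five_nonneg
  have hL' := logb_two_five_le
  obtain ⟨hN, hloc, hsucc⟩ := hA d 1 (1 / 5) (1 / 5) one_pos admissible_fifth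
  have hN' : (A.n d 1 (1 / 5) (1 / 5) : ℝ) ≤ a * 15 ^ k * (dim d : ℝ) ^ k := by
    have hd : (d : ℝ) = 2 * dim d + 1 := by exact_mod_cast hdn
    refine hN.trans ((polyBound_mono (y := 15 * dim d - 1) (by positivity) (by linarith)).trans ?_)
    rw [polyBound, add_sub_cancel, mul_pow, ← mul_assoc]
  have hup := sum_localSuccess_le (maskedEquiv d hn) hn
    (hna d 1 (1 / 5) (1 / 5) one_pos admissible_fifth) zero_le_one hloc
  have hlow := le_sum_success
    (f := localSuccess (maskedEquiv d hn) (A.alg d 1 (1 / 5) (1 / 5)))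
    fun r a => (hsucc _ (target_mem_concepts hn a r)).2
  have h := (ENNReal.ofReal_le_ofReal_iff (by positivity)).1 (hlow.trans hup)
  have he : Real.exp 1 < 2.7182818286 := Real.exp_one_lt_d9
  have h2 : (2 : ℝ) ^ dim d = √2 ^ dim d * √2 ^ dim d := by
    rw [← mul_pow, Real.mul_self_sqrt (by norm_num)]
  have h4 : (0 : ℝ) < √2 ^ dim d := by positivity
  have h5 : (A.n d 1 (1 / 5) (1 / 5) : ℝ) * (√2 ^ dim d * Real.exp 1 / 2)
      ≤ (√2 ^ dim d / 3) * (√2 ^ dim d * 1.4) := by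
    have : (A.n d 1 (1 / 5) (1 / 5) : ℝ) ≤ √2 ^ dim d / 3 := by linarith
    refine mul_le_mul this ?_ (by positivity) (by positivity)
    nlinarith
  nlinarith [mul_pos h4 h4]

/-! ### Programs that evaluate hypotheses, queries and randomizers -/

/-- A bit as the content of a register: `[]` for `false`. -/
def bit (b : Bool) : List Bool := if b then [true] else []

@[simp] theorem accepts_bit (b : Bool) : accepts (some (bit b)) = b := by
  cases b <;> rfl

/-- Negate the bit in register `r`. -/
def toggle (r : ℕ) : Cmd := .test r (.push r true) (.pop r) (.pop r)

/-- One step of the computation of an inner product. -/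
def ipStep : Cmd :=
  .seq (.test 0 .skip (.pop 1) (.seq (.test 1 .skip .skip (toggle 4)) (.pop 1))) (.pop 0)

/-- Add the inner product of the registers `0` and `1` to the bit in register `4`. -/
def ipProg : Cmd := .loop 0 ipStep

theorem runs_ipProg (v x : List Bool) (p : Bool) (l2 l3 l5 l6 l7 l8 : List Bool) :
    Runs ipProg (st [v, x, l2, l3, bit p, l5, l6, l7, l8])
      (st [[], x.drop v.length, l2, l3, bit (xor p (ip v x)), l5, l6, l7, l8])
      (15 * v.length + 1) := by
  induction v generalizing x p with
  | nil =>
    have h := Runs.loop_nil (c := ipStep) (r := 0)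
      (s := st [[], x, l2, l3, bit p, l5, l6, l7, l8]) rfl
    simpa [ipProg] using h
  | cons a v ih =>
    have h1 : Runs ipStep (st [a :: v, x, l2, l3, bit p, l5, l6, l7, l8])
        (st [v, x.tail, l2, l3, bit (xor p (a && x.headD false)), l5, l6, l7, l8]) 14 := by
      refine (Cmd.Straight.runs_of_eq ?_ ?_).mono (by simp [Cmd.cost, ipStep, toggle])
      · simp [Cmd.Straight, ipStep, toggle]
      · rcases a with _ | _ <;> rcases x with _ | ⟨_ | _, x⟩ <;> rcases p with _ | _ <;>
          simp [ipStep, toggle, Cmd.eval, st_apply, update_st, bit]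
    refine ((Runs.loop_cons (by simp [st_apply]) h1 (ih _ _)).mono
      (by simp; omega)).of_eq ?_
    cases x <;> simp

/-- Evaluation of masked parities. -/
def evalProg : Cmd := .seq ipProg (.test 4 .skip .skip (.push 0 true))

theorem Runs.exec_eq {c : Cmd} {s s' : Store} {B T : ℕ} (h : Runs c s s' B) (hT : B ≤ T) :
    exec T ([c], s) = some (s' 0) := by
  obtain ⟨T', -, h'⟩ := (h []).back exec_next (T - B)
  rw [Nat.sub_add_cancel hT] at h'
  rw [h', exec_nil]

theorem exec_evalProg (v x : List Bool) {T : ℕ} (hT : 15 * v.length + 10 ≤ T) :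
    exec T (evalProg.init [v, x]) = some (bit (ip v x)) := by
  rw [init_eq _ _ 7]
  have h1 := runs_ipProg v x false [] [] [] [] [] []
  have h2 : Runs (.test 4 .skip .skip (.push 0 true))
      (st [[], x.drop v.length, [], [], bit (xor false (ip v x)), [], [], [], []])
      (st [bit (ip v x), x.drop v.length, [], [], bit (ip v x), [], [], [], []]) 4 := by
    refine Cmd.Straight.runs_of_eq (by simp [Cmd.Straight]) ?_
    cases ip v x <;> simp [Cmd.eval, st_apply, update_st, bit]
  exact (h1.seq h2).exec_eq (by omega)

theorem decodeHyp_evalProg {T : ℕ} (X : Finset (List Bool)) (v : List Bool)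
    (hT : 15 * v.length + 10 ≤ T) :
    decodeHyp evalProg T X v = some fun x => ip v x.1 := by
  unfold decodeHyp
  simp [exec_evalProg v _ hT]

/-- Whether an example is relevant for the query with mode `m` and vector `v`. In mode `false`
these are the examples with the index selected by `v` whose mask bit is not set, in mode `true` the
examples whose mask bit is set. -/
def relevant (m : Bool) (v x : List Bool) : Bool := (x.head? == some m) && (m || ip v x.tail)

/-- The information about the target that an example carries for the query with mode `m` and vector
`v`, if it is relevant. -/
def value (m : Bool) (v x : List Bool) (y : Bool) : Bool := xor y (m && ip v x.tail)

/-- Compute the value of an example in register `4`, and leave register `5` empty if and only if the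
example is relevant. -/
def valueProg : Cmd :=
  .seq (.test 0 .skip (.test 1 (.push 5 true) .skip (.push 5 true))
    (.seq (.push 6 true) (.test 1 (.push 5 true) (.push 5 true) .skip)))
  (.seq (.seq (.pop 0) (.pop 1)) (.seq ipProg
    (.seq (.test 6 (.test 4 (.push 5 true) .skip (.pop 4)) .skip .skip)
      (.test 2 .skip .skip (toggle 4)))))

theorem runs_valueProg (m : Bool) (v x : List Bool) (y : Bool) (l8 : List Bool) :
    ∃ l1 l5 l6, Runs valueProg (st [m :: v, x, [y], [], [], [], [], [], l8])
      (st [[], l1, [y], [], bit (value m v x y), l5, l6, [], l8]) (15 * v.length + 40) ∧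
      (l5 = [] ↔ relevant m v x = true) := by
  set l5 : List Bool := if x.head? = some m then [] else [true] with hl5
  have h1 : Runs (.test 0 .skip (.test 1 (.push 5 true) .skip (.push 5 true))
      (.seq (.push 6 true) (.test 1 (.push 5 true) (.push 5 true) .skip)))
      (st [m :: v, x, [y], [], [], [], [], [], l8])
      (st [m :: v, x, [y], [], [], l5, bit m, [], l8]) 12 := by
    refine (Cmd.Straight.runs_of_eq (by simp [Cmd.Straight]) ?_).mono (by simp [Cmd.cost])
    rcases m with _ | _ <;> rcases x with _ | ⟨_ | _, x⟩ <;>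
      simp [Cmd.eval, st_apply, update_st, bit, hl5]
  have h2 : Runs (.seq (.pop 0) (.pop 1)) (st [m :: v, x, [y], [], [], l5, bit m, [], l8])
      (st [v, x.tail, [y], [], bit false, l5, bit m, [], l8]) 3 := by
    refine (Cmd.Straight.runs_of_eq (by simp [Cmd.Straight]) ?_).mono (by simp [Cmd.cost])
    simp [Cmd.eval, st_apply, update_st, bit]
  have h3 := runs_ipProg v x.tail false [y] [] l5 (bit m) [] l8
  set l5' : List Bool := if m || ip v x.tail then l5 else true :: l5 with hl5'
  have h4 : Runs (.seq (.test 6 (.test 4 (.push 5 true) .skip (.pop 4)) .skip .skip)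
      (.test 2 .skip .skip (toggle 4)))
      (st [[], x.tail.drop v.length, [y], [], bit (xor false (ip v x.tail)), l5, bit m, [], l8])
      (st [[], x.tail.drop v.length, [y], [], bit (value m v x y), l5', bit m, [], l8]) 20 := by
    refine (Cmd.Straight.runs_of_eq (by simp [Cmd.Straight, toggle]) ?_).mono
      (by simp [Cmd.cost, toggle])
    unfold value
    rw [hl5']
    rcases m with _ | _ <;> rcases y with _ | _ <;> rcases ip v x.tail with _ | _ <;>
      simp [Cmd.eval, st_apply, update_st, bit, toggle]
  refine ⟨_, _, _, (h1.seq (h2.seq (h3.seq h4))).mono (by omega), ?_⟩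
  rw [hl5', hl5, relevant]
  cases hm : (m || ip v x.tail) <;> simp

/-- Evaluation of statistical queries. -/
def queryProg : Cmd :=
  .seq (.pop 0) (.seq valueProg (.test 5 (.test 4 .skip .skip (.push 0 true)) .skip .skip))

theorem exec_queryProg (m : Bool) (v x : List Bool) (y : Bool) {T : ℕ}
    (hT : 15 * v.length + 60 ≤ T) :
    exec T (queryProg.init [false :: m :: v, x, [y]])
      = some (bit (relevant m v x && value m v x y)) := by
  rw [init_eq _ _ 6]
  have h1 : Runs (.pop 0) (st [false :: m :: v, x, [y], [], [], [], [], [], []])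
      (st [m :: v, x, [y], [], [], [], [], [], []]) 1 := by
    refine (Cmd.Straight.runs_of_eq (by simp [Cmd.Straight]) ?_).mono (by simp [Cmd.cost])
    simp [Cmd.eval, st_apply, update_st]
  obtain ⟨l1, l5, l6, h2, h3⟩ := runs_valueProg m v x y []
  have h4 : Runs (.test 5 (.test 4 .skip .skip (.push 0 true)) .skip .skip)
      (st [[], l1, [y], [], bit (value m v x y), l5, l6, [], []])
      (st [bit (relevant m v x && value m v x y), l1, [y], [], bit (value m v x y), l5, l6, [], []])
      10 := by
    refine (Cmd.Straight.runs_of_eq (by simp [Cmd.Straight]) ?_).mono (by simp [Cmd.cost])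
    rcases hr : relevant m v x with _ | _
    · obtain ⟨b, l, rfl⟩ := List.exists_cons_of_ne_nil (fun h => by simp [hr] at h3; exact h3 h)
      cases b <;> simp [Cmd.eval, st_apply, bit]
    · rw [h3.2 hr]
      cases value m v x y <;> simp [Cmd.eval, st_apply, update_st, bit]
  exact (h1.seq (h2.seq h4)).exec_eq (by omega)

/-- All computations that start at the configuration `x` with time at least `B` have the output
distribution `p`. -/
def Yields (B : ℕ) (x : Cfg) (p : PMF (Option (List Bool))) : Prop :=
  ∀ T, B ≤ T → execRandom T x = p

theorem Reach.yields {t B : ℕ} {x y : Cfg} {p : PMF (Option (List Bool))} (h : Reach t x y)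
    (hy : Yields B y p) : Yields (B + t) x p := by
  intro T hT
  obtain ⟨T', h1, h2⟩ := h.back execRandom_next (T - t)
  rw [Nat.sub_add_cancel (by omega)] at h2
  rw [h2]
  exact hy _ (by omega)

theorem yields_nil (B : ℕ) (s : Store) : Yields B ([], s) (PMF.pure (some (s 0))) :=
  fun T _ => execRandom_nil T s

theorem yields_flip {B r : ℕ} {K : List Cmd} {s : Store} {p : Bool → PMF (Option (List Bool))}
    (h : ∀ b, Yields B (K, Function.update s r (b :: s r)) (p b)) :
    Yields (B + 1) (.flip r :: K, s) ((PMF.uniformOfFintype Bool).bind p) := by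
  intro T hT
  obtain ⟨T, rfl⟩ : ∃ T', T = T' + 1 := ⟨T - 1, by omega⟩
  simp only [execRandom, Cmd.step]
  congr 1
  funext b
  exact h b T (by omega)

theorem Yields.mono {B B' : ℕ} {x : Cfg} {p : PMF (Option (List Bool))} (h : Yields B x p)
    (hB : B ≤ B') : Yields B' x p := fun T hT => h T (hB.trans hT)

/-- The given bit if there is one and all of `k` coins show `true`, and a fair coin otherwise. -/
noncomputable def noisy (o : Option Bool) : ℕ → PMF Bool
  | 0 => o.elim (PMF.uniformOfFintype Bool) PMF.pure
  | k + 1 => (PMF.uniformOfFintype Bool).bind fun b =>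
      if b then noisy o k else PMF.uniformOfFintype Bool

/-- Flip a coin for each leading `true` in register `0`, and mark in register `8` whether one of
them shows `false`. -/
def coinStep : Cmd :=
  .test 0 (.pop 3) (.seq (.pop 3) (.pop 0))
    (.seq (.pop 0) (.seq (.flip 7) (.test 7 .skip (.seq (.pop 7) (.push 8 true)) (.pop 7))))

/-- Output the bit in register `4` or a fair coin. -/
def chooseProg : Cmd :=
  .test 8 (.test 5 (.test 4 (.push 0 false) .skip (.push 0 true)) (.flip 0) (.flip 0))
    (.flip 0) (.flip 0)

/-- Evaluation of randomizers. -/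
def randomizerProg : Cmd :=
  .seq (.push 3 true) (.seq (.loop 3 coinStep) (.seq valueProg chooseProg))

theorem Reach.seq (c c' : Cmd) (K : List Cmd) (s : Store) :
    Reach 1 (.seq c c' :: K, s) (c :: c' :: K, s) := .step rfl (.refl 0 _)

theorem Reach.test_nil {r : ℕ} {c₀ c₁ c₂ : Cmd} {K : List Cmd} {s : Store} (h : s r = []) :
    Reach 1 (.test r c₀ c₁ c₂ :: K, s) (c₀ :: K, s) :=
  .step (x := (c₀ :: K, s)) (by simp [Cmd.step, h]) (.refl 0 _)

theorem Reach.test_false {r : ℕ} {c₀ c₁ c₂ : Cmd} {K : List Cmd} {s : Store} {l : List Bool}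
    (h : s r = false :: l) : Reach 1 (.test r c₀ c₁ c₂ :: K, s) (c₁ :: K, s) :=
  .step (x := (c₁ :: K, s)) (by simp [Cmd.step, h]) (.refl 0 _)

theorem Reach.test_true {r : ℕ} {c₀ c₁ c₂ : Cmd} {K : List Cmd} {s : Store} {l : List Bool}
    (h : s r = true :: l) : Reach 1 (.test r c₀ c₁ c₂ :: K, s) (c₂ :: K, s) :=
  .step (x := (c₂ :: K, s)) (by simp [Cmd.step, h]) (.refl 0 _)

theorem Reach.loop {r : ℕ} {c : Cmd} {K : List Cmd} {s : Store} (h : s r ≠ []) :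
    Reach 1 (.loop r c :: K, s) (c :: .loop r c :: K, s) := by
  obtain ⟨b, l, hl⟩ := List.exists_cons_of_ne_nil h
  exact .step (x := (c :: Cmd.loop r c :: K, s)) (by simp [Cmd.step, hl]) (.refl 0 _)

theorem Reach.loop_nil {r : ℕ} {c : Cmd} {K : List Cmd} {s : Store} (h : s r = []) :
    Reach 1 (.loop r c :: K, s) (K, s) :=
  .step (x := (K, s)) (by simp [Cmd.step, h]) (.refl 0 _)

/-- What an example contributes to the answer of a query. -/
def contribution (m : Bool) (v x : List Bool) (y : Bool) : Option Bool :=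
  if relevant m v x then some (value m v x y) else none

theorem yields_flip_zero (l : List (List Bool)) :
    Yields 1 ([.flip 0], st ([] :: l))
      ((PMF.uniformOfFintype Bool).map fun b => some [b]) := by
  rw [← PMF.bind_pure_comp]
  refine yields_flip (B := 0) fun b => ?_
  have h := yields_nil 0 (Function.update (st ([] :: l)) 0 (b :: st ([] :: l) 0))
  simpa [st_apply, update_st] using h

theorem yields_chooseProg (m : Bool) (v x : List Bool) (y : Bool) (l8 : List Bool) :
    Yields (15 * v.length + 50) ([.seq valueProg chooseProg],
        st [m :: v, x, [y], [], [], [], [], [], l8])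
      ((if l8 = [] then noisy (contribution m v x y) 0 else PMF.uniformOfFintype Bool).map
        fun b => some [b]) := by
  obtain ⟨l1, l5, l6, h2, h3⟩ := runs_valueProg m v x y l8
  refine ((Reach.seq _ _ _ _).yields (((h2 _).yields (B := 4) ?_))).mono (by omega)
  unfold chooseProg
  by_cases h8 : l8 = []
  · subst h8
    rw [if_pos rfl]
    refine ((Reach.test_nil rfl).yields (B := 3) ?_)
    rcases hr : relevant m v x with _ | _
    · have : l5 ≠ [] := fun h => by simp [h3.1 h] at hr
      have h1 : Reach 1 ([.test 5 (.test 4 (.push 0 false) .skip (.push 0 true)) (.flip 0) (.flip 0)],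
          st [[], l1, [y], [], bit (value m v x y), l5, l6, [], []])
          ([.flip 0], st [[], l1, [y], [], bit (value m v x y), l5, l6, [], []]) := by
        obtain ⟨b, l, rfl⟩ := List.exists_cons_of_ne_nil this
        cases b
        · exact .test_false rfl
        · exact .test_true rfl
      have h := (h1.yields (yields_flip_zero _)).mono (show 1 + 1 ≤ 3 by omega)
      simpa [noisy, contribution, hr] using h
    · rw [h3.2 hr]
      refine ((Reach.test_nil rfl).yields (B := 2) ?_)
      rcases hv : value m v x y with _ | _
      · have h1 : Reach 2 ([.test 4 (.push 0 false) .skip (.push 0 true)],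
            st [[], l1, [y], [], bit false, [], l6, [], []])
            ([], st [[false], l1, [y], [], bit false, [], l6, [], []]) := by
          refine (Reach.test_nil rfl).trans (B' := 1) ?_
          refine .step rfl ?_
          rw [update_st _ _ _ (by simp)]
          exact .refl _ _
        have h4 := h1.yields (yields_nil 0 _)
        simpa [noisy, contribution, hr, hv, st_apply, PMF.pure_map] using h4
      · have h1 : Reach 2 ([.test 4 (.push 0 false) .skip (.push 0 true)],
            st [[], l1, [y], [], bit true, [], l6, [], []])
            ([], st [[true], l1, [y], [], bit true, [], l6, [], []]) := by
          refine (Reach.test_true rfl).trans (B' := 1) ?_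
          refine .step rfl ?_
          rw [update_st _ _ _ (by simp)]
          exact .refl _ _
        have h4 := h1.yields (yields_nil 0 _)
        simpa [noisy, contribution, hr, hv, st_apply, PMF.pure_map] using h4
  · rw [if_neg h8]
    have h1 : Reach 1 ([chooseProg],
        st [[], l1, [y], [], bit (value m v x y), l5, l6, [], l8])
        ([.flip 0], st [[], l1, [y], [], bit (value m v x y), l5, l6, [], l8]) := by
      obtain ⟨b, l, rfl⟩ := List.exists_cons_of_ne_nil h8
      cases b
      · exact .test_false rfl
      · exact .test_true rfl
    exact (h1.yields (yields_flip_zero _)).mono (by omega)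

theorem yields_coinStep (m : Bool) (v x : List Bool) (y : Bool) (k : ℕ) (l8 : List Bool) :
    Yields (15 * v.length + 60 + 15 * k) ([.loop 3 coinStep, .seq valueProg chooseProg],
        st [unary k ++ false :: m :: v, x, [y], [true], [], [], [], [], l8])
      ((if l8 = [] then noisy (contribution m v x y) k else PMF.uniformOfFintype Bool).map
        fun b => some [b]) := by
  induction k generalizing l8 with
  | zero =>
    refine ((Reach.loop (by simp [st_apply])).yields
      (B := 15 * v.length + 58) ?_).mono (by omega)
    refine ((Reach.test_false rfl).yields (B := 15 * v.length + 55) ?_).mono (by omega)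
    have h1 : Runs (.seq (.pop 3) (.pop 0))
        (st [unary 0 ++ false :: m :: v, x, [y], [true], [], [], [], [], l8])
        (st [m :: v, x, [y], [], [], [], [], [], l8]) 3 := by
      refine (Cmd.Straight.runs_of_eq (by simp [Cmd.Straight]) ?_).mono (by simp [Cmd.cost])
      simp [Cmd.eval, st_apply, update_st, unary]
    refine ((h1 _).yields (B := 15 * v.length + 51) ?_).mono (by omega)
    exact (Reach.loop_nil rfl).yields (yields_chooseProg m v x y l8)
  | succ k ih =>
    refine ((Reach.loop (by simp [st_apply])).yields
      (B := 15 * v.length + 60 + 15 * k + 14) ?_).mono (by omega)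
    refine ((Reach.test_true rfl).yields (B := 15 * v.length + 60 + 15 * k + 13) ?_).mono (by omega)
    refine ((Reach.seq _ _ _ _).yields (B := 15 * v.length + 60 + 15 * k + 12) ?_).mono (by omega)
    have h1 : Runs (.pop 0)
        (st [unary (k + 1) ++ false :: m :: v, x, [y], [true], [], [], [], [], l8])
        (st [unary k ++ false :: m :: v, x, [y], [true], [], [], [], [], l8]) 1 := by
      refine (Cmd.Straight.runs_of_eq (by simp [Cmd.Straight]) ?_).mono (by simp [Cmd.cost])
      simp [Cmd.eval, st_apply, update_st, unary, List.replicate_succ]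
    refine ((h1 _).yields (B := 15 * v.length + 60 + 15 * k + 11) ?_).mono (by omega)
    refine ((Reach.seq _ _ _ _).yields (B := 15 * v.length + 60 + 15 * k + 10) ?_).mono (by omega)
    have h2 : ∀ b, Yields (15 * v.length + 60 + 15 * k + 9)
        (.test 7 .skip (.seq (.pop 7) (.push 8 true)) (.pop 7) ::
          [.loop 3 coinStep, .seq valueProg chooseProg],
          Function.update (st [unary k ++ false :: m :: v, x, [y], [true], [], [], [], [], l8]) 7
            (b :: st [unary k ++ false :: m :: v, x, [y], [true], [], [], [], [], l8] 7))
        ((if b then (if l8 = [] then noisy (contribution m v x y) k else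
          PMF.uniformOfFintype Bool) else PMF.uniformOfFintype Bool).map fun b => some [b]) := by
      intro b
      have h3 : Runs (.test 7 .skip (.seq (.pop 7) (.push 8 true)) (.pop 7))
          (Function.update (st [unary k ++ false :: m :: v, x, [y], [true], [], [], [], [], l8]) 7
            (b :: st [unary k ++ false :: m :: v, x, [y], [true], [], [], [], [], l8] 7))
          (st [unary k ++ false :: m :: v, x, [y], [true], [], [], [], [],
            if b then l8 else true :: l8]) 9 := by
        refine (Cmd.Straight.runs_of_eq (by simp [Cmd.Straight]) ?_).mono (by simp [Cmd.cost])
        cases b <;> simp [Cmd.eval, st_apply, update_st]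
      have h := (h3 [.loop 3 coinStep, .seq valueProg chooseProg]).yields (ih _)
      cases b <;> simpa using h
    have h4 := yields_flip h2
    convert h4 using 1
    rw [← PMF.map_bind]
    congr 1
    by_cases h8 : l8 = []
    · simp [h8, noisy]
    · simp [h8]

theorem execRandom_randomizerProg (k : ℕ) (m : Bool) (v x : List Bool) (y : Bool) {T : ℕ}
    (hT : 15 * v.length + 15 * k + 70 ≤ T) :
    execRandom T (randomizerProg.init [unary k ++ false :: m :: v, x, [y]])
      = (noisy (contribution m v x y) k).map fun b => some [b] := by
  rw [init_eq _ _ 6]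
  have h1 : Runs (.push 3 true) (st [unary k ++ false :: m :: v, x, [y], [], [], [], [], [], []])
      (st [unary k ++ false :: m :: v, x, [y], [true], [], [], [], [], []]) 1 := by
    refine (Cmd.Straight.runs_of_eq (by simp [Cmd.Straight]) ?_).mono (by simp [Cmd.cost])
    simp [Cmd.eval, st_apply, update_st]
  have h2 := yields_coinStep m v x y k []
  have h3 := (Reach.seq _ _ _ _).yields ((h1 _).yields ((Reach.seq _ _ _ _).yields h2))
  rw [if_pos rfl] at h3
  exact h3 T (by omega)

/-! ### What examples of masked parities reveal -/

theorem contribution_selector {n : ℕ} (a : Bool) (r : Fin n → Bool) (i : Fin n)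
    (u : MaskedPoint n) :
    contribution false (selector i) (maskedString u) (maskedValue a r u)
      = if u.1 = false ∧ u.2.1 = i then some (r i) else none := by
  obtain ⟨_ | _, j, x⟩ := u
  · have h : (unitVec j ++ List.ofFn x)[(i : ℕ)]?.getD false = decide (i = j) := by
      rw [List.getElem?_append_left (by simp [length_unitVec])]
      simp [unitVec]
    by_cases hj : i = j
    · subst hj
      simp [contribution, relevant, value, maskedString, maskedValue, ip_selector, h]
    · simp [contribution, relevant, maskedString, ip_selector, h, hj, Ne.symm hj]
  · simp [contribution, relevant, maskedString]

theorem contribution_ofFn {n : ℕ} (a : Bool) (r : Fin n → Bool) (u : MaskedPoint n) :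
    contribution true (List.ofFn r) (maskedString u) (maskedValue a r u)
      = if u.1 = true then some a else none := by
  obtain ⟨_ | _, j, x⟩ := u
  · simp [contribution, relevant, maskedString]
  · simp [contribution, relevant, value, maskedString, maskedValue, ip_append]

/-- The query with mode `m` and vector `v` reveals the bit `b` of the target: a fraction of at least
`1 / (2 n)` of the examples is relevant, and all of these contribute `b`. -/
def Reveals (d : ℕ) (c : maskedParity.X d → Bool) (m : Bool) (v : List Bool) (b : Bool) : Prop :=
  ∃ p : ℝ, 1 / (2 * dim d) ≤ p ∧ p ≤ 1 ∧ ∀ g : Option Bool → ℝ,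
    (avg fun x : maskedParity.X d => g (contribution m v x.1 (c x))) =
      p * g (some b) + (1 - p) * g none

theorem reveals_selector {d : ℕ} (hd : dim d ≠ 0) (a : Bool) (r : Fin (dim d) → Bool)
    (i : Fin (dim d)) :
    Reveals d (fun x => ip (a :: List.ofFn r) x.1) false (selector i) (r i) := by
  have h0 : (0 : ℝ) < dim d := Nat.cast_pos.2 (Nat.pos_of_ne_zero hd)
  have h1 : (1 : ℝ) ≤ dim d := by exact_mod_cast Nat.one_le_iff_ne_zero.2 hd
  refine ⟨1 / (2 * dim d), le_rfl, ?_, fun g => ?_⟩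
  · rw [div_le_one (by positivity)]; linarith
  · rw [avg_equiv (maskedEquiv d hd), avg_maskedPoint]
    simp only [coe_maskedEquiv, ip_maskedString, contribution_selector]
    simp only [Fintype.sum_bool, Bool.true_eq_false, false_and, if_false, true_and, apply_ite g,
      Finset.sum_const, Finset.card_univ, Fintype.card_pi, Fintype.card_bool, Finset.prod_const,
      Fintype.card_fin, nsmul_eq_mul]
    rw [← Finset.mul_sum, Finset.sum_ite, Finset.sum_const, Finset.sum_const, Finset.filter_eq',
      if_pos (Finset.mem_univ _), Finset.card_singleton, Finset.filter_ne',
      Finset.card_erase_of_mem (Finset.mem_univ _), Finset.card_univ, Fintype.card_fin]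
    push_cast [Nat.cast_sub (Nat.one_le_iff_ne_zero.2 hd), nsmul_eq_mul]
    field_simp
    ring

theorem reveals_ofFn {d : ℕ} (hd : dim d ≠ 0) (a : Bool) (r : Fin (dim d) → Bool) :
    Reveals d (fun x => ip (a :: List.ofFn r) x.1) true (List.ofFn r) a := by
  have h0 : (0 : ℝ) < dim d := Nat.cast_pos.2 (Nat.pos_of_ne_zero hd)
  have h1 : (1 : ℝ) ≤ dim d := by exact_mod_cast Nat.one_le_iff_ne_zero.2 hd
  refine ⟨1 / 2, ?_, by norm_num, fun g => ?_⟩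
  · exact one_div_le_one_div_of_le (by norm_num) (by linarith)
  · rw [avg_equiv (maskedEquiv d hd), avg_maskedPoint]
    simp only [coe_maskedEquiv, ip_maskedString, contribution_ofFn]
    simp only [Fintype.sum_bool, Bool.false_eq_true, if_false, if_true,
      Finset.sum_const, Finset.card_univ, Fintype.card_pi, Fintype.card_bool, Finset.prod_const,
      Fintype.card_fin, nsmul_eq_mul]
    push_cast
    field_simp
    ring

/-! ### The common part of the learning programs -/

/-- Put the separator and the mode `m` in front of the vector in register `0`, and the coins in front
of these. -/
def header (m : Bool) : Cmd := .seq (.seq (.push 0 m) (.push 0 false)) (app 7 6 0)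

/-- Decrease the counter in register `4` and prepare the query for the bit with this index. -/
def indexPrep : Cmd :=
  .seq (.pop 4) (.seq (clear 0) (.seq (.push 0 true) (.seq (app 4 6 0) (header false))))

/-- Prepare the query for the constant term, when the other bits are in register `5`. -/
def finalPrep : Cmd := .seq (clear 0) (.seq (app 5 6 0) (header true))

/-- The learning program. The command `bitProg` puts the query in register `0` to the oracle, as
often as necessary, and pushes the resulting bit onto register `5`. -/
def learnProg (bitProg : Cmd) : Cmd :=
  .seq (.loop 4 (.seq indexPrep bitProg))
    (.seq finalPrep (.seq bitProg (.seq (clear 0) (app 5 6 0))))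

/-- The stores that occur at the main stations of the learning programs. -/
def mainStore (l0 l1 l2 l3 : List Bool) (i : ℕ) (l5 : List Bool) (k : ℕ) (l8 : List Bool)
    (tail : List (List Bool)) : Store :=
  st (l0 :: l1 :: l2 :: l3 :: List.replicate i false :: l5 :: [] :: unary k :: l8 :: [] :: [] :: [] ::
    tail)

theorem runs_header (m : Bool) (l0 l1 l2 l3 : List Bool) (i : ℕ) (l5 : List Bool) (k : ℕ)
    (l8 : List Bool) (tail : List (List Bool)) :
    Runs (header m) (mainStore l0 l1 l2 l3 i l5 k l8 tail)
      (mainStore (unary k ++ false :: m :: l0) l1 l2 l3 i l5 k l8 tail) (22 * k + 7) := by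
  have h1 : Runs (.seq (.push 0 m) (.push 0 false)) (mainStore l0 l1 l2 l3 i l5 k l8 tail)
      (mainStore (false :: m :: l0) l1 l2 l3 i l5 k l8 tail) 3 := by
    refine (Cmd.Straight.runs_of_eq (by simp [Cmd.Straight]) ?_).mono (by simp [Cmd.cost])
    simp [Cmd.eval, st_apply, update_st, mainStore]
  have h2 := runs_app (a := 7) (t := 6) (b := 0) (by simp) (by simp) (by simp)
    (s := mainStore (false :: m :: l0) l1 l2 l3 i l5 k l8 tail) rfl
  refine ((h1.seq h2).mono ?_).of_eq ?_
  · simp [mainStore, st_apply, unary]; omega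
  · simp [mainStore, st_apply, update_st]

theorem runs_indexPrep (l0 l1 l2 l3 : List Bool) (i : ℕ) (l5 : List Bool) (k : ℕ)
    (l8 : List Bool) (tail : List (List Bool)) :
    Runs indexPrep (mainStore l0 l1 l2 l3 (i + 1) l5 k l8 tail)
      (mainStore (unary k ++ false :: false :: selector i) l1 l2 l3 i l5 k l8 tail)
      (2 * l0.length + 22 * i + 22 * k + 20) := by
  have h1 : Runs (.pop 4) (mainStore l0 l1 l2 l3 (i + 1) l5 k l8 tail)
      (mainStore l0 l1 l2 l3 i l5 k l8 tail) 1 := by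
    refine (Cmd.Straight.runs_of_eq (by simp [Cmd.Straight]) ?_).mono (by simp [Cmd.cost])
    simp [Cmd.eval, st_apply, update_st, mainStore]
  have h2 : Runs (clear 0) (mainStore l0 l1 l2 l3 i l5 k l8 tail)
      (mainStore [] l1 l2 l3 i l5 k l8 tail) (2 * l0.length + 1) := by
    refine (runs_clear 0 (mainStore l0 l1 l2 l3 i l5 k l8 tail)).of_eq ?_
    simp [update_st, mainStore]
  have h3 : Runs (.push 0 true) (mainStore [] l1 l2 l3 i l5 k l8 tail)
      (mainStore [true] l1 l2 l3 i l5 k l8 tail) 1 := by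
    refine (Cmd.Straight.runs_of_eq (by simp [Cmd.Straight]) ?_).mono (by simp [Cmd.cost])
    simp [Cmd.eval, st_apply, update_st, mainStore]
  have h4 : Runs (app 4 6 0) (mainStore [true] l1 l2 l3 i l5 k l8 tail)
      (mainStore (selector i) l1 l2 l3 i l5 k l8 tail) (22 * i + 3) := by
    refine ((runs_app (by simp) (by simp) (by simp)
      (s := mainStore [true] l1 l2 l3 i l5 k l8 tail) rfl).mono ?_).of_eq ?_
    · simp [mainStore, st_apply]
    · simp [mainStore, st_apply, update_st, selector]
  exact (h1.seq (h2.seq (h3.seq (h4.seq (runs_header _ _ _ _ _ _ _ _ _ _))))).mono (by omega)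

theorem runs_finalPrep (l0 l1 l2 l3 : List Bool) (i : ℕ) (l5 : List Bool) (k : ℕ)
    (l8 : List Bool) (tail : List (List Bool)) :
    Runs finalPrep (mainStore l0 l1 l2 l3 i l5 k l8 tail)
      (mainStore (unary k ++ false :: true :: l5) l1 l2 l3 i l5 k l8 tail)
      (2 * l0.length + 22 * l5.length + 22 * k + 20) := by
  have h2 : Runs (clear 0) (mainStore l0 l1 l2 l3 i l5 k l8 tail)
      (mainStore [] l1 l2 l3 i l5 k l8 tail) (2 * l0.length + 1) := by
    refine (runs_clear 0 (mainStore l0 l1 l2 l3 i l5 k l8 tail)).of_eq ?_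
    simp [update_st, mainStore]
  have h4 : Runs (app 5 6 0) (mainStore [] l1 l2 l3 i l5 k l8 tail)
      (mainStore l5 l1 l2 l3 i l5 k l8 tail) (22 * l5.length + 3) := by
    refine ((runs_app (by simp) (by simp) (by simp)
      (s := mainStore [] l1 l2 l3 i l5 k l8 tail) rfl).mono ?_).of_eq ?_
    · simp [mainStore, st_apply]
    · simp [mainStore, st_apply, update_st]
  exact (h2.seq (h4.seq (runs_header _ _ _ _ _ _ _ _ _ _))).mono (by omega)

theorem runs_outputResult (l0 l1 l2 l3 : List Bool) (i : ℕ) (l5 : List Bool) (k : ℕ)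
    (l8 : List Bool) (tail : List (List Bool)) :
    Runs (.seq (clear 0) (app 5 6 0)) (mainStore l0 l1 l2 l3 i l5 k l8 tail)
      (mainStore l5 l1 l2 l3 i l5 k l8 tail)
      (2 * l0.length + 22 * l5.length + 20) := by
  have h2 : Runs (clear 0) (mainStore l0 l1 l2 l3 i l5 k l8 tail)
      (mainStore [] l1 l2 l3 i l5 k l8 tail) (2 * l0.length + 1) := by
    refine (runs_clear 0 (mainStore l0 l1 l2 l3 i l5 k l8 tail)).of_eq ?_
    simp [update_st, mainStore]
  have h4 : Runs (app 5 6 0) (mainStore [] l1 l2 l3 i l5 k l8 tail)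
      (mainStore l5 l1 l2 l3 i l5 k l8 tail) (22 * l5.length + 3) := by
    refine ((runs_app (by simp) (by simp) (by simp)
      (s := mainStore [] l1 l2 l3 i l5 k l8 tail) rfl).mono ?_).of_eq ?_
    · simp [mainStore, st_apply]
    · simp [mainStore, st_apply, update_st]
  exact (h2.seq h4).mono (by omega)

/-- For every two elements of register `0`, push one onto register `4` and eight onto
register `1`. -/
def halveProg : Cmd :=
  .loop 0 (.seq (.pop 0) (.test 0 .skip .skip (.seq (.seq (.pop 0) (.push 4 false))
    (.seq (.seq (.seq (.push 1 true) (.push 1 true)) (.seq (.push 1 true) (.push 1 true)))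
      (.seq (.seq (.push 1 true) (.push 1 true)) (.seq (.push 1 true) (.push 1 true)))))))

theorem runs_halveProg (m i j : ℕ) (l2 l3 : List Bool) (tail : List (List Bool)) :
    Runs halveProg
      (st (unary m :: unary j :: l2 :: l3 :: List.replicate i false :: tail))
      (st ([] :: unary (8 * (m / 2) + j) :: l2 :: l3 :: List.replicate (m / 2 + i) false :: tail))
      (30 * m + 1) := by
  induction m using Nat.twoStepInduction generalizing i j with
  | zero =>
    refine ((Runs.loop_nil rfl).mono (by omega)).of_eq ?_
    simp [unary]
  | one =>
    refine (Runs.loop_cons (by simp [st_apply, unary]) (Cmd.Straight.runs_of_eq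
      (s' := st ([] :: unary j :: l2 :: l3 :: List.replicate i false :: tail)) ?_ ?_)
      ((Runs.loop_nil rfl).of_eq ?_)).mono ?_
    · simp [Cmd.Straight]
    · simp [Cmd.eval, st_apply, update_st, unary]
    · simp
    · simp [Cmd.cost]
  | more m ih _ =>
    have h := ih (i + 1) (j + 8)
    refine (Runs.loop_cons (by simp [st_apply, unary, List.replicate_succ])
      (Cmd.Straight.runs_of_eq (s' := st (unary m :: unary (j + 8) :: l2 :: l3 ::
        List.replicate (i + 1) false :: tail)) ?_ ?_) (h.of_eq ?_)).mono ?_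
    · simp [Cmd.Straight]
    · simp [Cmd.eval, st_apply, update_st, unary, List.replicate_succ]
    · rw [show 8 * (m / 2) + (j + 8) = 8 * ((m + 2) / 2) + j by omega,
        show m / 2 + (i + 1) = (m + 2) / 2 + i by omega]
    · simp [Cmd.cost]; omega

/-! ### The SQ learner -/

theorem Alg.runSQ_mapOutput {X H H' : Type} (O : SQOracle X) (f : H → H')
    (P : Alg (SQQuery X) ℝ H) (past : List (SQQuery X)) :
    (P.mapOutput f).runSQ O past = (P.runSQ O past).map f := by
  induction P generalizing past with
  | output h => simp [Alg.mapOutput, Alg.runSQ, PMF.pure_map]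
  | sample p k ih => simp [Alg.mapOutput, Alg.runSQ, PMF.map_bind, ih]
  | query q k ih => simp [Alg.mapOutput, Alg.runSQ, ih]

theorem Alg.QueriesWithin.mapOutput {Q A H H' : Type} {reach : Q → Set A} {ok : Q → Prop}
    (f : H → H') {P : Alg Q A H} {t : ℕ} (h : P.QueriesWithin reach ok t) :
    (P.mapOutput f).QueriesWithin reach ok t := by
  induction P generalizing t with
  | output _ => trivial
  | sample p k ih => exact fun i hi => ih i (h i hi)
  | query q k ih =>
    cases t with
    | zero => exact h.elim
    | succ t => exact ⟨h.1, fun a ha => ih a (h.2 a ha)⟩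

/-- In one step, register `1` grows by at most one. -/
theorem length_step_next {c : Cmd} {K : List Cmd} {s : Store} {x : Cfg}
    (h : c.step K s = .next x) : (x.2 1).length ≤ (s 1).length + 1 := by
  cases c with
  | skip => cases h; simp
  | push r b =>
    cases h
    by_cases hr : 1 = r
    · subst hr; simp
    · simp [Function.update_of_ne hr]
  | pop r =>
    cases h
    by_cases hr : 1 = r
    · subst hr; simp; omega
    · simp [Function.update_of_ne hr]
  | flip r => cases h
  | call => cases h
  | seq c c' => cases h; simp
  | test r c₀ c₁ c₂ =>
    simp only [Cmd.step] at h
    split at h <;> cases h <;> simp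
  | loop r c =>
    simp only [Cmd.step] at h
    split at h <;> cases h <;> simp

theorem length_step_coin {c : Cmd} {K : List Cmd} {s : Store} {k : Bool → Cfg}
    (h : c.step K s = .coin k) (b : Bool) : ((k b).2 1).length ≤ (s 1).length + 1 := by
  cases c with
  | flip r =>
    cases h
    by_cases hr : 1 = r
    · subst hr; simp
    · simp [Function.update_of_ne hr]
  | test r c₀ c₁ c₂ =>
    simp only [Cmd.step] at h
    split at h <;> cases h
  | loop r c =>
    simp only [Cmd.step] at h
    split at h <;> cases h
  | _ => cases h

theorem step_ask {c : Cmd} {K : List Cmd} {s : Store} {q r : List Bool} {k : List Bool → Cfg}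
    (h : c.step K s = .ask q r k) : r = s 1 ∧ ∀ w, (k w).2 1 = s 1 := by
  cases c with
  | call =>
    cases h
    exact ⟨rfl, fun w => by simp⟩
  | test r c₀ c₁ c₂ =>
    simp only [Cmd.step] at h
    split at h <;> cases h
  | loop r c =>
    simp only [Cmd.step] at h
    split at h <;> cases h
  | _ => cases h

/-- A machine asks at most as many queries as it makes steps, and their tolerances are bounded in
terms of the number of steps, too. -/
theorem queriesWithin_toSQ (G E : Cmd) (T₀ : ℕ) (X : Finset (List Bool)) (reach : SQQuery X → Set ℝ)
    (T : ℕ) (x : Cfg) (τ : ℝ) (hτ : τ ≤ 1 / ((T : ℝ) + (x.2 1).length + 2)) :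
    (toSQ G E T₀ X (execOracle T x)).QueriesWithin reach (fun q => τ ≤ q.τ) T := by
  induction T generalizing x with
  | zero =>
    obtain ⟨_ | ⟨c, K⟩, s⟩ := x <;> simp [execOracle, toSQ, Alg.QueriesWithin]
  | succ T ih =>
    obtain ⟨_ | ⟨c, K⟩, s⟩ := x
    · simp [execOracle, toSQ, Alg.QueriesWithin]
    · have key : ∀ y : Cfg, (y.2 1).length ≤ (s 1).length + 1 →
          τ ≤ 1 / ((T : ℝ) + (y.2 1).length + 2) := by
        intro y hy
        refine hτ.trans (one_div_le_one_div_of_le (by positivity) ?_)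
        have : ((y.2 1).length : ℝ) ≤ (s 1).length + 1 := by exact_mod_cast hy
        push_cast
        linarith
      have up : ∀ y : Cfg, (y.2 1).length ≤ (s 1).length + 1 →
          (toSQ G E T₀ X (execOracle T y)).QueriesWithin reach (fun q => τ ≤ q.τ) (T + 1) :=
        fun y hy => (ih y (key y hy)).mono (fun _ h => h) (by omega)
      cases hstep : c.step K s with
      | next y =>
        simp only [execOracle, hstep]
        exact up y (length_step_next hstep)
      | coin k =>
        simp only [execOracle, hstep]
        exact fun b _ => up (k b) (length_step_coin hstep b)
      | ask q r k =>
        obtain ⟨rfl, hk⟩ := step_ask hstep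
        simp only [execOracle, hstep, toSQ]
        split_ifs with hG
        · refine ⟨?_, fun a _ => ih _ (key _ (by rw [hk]; omega))⟩
          refine hτ.trans (one_div_le_one_div_of_le (by positivity) ?_)
          push_cast
          have : (0 : ℝ) ≤ T := by positivity
          linarith
        · trivial

/-- The statistical query that is described by a mode and a vector, with tolerance
`1 / (l + 2)`. -/
noncomputable def valueQuery (X : Finset (List Bool)) (m : Bool) (v : List Bool) (l : ℕ) :
    SQQuery X where
  g := fun x y => relevant m v x && value m v x y
  τ := 1 / ((l : ℝ) + 2)
  τ_pos := by positivity
  τ_lt_one := by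
    rw [div_lt_one (by positivity)]
    have : (0 : ℝ) ≤ l := Nat.cast_nonneg _
    linarith

/-- All computations with time at least `B` that start at the configuration `x` and use the oracle
`O` output `h`. -/
def SQYields {X : Finset (List Bool)} (O : SQOracle X) (h : X → Bool) (T₀ B : ℕ) (x : Cfg) : Prop :=
  ∀ T past, B ≤ T →
    (toSQ queryProg evalProg T₀ X (execOracle T x)).runSQ O past = PMF.pure (some h)

section

variable {X : Finset (List Bool)} {O : SQOracle X} {h : X → Bool} {T₀ : ℕ}

theorem SQYields.mono {B B' : ℕ} {x : Cfg} (hx : SQYields O h T₀ B x) (hB : B ≤ B') :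
    SQYields O h T₀ B' x := fun T past hT => hx T past (hB.trans hT)

theorem Reach.sqYields {t B : ℕ} {x y : Cfg} (hxy : Reach t x y) (hy : SQYields O h T₀ B y) :
    SQYields O h T₀ (B + t) x := by
  intro T past hT
  obtain ⟨T', h1, h2⟩ := hxy.back execOracle_next (T - t)
  rw [Nat.sub_add_cancel (by omega)] at h2
  rw [h2]
  exact hy _ _ (by omega)

theorem sqYields_nil (B : ℕ) (s : Store) (hT : 15 * (s 0).length + 10 ≤ T₀) :
    SQYields O (fun x => ip (s 0) x.1) T₀ B ([], s) := by
  intro T past _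
  rw [execOracle_nil]
  simp [toSQ, Alg.runSQ, decodeHyp_evalProg X (s 0) hT]

theorem sqYields_call {c : X → Bool} (hO : O.IsFor c) {B : ℕ} {K : List Cmd} {s : Store} {m : Bool}
    {v : List Bool} (hs : s 0 = false :: m :: v) (hT : 15 * v.length + 60 ≤ T₀)
    (hK : ∀ a, a ∈ (valueQuery X m v (s 1).length).valid c → SQYields O h T₀ B
      (K, Function.update s 2 (encodeAnswer (1 / (((s 1).length : ℝ) + 2)) a))) :
    SQYields O h T₀ (B + 1) (.call :: K, s) := by
  intro T past hT'
  obtain ⟨T, rfl⟩ : ∃ T', T = T' + 1 := ⟨T - 1, by omega⟩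
  simp only [execOracle, Cmd.step, toSQ, hs]
  simp only [exec_queryProg m v _ _ hT, accepts_bit]
  rw [if_pos (by simp)]
  exact hK _ (hO past (valueQuery X m v (s 1).length)) T _ (by omega)

end

/-- Put the query in register `0` to the SQ oracle and push the bit that it reveals onto
register `5`. -/
def sqBitProg : Cmd :=
  .seq .call (.seq (app 1 6 9) (.seq (.loop 9 (.seq (.pop 9) (.pop 2)))
    (.seq (.seq (.seq (.pop 2) (.pop 2)) (.seq (.pop 2) (.pop 2)))
      (.test 2 (.push 5 false) .skip (.push 5 true)))))

theorem runs_dropProg (j N : ℕ) (l0 l1 l3 l4 l5 l6 l7 l8 : List Bool) (tail : List (List Bool)) :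
    Runs (.loop 9 (.seq (.pop 9) (.pop 2)))
      (st (l0 :: l1 :: unary N :: l3 :: l4 :: l5 :: l6 :: l7 :: l8 :: unary j :: tail))
      (st (l0 :: l1 :: unary (N - j) :: l3 :: l4 :: l5 :: l6 :: l7 :: l8 :: [] :: tail))
      (4 * j + 1) := by
  induction j generalizing N with
  | zero => exact (Runs.loop_nil rfl).mono (by omega)
  | succ j ih =>
    have h := ih (N - 1)
    rw [show N - 1 - j = N - (j + 1) by omega] at h
    refine (Runs.loop_cons (by simp [st_apply, unary, List.replicate_succ])
      (Cmd.Straight.runs_of_eq ?_ ?_) h).mono ?_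
    · simp [Cmd.Straight]
    · simp [Cmd.eval, st_apply, update_st, unary, List.replicate_succ]
    · simp [Cmd.cost]; omega

/-- The answer to a query tells the bit that the query reveals. -/
theorem encodeAnswer_of_reveals {d : ℕ} (hd : dim d ≠ 0) {c : maskedParity.X d → Bool} {m : Bool}
    {v : List Bool} {b : Bool} (hb : Reveals d c m v b) {a : ℝ}
    (ha : a ∈ (valueQuery (maskedParity.dom d) m v (8 * dim d)).valid c) :
    ∃ N, encodeAnswer (1 / (((8 * dim d : ℕ) : ℝ) + 2)) a = unary N ∧
      (b = false → N ≤ 8 * dim d + 3) ∧ (b = true → 8 * dim d + 5 ≤ N) := by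
  refine ⟨_, rfl, ?_⟩
  have hn : (0 : ℝ) < dim d := Nat.cast_pos.2 (Nat.pos_of_ne_zero hd)
  obtain ⟨p, hp, -, hg⟩ := hb
  have he : (valueQuery (maskedParity.dom d) m v (8 * dim d)).expect c
      = p * (if b then 1 else -1) + (1 - p) * (-1) := by
    have h := hg fun o => if o = some true then 1 else -1
    simp only [Option.some.injEq, reduceCtorEq, if_false] at h
    rw [← h]
    unfold SQQuery.expect avg valueQuery contribution
    congr 1
    refine Finset.sum_congr rfl fun x _ => ?_
    cases relevant m v x.1 <;> simp
  have hτ : (valueQuery (maskedParity.dom d) m v (8 * dim d)).τ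
    = 1 / (((8 * dim d : ℕ) : ℝ) + 2) := rfl
  rw [SQQuery.valid, Set.mem_ofPred_eq, he, hτ, abs_le] at ha
  obtain ⟨ha1, ha2⟩ := ha
  rw [div_div_eq_mul_div, div_one]
  push_cast at *
  set l : ℝ := 8 * dim d + 2 with hl
  have hl0 : 0 < l := by positivity
  have h1 : 1 / l * l = 1 := by field_simp
  constructor
  · rintro rfl
    rw [← Nat.lt_succ_iff, Nat.floor_lt' (by simp)]
    simp only [Bool.false_eq_true, if_false] at ha2
    have h2 : a + 2 ≤ 1 + 1 / l := by linarith
    have h3 : (a + 2) * l ≤ (1 + 1 / l) * l := by gcongr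
    push_cast
    have h4 : (1 + 1 / l) * l = l + 1 := by rw [add_mul, h1, one_mul]
    linarith
  · rintro rfl
    refine Nat.le_floor ?_
    simp only [if_true] at ha1
    have h2 : 1 + 1 / dim d - 1 / l ≤ a + 2 := by
      have : 1 / (2 * (dim d : ℝ)) = 1 / dim d / 2 := by field_simp
      linarith
    have h3 : (1 + 1 / dim d - 1 / l) * l ≤ (a + 2) * l := by gcongr
    have h4 : (1 + 1 / dim d - 1 / l) * l = l + (8 + 2 / dim d) - 1 := by
      rw [sub_mul, h1, add_mul, hl]
      field_simp
    have h5 : 0 < 2 / (dim d : ℝ) := by positivity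
    push_cast
    linarith

theorem sqYields_sqBitProg {d : ℕ} (hd : dim d ≠ 0) {c h : maskedParity.X d → Bool}
    {O : SQOracle (maskedParity.X d)} (hO : O.IsFor c) {T₀ : ℕ} {m b : Bool}
    {v l2 l3 l5 l8 : List Bool} {i B : ℕ}
    {tail : List (List Bool)} {K : List Cmd} (hb : Reveals d c m v b)
    (hT : 15 * v.length + 60 ≤ T₀)
    (hK : ∀ l2, SQYields O h T₀ B
      (K, mainStore (false :: m :: v) (unary (8 * dim d)) l2 l3 i (b :: l5) 0 l8 tail)) :
    SQYields O h T₀ (B + 208 * dim d + 30)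
      (sqBitProg :: K, mainStore (false :: m :: v) (unary (8 * dim d)) l2 l3 i l5 0 l8 tail) := by
  refine ((Reach.seq _ _ _ _).sqYields (B := B + 208 * dim d + 29) ?_).mono (by omega)
  refine sqYields_call hO (B := B + 208 * dim d + 28) (m := m) (v := v) rfl hT fun a ha => ?_
  have h1 : (mainStore (false :: m :: v) (unary (8 * dim d)) l2 l3 i l5 0 l8 tail 1).length
    = 8 * dim d := by simp [mainStore, st_apply, unary]
  rw [h1] at ha ⊢
  obtain ⟨N, hN, hN1, hN2⟩ := encodeAnswer_of_reveals hd hb ha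
  rw [hN]
  have h2 : Function.update (mainStore (false :: m :: v) (unary (8 * dim d)) l2 l3 i l5 0 l8 tail) 2
      (unary N) = mainStore (false :: m :: v) (unary (8 * dim d)) (unary N) l3 i l5 0 l8 tail := by
    simp [mainStore, update_st]
  rw [h2]
  have h3 : Runs (app 1 6 9)
      (mainStore (false :: m :: v) (unary (8 * dim d)) (unary N) l3 i l5 0 l8 tail)
      (st ((false :: m :: v) :: unary (8 * dim d) :: unary N :: l3 :: List.replicate i false :: l5 ::
        [] :: unary 0 :: l8 :: unary (8 * dim d) :: [] :: [] :: tail)) (176 * dim d + 3) := by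
    refine ((runs_app (by simp) (by simp) (by simp)
      (s := mainStore (false :: m :: v) (unary (8 * dim d)) (unary N) l3 i l5 0 l8 tail)
      rfl).mono ?_).of_eq ?_
    · simp [mainStore, st_apply, unary]
      omega
    · simp [mainStore, st_apply, update_st]
  have h4 := runs_dropProg (8 * dim d) N (false :: m :: v) (unary (8 * dim d)) l3
    (List.replicate i false) l5 [] (unary 0) l8 ([] :: [] :: tail)
  have h5 : Runs (.seq (.seq (.seq (.pop 2) (.pop 2)) (.seq (.pop 2) (.pop 2)))
      (.test 2 (.push 5 false) .skip (.push 5 true)))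
      (mainStore (false :: m :: v) (unary (8 * dim d)) (unary (N - 8 * dim d)) l3 i l5 0 l8 tail)
      (mainStore (false :: m :: v) (unary (8 * dim d)) (unary (N - 8 * dim d - 4)) l3 i (b :: l5) 0
        l8 tail) 14 := by
    refine (Cmd.Straight.runs_of_eq (by simp [Cmd.Straight]) ?_).mono (by simp [Cmd.cost])
    cases b
    · have h6 : N - 8 * dim d - 4 = 0 := by have := hN1 rfl; omega
      have h7 : N - 8 * dim d - 1 - 1 - 1 - 1 = 0 := by omega
      simp [Cmd.eval, st_apply, update_st, mainStore, unary, h6, h7]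
    · obtain ⟨j, hj⟩ : ∃ j, N - 8 * dim d = j + 5 := ⟨N - 8 * dim d - 5, by
        have := hN2 rfl; omega⟩
      simp [Cmd.eval, st_apply, update_st, mainStore, unary, hj, List.replicate_succ]
  exact (((h3.seq (h4.seq h5)) K).sqYields (hK _)).mono (by omega)

theorem sqYields_learnProg {d : ℕ} (hd : dim d ≠ 0) (a : Bool) (r : Fin (dim d) → Bool)
    {O : SQOracle (maskedParity.X d)} (hO : O.IsFor fun x => ip (a :: List.ofFn r) x.1) {T₀ : ℕ}
    (hT : 15 * dim d + 75 ≤ T₀) (l2 l3 l8 : List Bool) (tail : List (List Bool)) :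
    SQYields O (fun x => ip (a :: List.ofFn r) x.1) T₀ (300 * (dim d + 1) * (dim d + 2))
      ([learnProg sqBitProg],
        mainStore [] (unary (8 * dim d)) l2 l3 (dim d) [] 0 l8 tail) := by
  have hlen : (List.ofFn r).length = dim d := by simp
  refine ((Reach.seq _ _ _ _).sqYields (B := 300 * (dim d + 1) * (dim d + 2) - 1) ?_).mono
    (by have : 0 < 300 * (dim d + 1) * (dim d + 2) := by positivity
        omega)
  have key : ∀ i ≤ dim d, ∀ l0 l2 : List Bool, l0.length ≤ dim d + 2 →
      SQYields O (fun x => ip (a :: List.ofFn r) x.1) T₀ (300 * (dim d + 1) + i * (232 * dim d + 60) + 100)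
      ([.loop 4 (.seq indexPrep sqBitProg),
        .seq finalPrep (.seq sqBitProg (.seq (clear 0) (app 5 6 0)))],
        mainStore l0 (unary (8 * dim d)) l2 l3 i ((List.ofFn r).drop i) 0 l8 tail) := by
    intro i
    induction i with
    | zero =>
      intro _ l0 l2 hl0
      refine ((Reach.loop_nil rfl).sqYields (B := 300 * (dim d + 1) + 99) ?_).mono (by omega)
      refine ((Reach.seq _ _ _ _).sqYields (B := 300 * (dim d + 1) + 98) ?_).mono (by omega)
      refine ((runs_finalPrep _ _ _ _ _ _ _ _ _ _).sqYields
        (B := 274 * dim d + 300) ?_).mono (by simp; omega)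
      refine ((Reach.seq _ _ _ _).sqYields (B := 274 * dim d + 299) ?_).mono (by omega)
      refine (sqYields_sqBitProg (B := 25 * dim d + 60) hd hO (m := true) (b := a)
        (v := (List.ofFn r).drop 0) ?_ ?_ ?_).mono (by omega)
      · simpa using reveals_ofFn hd a r
      · simp; omega
      · intro l2
        refine ((runs_outputResult _ _ _ _ _ _ _ _ _ _).sqYields (B := 0) ?_).mono
          (by simp; omega)
        exact sqYields_nil (O := O) 0 (mainStore (a :: List.ofFn r) _ _ _ _ _ _ _ _)
          (by simp [mainStore, st_apply]; omega)
    | succ i ih =>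
      intro hi l0 l2 hl0
      refine ((Reach.loop (by simp [mainStore, st_apply])).sqYields
        (B := 300 * (dim d + 1) + (i + 1) * (232 * dim d + 60) + 99) ?_).mono (by omega)
      refine ((Reach.seq _ _ _ _).sqYields
        (B := 300 * (dim d + 1) + (i + 1) * (232 * dim d + 60) + 98) ?_).mono (by omega)
      refine ((runs_indexPrep _ _ _ _ _ _ _ _ _ _).sqYields
        (B := (300 * (dim d + 1) + i * (232 * dim d + 60) + 100) + 208 * dim d + 30) ?_).mono
        (by have := add_one_mul i (232 * dim d + 60); omega)
      refine sqYields_sqBitProg hd hO (m := false) (b := r ⟨i, hi⟩)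
        (v := selector i) ?_ ?_ ?_
      · exact reveals_selector hd a r ⟨i, hi⟩
      · simp [selector]; omega
      · intro l2
        have h1 := ih (by omega) (false :: false :: selector i) l2 (by simp [selector]; omega)
        rwa [List.drop_eq_getElem_cons (by simpa using hi), List.getElem_ofFn] at h1
  have h1 := key (dim d) le_rfl [] l2 (by simp)
  rw [List.drop_of_length_le (by simp)] at h1
  refine h1.mono ?_
  have : 300 * (dim d + 1) * (dim d + 2) = 300 * (dim d * dim d) + 900 * dim d + 600 := by ring
  have h2 : dim d * (232 * dim d + 60) = 232 * (dim d * dim d) + 60 * dim d := by ring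
  omega

/-- The SQ learner for masked parities. -/
def sqProg : Cmd := .seq (clear 1) (.seq (.pop 0) (.seq halveProg (learnProg sqBitProg)))

theorem sqYields_sqProg {d : ℕ} (hd : dim d ≠ 0) (a : Bool) (r : Fin (dim d) → Bool)
    {O : SQOracle (maskedParity.X d)} (hO : O.IsFor fun x => ip (a :: List.ofFn r) x.1) {T₀ : ℕ}
    (hT : 15 * dim d + 75 ≤ T₀) (A L : ℕ) :
    SQYields O (fun x => ip (a :: List.ofFn r) x.1) T₀ (300 * (d + A + 3) ^ 2)
      (sqProg.init [unary d, unary A, unary L]) := by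
  rw [init_eq _ _ 9]
  have h1 : Runs (clear 1) (st ([unary d, unary A, unary L] ++ List.replicate 9 []))
      (st (unary d :: [] :: unary L :: List.replicate 9 [])) (2 * A + 1) := by
    refine ((runs_clear 1 _).mono ?_).of_eq ?_
    · simp [st_apply, unary]
    · rw [update_st _ _ _ (by simp)]; simp
  have h2 : Runs (.pop 0) (st (unary d :: [] :: unary L :: List.replicate 9 []))
      (st (unary (d - 1) :: unary 0 :: unary L :: List.replicate 9 [])) 1 := by
    refine (Cmd.Straight.runs_of_eq (by simp [Cmd.Straight]) ?_).mono (by simp [Cmd.cost])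
    simp [Cmd.eval, st_apply, update_st, unary]
  have h3 := runs_halveProg (d - 1) 0 0 (unary L) [] (List.replicate 7 [])
  have h4 := sqYields_learnProg hd a r hO hT (unary L) [] [] []
  have h5 := (Reach.seq _ _ _ _).sqYields ((h1 _).sqYields ((Reach.seq _ _ _ _).sqYields
    ((h2 _).sqYields ((Reach.seq _ _ _ _).sqYields ((h3 _).sqYields h4)))))
  refine h5.mono ?_
  have hdim : 2 * dim d ≤ d := by unfold dim; omega
  have h6 : 300 * (dim d + 1) * (dim d + 2) ≤ 300 * ((d + 1) * (d + 2)) := by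
    rw [mul_assoc]
    gcongr <;> omega
  have h7 : d - 1 ≤ d := Nat.sub_le d 1
  nlinarith [Nat.zero_le (d * A), Nat.zero_le (A * A)]

/-- The running time of the SQ learner. -/
noncomputable def sqTime (d : ℕ) (α _β : ℝ) : ℕ := 300 * (d + ⌈1 / α⌉₊ + 3) ^ 2

/-- The SQ learner for masked parities. -/
noncomputable def sqLearner : SQFamily maskedParity := fun d α β =>
  (machineSQ maskedParity sqProg queryProg evalProg sqTime d α β).mapOutput fun o =>
    o.getD fun _ => false

theorem Admissible.nonneg {α β : ℝ} (h : Admissible α β) :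
    0 < 1 / α ∧ 0 < Real.logb 2 (1 / β) := by
  obtain ⟨⟨h1, h2⟩, ⟨h3, h4⟩⟩ := h
  refine ⟨by positivity, Real.logb_pos (by norm_num) ?_⟩
  rw [lt_div_iff₀ h3]
  linarith

theorem err_self {X : Type} [Fintype X] (c : X → Bool) : err c c = 0 := by
  simp [err]

theorem sqTime_add_le {d : ℕ} {α β : ℝ} (h : Admissible α β) {x : ℝ}
    (hx : d + 1 / α + Real.logb 2 (1 / β) ≤ x) :
    (sqTime d α β : ℝ) + ⌈1 / α⌉₊ + 2 ≤ polyBound 4816 2 x := by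
  obtain ⟨h1, h2⟩ := h.nonneg
  have h3 := (Nat.ceil_lt_add_one h1.le).le
  unfold sqTime polyBound
  push_cast
  set A : ℝ := (⌈1 / α⌉₊ : ℝ)
  have hA : 0 ≤ A := Nat.cast_nonneg _
  have hd : (0 : ℝ) ≤ d := Nat.cast_nonneg _
  have h4 : (d : ℝ) + A + 3 ≤ 4 * (1 + x) := by linarith
  have h5 : ((d : ℝ) + A + 3) ^ 2 ≤ (4 * (1 + x)) ^ 2 := by gcongr
  nlinarith

theorem runSQ_machineSQ {d : ℕ} {α β : ℝ} {c : maskedParity.X d → Bool}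
    (hc : c ∈ maskedParity.concepts d) {O : SQOracle (maskedParity.X d)} (hO : O.IsFor c) :
    (machineSQ maskedParity sqProg queryProg evalProg sqTime d α β).runSQ O []
      = PMF.pure (some c) := by
  obtain ⟨hd, s, hs, rfl⟩ := maskedParity_mem_concepts.1 hc
  obtain ⟨a, s, rfl⟩ := List.exists_cons_of_length_eq_add_one hs
  obtain ⟨r, rfl⟩ : ∃ r : Fin (dim d) → Bool, s = List.ofFn r := by
    have h : s.length = dim d := by simpa using hs
    rw [← h]
    exact ⟨s.get, (List.ofFn_get s).symm⟩
  refine sqYields_sqProg hd a r hO ?_ _ _ _ _ le_rfl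
  have : dim d ≤ d := by unfold dim; omega
  unfold sqTime
  nlinarith [Nat.zero_le (d * ⌈1 / α⌉₊), Nat.zero_le (⌈1 / α⌉₊ * ⌈1 / α⌉₊)]

theorem maskedParity_mem_effAdaptiveSQ : maskedParity ∈ EffAdaptiveSQ := by
  refine ⟨sqLearner, ⟨4816, 2, ?_⟩, sqProg, queryProg, evalProg, sqTime, 4816, 2, ?_⟩
  · intro d α β hαβ c hc
    have hs : (0 : ℝ) ≤ maskedParity.size d c := Nat.cast_nonneg _
    obtain ⟨hα, hβ⟩ := hαβ.nonneg
    have hx := sqTime_add_le hαβ (x := d + maskedParity.size d c + 1 / α + Real.logb 2 (1 / β))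
      (d := d) (by linarith)
    have hA : (0 : ℝ) ≤ ⌈1 / α⌉₊ := Nat.cast_nonneg _
    refine ⟨?_, fun O hO => ?_⟩
    · refine ((queriesWithin_toSQ _ _ _ _ _ _ _ _ ?_).mono (fun _ h => h) ?_).mapOutput _
      · refine one_div_le_one_div_of_le (by positivity) (le_trans (le_of_eq ?_) hx)
        simp [Cmd.init, unary]
      · exact Nat.le_floor (by linarith)
    · rw [sqLearner, Alg.runSQ_mapOutput, runSQ_machineSQ hc hO, PMF.pure_map]
      rw [PMF.toOuterMeasure_pure_apply, if_pos]
      · rw [← ENNReal.ofReal_one]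
        exact ENNReal.ofReal_le_ofReal (by linarith [hαβ.2.1])
      · simpa [err_self] using hαβ.1.1.le
  · intro d α β hαβ
    have hA : (0 : ℝ) ≤ ⌈1 / α⌉₊ := Nat.cast_nonneg _
    refine ⟨by linarith [sqTime_add_le hαβ (le_refl ((d : ℝ) + 1 / α + Real.logb 2 (1 / β)))],
      fun c hc O hO => ?_, rfl⟩
    rw [runSQ_machineSQ hc hO]
    simp

/-! ### Local algorithms that use each entry of the database once -/

/-- The algorithm makes no random choices, puts one query to each of the entries `j, j + 1, …`,
with `ε`-local randomizers, and does not fail. -/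
def Tame {D H : Type} {N : ℕ} (ε : ℝ) :
    Alg (LRQuery D N) (List Bool) (Option H) → ℕ → Prop
  | .output o, _ => o ≠ none
  | .sample _ _, _ => False
  | .query q k, j => (q.1 : ℕ) = j ∧ IsLocalRandomizer ε q.2 ∧
      ∀ w ∈ LRQuery.reach q, Tame ε (k w) (j + 1)

theorem Tame.localWithin {D H : Type} {N : ℕ} {ε : ℝ}
    {P : Alg (LRQuery D N) (List Bool) (Option H)} {j : ℕ} (hP : Tame ε P j)
    {budget : Fin N → ℝ} (hb : ∀ i : Fin N, j ≤ i → budget i = ε) : P.LocalWithin budget := by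
  induction P generalizing j budget with
  | output _ => trivial
  | sample _ _ => exact hP.elim
  | query q k ih =>
    obtain ⟨h1, h2, h3⟩ := hP
    refine ⟨ε, h2, (hb q.1 h1.ge).ge, fun w hw => ih w (h3 w hw) fun i hi => ?_⟩
    rw [Function.update_of_ne]
    · exact hb i (by omega)
    · rintro rfl
      omega

theorem Tame.none_notMem {D H : Type} {N : ℕ} {ε : ℝ}
    {P : Alg (LRQuery D N) (List Bool) (Option H)} {j : ℕ} (hP : Tame ε P j) (z : Fin N → D) :
    none ∉ (P.runLR z).support := by
  induction P generalizing j with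
  | output o => simpa [Alg.runLR, eq_comm, Tame] using hP
  | sample _ _ => exact hP.elim
  | query q k ih =>
    simp only [Alg.runLR, PMF.mem_support_bind_iff, not_exists, not_and]
    exact fun w hw => ih w (hP.2.2 w ⟨_, hw⟩)

theorem Tame.runLR_update {D H : Type} {N : ℕ} {ε : ℝ}
    {P : Alg (LRQuery D N) (List Bool) (Option H)} {j : ℕ} (hP : Tame ε P j) (z : Fin N → D)
    (i : Fin N) (hi : (i : ℕ) < j) (u : D) : P.runLR (Function.update z i u) = P.runLR z := by
  induction P generalizing j with
  | output _ => rfl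
  | sample _ _ => exact hP.elim
  | query q k ih =>
    obtain ⟨h1, h2, h3⟩ := hP
    have hq : q.1 ≠ i := by
      rintro rfl
      omega
    simp only [Alg.runLR, Function.update_of_ne hq]
    exact PMF.bind_congr fun w hw => ih w (h3 w ⟨_, hw⟩) (by omega)

/-- The output of an algorithm whose queries are put to fresh random examples of `c`. -/
noncomputable def freshRun {X H : Type} [Fintype X] [Nonempty X] {N : ℕ} (c : X → Bool) :
    Alg (LRQuery (X × Bool) N) (List Bool) H → PMF H
  | .output h => PMF.pure h
  | .sample p k => p.bind fun i => freshRun c (k i)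
  | .query q k => ((PMF.uniformOfFintype X).bind fun x => q.2 (x, c x)).bind fun w =>
      freshRun c (k w)

theorem Tame.localOutput_eq {X H : Type} [Fintype X] [Nonempty X] {N : ℕ} {ε : ℝ} {c : X → Bool}
    {P : Alg (LRQuery (X × Bool) N) (List Bool) (Option H)} {j : ℕ} (hP : Tame ε P j) :
    localOutput P c = freshRun c P := by
  unfold localOutput
  induction P generalizing j with
  | output o => simp [Alg.runLR, freshRun]
  | sample _ _ => exact hP.elim
  | query q k ih =>
    obtain ⟨h1, h2, h3⟩ := hP
    rw [← uniform_bind_update q.1]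
    simp only [Alg.runLR, freshRun, Function.update_self, PMF.bind_bind]
    rw [PMF.bind_comm]
    congr 1
    funext u
    rw [PMF.bind_comm]
    refine PMF.bind_congr fun w hw => ?_
    rw [← ih w (h3 w ⟨_, hw⟩)]
    congr 1
    funext x
    have h4 : (fun i => (Function.update x q.1 u i, c (Function.update x q.1 u i)))
        = Function.update (fun i => (x i, c (x i))) q.1 (u, c u) := by
      funext i
      by_cases hi : i = q.1
      · subst hi; simp
      · simp [hi]
    rw [h4, (h3 w ⟨_, hw⟩).runLR_update _ _ (by omega)]

theorem Alg.runLR_mapOutput {D H H' : Type} {N : ℕ} (z : Fin N → D) (f : H → H')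
    (P : Alg (LRQuery D N) (List Bool) H) : (P.mapOutput f).runLR z = (P.runLR z).map f := by
  induction P with
  | output h => simp [Alg.mapOutput, Alg.runLR, PMF.pure_map]
  | sample p k ih => simp [Alg.mapOutput, Alg.runLR, PMF.map_bind, ih]
  | query q k ih => simp [Alg.mapOutput, Alg.runLR, PMF.map_bind, ih]

theorem Alg.LocalWithin.mapOutput {D H H' : Type} {N : ℕ} (f : H → H')
    {P : Alg (LRQuery D N) (List Bool) H} {budget : Fin N → ℝ} (h : P.LocalWithin budget) :
    (P.mapOutput f).LocalWithin budget := by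
  induction P generalizing budget with
  | output _ => trivial
  | sample p k ih => exact fun i hi => ih i (h i hi)
  | query q k ih =>
    obtain ⟨e, h1, h2, h3⟩ := h
    exact ⟨e, h1, h2, fun w hw => ih w (h3 w hw)⟩

/-- A machine asks at most as many queries as it makes steps. -/
theorem queriesWithin_toLocal (R E : Cmd) (T₀ N : ℕ) (X : Finset (List Bool))
    (reach : LRQuery (X × Bool) N → Set (List Bool)) (T : ℕ) (x : Cfg) :
    (toLocal R E T₀ N X (execOracle T x)).QueriesWithin reach (fun _ => True) T := by
  induction T generalizing x with
  | zero =>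
    obtain ⟨_ | ⟨c, K⟩, s⟩ := x <;> simp [execOracle, toLocal, Alg.QueriesWithin]
  | succ T ih =>
    obtain ⟨_ | ⟨c, K⟩, s⟩ := x
    · simp [execOracle, toLocal, Alg.QueriesWithin]
    · have up : ∀ y : Cfg, (toLocal R E T₀ N X (execOracle T y)).QueriesWithin reach
          (fun _ => True) (T + 1) := fun y => (ih y).mono (fun _ h => h) (by omega)
      cases hstep : c.step K s with
      | next y =>
        simp only [execOracle, hstep]
        exact up y
      | coin k =>
        simp only [execOracle, hstep]
        exact fun b _ => up (k b)
      | ask q r k =>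
        simp only [execOracle, hstep, toLocal]
        split_ifs with hG
        · exact ⟨trivial, fun a _ => ih _⟩
        · trivial

/-! ### Noisy bits -/

theorem noisy_toReal (o : Option Bool) (k : ℕ) (b : Bool) : (noisy o k b).toReal =
    1 / 2 + (1 / 2) ^ k * (o.elim (1 / 2) (fun b' => if b' = b then 1 else 0) - 1 / 2) := by
  induction k with
  | zero =>
    cases o with
    | none => simp [noisy]
    | some b' =>
      by_cases h : b = b'
      · simp [noisy, h]
      · simp [noisy, h, Ne.symm h]
  | succ k ih =>
    rw [noisy, PMF.bind_apply, tsum_fintype, Fintype.sum_bool, ENNReal.toReal_add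
      (ENNReal.mul_ne_top (PMF.apply_ne_top _ _) (PMF.apply_ne_top _ _))
      (ENNReal.mul_ne_top (PMF.apply_ne_top _ _) (PMF.apply_ne_top _ _)),
      ENNReal.toReal_mul, ENNReal.toReal_mul]
    simp only [if_true, Bool.false_eq_true, if_false, ih, PMF.uniformOfFintype_apply]
    simp
    ring

theorem abs_noisy_sub_le (o : Option Bool) (k : ℕ) (b : Bool) :
    |(noisy o k b).toReal - 1 / 2| ≤ (1 / 2) ^ k / 2 := by
  have h : (0 : ℝ) < (1 / 2) ^ k := by positivity
  rw [noisy_toReal, add_sub_cancel_left, abs_mul, abs_of_pos h, div_eq_mul_inv _ (2 : ℝ)]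
  refine mul_le_mul_of_nonneg_left ?_ h.le
  cases o with
  | none => simp
  | some b' =>
    simp only [Option.elim_some]
    split_ifs <;> norm_num [abs_of_neg]

theorem map_singleton_apply (p : PMF Bool) (b : Bool) : (p.map fun b => [b]) [b] = p b := by
  rw [PMF.map_apply, tsum_fintype, Fintype.sum_bool]
  cases b <;> simp

theorem isLocalRandomizer_noisy {D : Type} (o : D → Option Bool) {k : ℕ} {ε : ℝ} (hk : k ≠ 0)
    (hε : 4 * (1 / 2) ^ k ≤ ε) :
    IsLocalRandomizer ε fun u => (noisy (o u) k).map fun b => [b] := by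
  intro u u' w
  have hw : (∃ b : Bool, w = [b]) ∨ ∀ p : PMF Bool, (p.map fun b => [b]) w = 0 := by
    by_cases h : ∃ b : Bool, w = [b]
    · exact .inl h
    · refine .inr fun p => ?_
      rw [PMF.map_apply, ENNReal.tsum_eq_zero]
      intro b
      rw [if_neg fun hb => h ⟨b, hb⟩]
  rcases hw with ⟨b, rfl⟩ | hw
  · beta_reduce
    rw [map_singleton_apply, map_singleton_apply]
    rw [← ENNReal.ofReal_toReal (PMF.apply_ne_top (noisy (o u) k) b),
      ← ENNReal.ofReal_toReal (PMF.apply_ne_top (noisy (o u') k) b),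
      ← ENNReal.ofReal_mul (Real.exp_pos _).le]
    refine ENNReal.ofReal_le_ofReal ?_
    have h1 := (abs_le.1 (abs_noisy_sub_le (o u) k b)).2
    have h2 := (abs_le.1 (abs_noisy_sub_le (o u') k b)).1
    set t : ℝ := (1 / 2) ^ k with ht
    have ht0 : 0 < t := by positivity
    have ht1 : t ≤ 1 / 2 := by
      obtain ⟨k, rfl⟩ := Nat.exists_eq_succ_of_ne_zero hk
      rw [ht, pow_succ]
      have : ((1 : ℝ) / 2) ^ k ≤ 1 := pow_le_one₀ (by norm_num) (by norm_num)
      linarith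
    have h3 : 1 + 4 * t ≤ Real.exp ε := by linarith [Real.add_one_le_exp ε]
    calc (noisy (o u) k b).toReal ≤ 1 / 2 + t / 2 := by linarith
      _ ≤ (1 + 4 * t) * (1 / 2 - t / 2) := by nlinarith
      _ ≤ Real.exp ε * (noisy (o u') k b).toReal := by
        refine mul_le_mul h3 (by linarith) (by linarith) (Real.exp_pos _).le
  · beta_reduce
    rw [hw, hw]
    simp

/-- The probability that the noisy answer to a query about a random example of `c` is `b`. -/
noncomputable def answerProb {X : Finset (List Bool)} (c : X → Bool) (m : Bool) (v : List Bool)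
    (k : ℕ) (b : Bool) : ℝ :=
  avg fun x : X => (noisy (contribution m v x.1 (c x)) k b).toReal

theorem Reveals.answerProb_eq {d : ℕ} {c : maskedParity.X d → Bool} {m : Bool} {v : List Bool}
    {b : Bool} (h : Reveals d c m v b) (k : ℕ) :
    ∃ g : ℝ, (1 / 2) ^ k / (4 * dim d) ≤ g ∧
      answerProb c m v k b = 1 / 2 + g ∧ answerProb c m v k (!b) = 1 / 2 - g := by
  obtain ⟨p, hp, -, hg⟩ := h
  refine ⟨p * (1 / 2) ^ k / 2, ?_, ?_, ?_⟩
  · calc ((1 : ℝ) / 2) ^ k / (4 * dim d) = 1 / (2 * dim d) * (1 / 2) ^ k / 2 := by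
          rw [div_mul_eq_mul_div, one_mul, div_div]
          congr 1
          ring
      _ ≤ _ := by gcongr
  · rw [answerProb, hg fun o => (noisy o k b).toReal, noisy_toReal, noisy_toReal]
    simp
    ring
  · rw [answerProb, hg fun o => (noisy o k (!b)).toReal, noisy_toReal, noisy_toReal]
    simp
    ring

/-- One step of the analysis of a majority vote by exponential moments. -/
theorem moment_step {γ g : ℝ} (h0 : 0 ≤ γ) (hg : γ ≤ g) :
    (1 / 2 + g) * (1 + γ)⁻¹ + (1 / 2 - g) * (1 + γ) ≤ 1 - γ ^ 2 := by
  have h2 : 0 < 1 + γ := by linarith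
  rw [← div_eq_mul_inv, ← le_sub_iff_add_le, div_le_iff₀ h2]
  nlinarith [mul_nonneg h0 h0, mul_nonneg (mul_nonneg h0 h0) h0,
    mul_nonneg (sub_nonneg.2 hg) h0, mul_nonneg (mul_nonneg (sub_nonneg.2 hg) h0) h0]

/-! ### The local learner -/

/-- All computations with time at least `B` that start at the configuration `x` are tame from the
entry `j` on, and fail to output `c` with probability at most `φ`. -/
def LGood {d : ℕ} (c : maskedParity.X d → Bool) (ε : ℝ) (T₀ N B j : ℕ) (φ : ℝ) (x : Cfg) : Prop :=
  ∀ T, B ≤ T →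
    Tame ε (toLocal randomizerProg evalProg T₀ N (maskedParity.dom d) (execOracle T x)) j ∧
    (freshRun c (toLocal randomizerProg evalProg T₀ N (maskedParity.dom d)
      (execOracle T x))).toOuterMeasure {o | o ≠ some c} ≤ ENNReal.ofReal φ

section

variable {d : ℕ} {c : maskedParity.X d → Bool} {ε : ℝ} {T₀ N : ℕ}

theorem LGood.mono {B B' j : ℕ} {φ φ' : ℝ} {x : Cfg} (h : LGood c ε T₀ N B j φ x) (hB : B ≤ B')
    (hφ : φ ≤ φ') : LGood c ε T₀ N B' j φ' x := fun T hT =>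
  ⟨(h T (hB.trans hT)).1, (h T (hB.trans hT)).2.trans (ENNReal.ofReal_le_ofReal hφ)⟩

theorem LGood.of_one_le {B j : ℕ} {φ φ' : ℝ} {x : Cfg} (h : LGood c ε T₀ N B j φ x) (hφ : 1 ≤ φ') :
    LGood c ε T₀ N B j φ' x := fun T hT =>
  ⟨(h T hT).1, (PMF.toOuterMeasure_le_one _ _).trans (by
    rw [← ENNReal.ofReal_one]; exact ENNReal.ofReal_le_ofReal hφ)⟩

theorem Reach.lGood {t B j : ℕ} {φ : ℝ} {x y : Cfg} (hxy : Reach t x y)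
    (hy : LGood c ε T₀ N B j φ y) : LGood c ε T₀ N (B + t) j φ x := by
  intro T hT
  obtain ⟨T', h1, h2⟩ := hxy.back execOracle_next (T - t)
  rw [Nat.sub_add_cancel (by omega)] at h2
  rw [h2]
  exact hy _ (by omega)

open Classical in
theorem lGood_nil (B j : ℕ) (s : Store) (hT : 15 * (s 0).length + 10 ≤ T₀) :
    LGood c ε T₀ N B j (if c = fun x => ip (s 0) x.1 then 0 else 1) ([], s) := by
  intro T _
  rw [execOracle_nil]
  simp only [toLocal, Option.bind_some, decodeHyp_evalProg _ (s 0) hT]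
  refine ⟨by simp [Tame], ?_⟩
  rw [freshRun, PMF.toOuterMeasure_pure_apply]
  split_ifs with h1 h2 h2
  · exact (h1 (by rw [h2])).elim
  · simp
  · simp
  · simp

theorem answerProb_nonneg (m : Bool) (v : List Bool) (k : ℕ) (b : Bool) :
    0 ≤ answerProb c m v k b := by
  unfold answerProb avg
  positivity

theorem uniform_bind_noisy_apply (m : Bool) (v : List Bool) (k : ℕ) (b : Bool) :
    ((PMF.uniformOfFintype (maskedParity.X d)).bind
      fun x => noisy (contribution m v x.1 (c x)) k) b = ENNReal.ofReal (answerProb c m v k b) := by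
  rw [← ENNReal.ofReal_toReal (PMF.apply_ne_top _ b)]
  congr 1
  rw [PMF.bind_apply, tsum_fintype, ENNReal.toReal_sum
    (fun x _ => ENNReal.mul_ne_top (PMF.apply_ne_top _ _) (PMF.apply_ne_top _ _)), answerProb, avg,
    Finset.sum_div]
  refine Finset.sum_congr rfl fun x _ => ?_
  rw [ENNReal.toReal_mul, PMF.uniformOfFintype_apply, ENNReal.toReal_inv, ENNReal.toReal_natCast]
  ring

theorem lGood_call {B j k : ℕ} {K : List Cmd} {s : Store} {m : Bool} {v : List Bool}
    (hs : s 0 = unary k ++ false :: m :: v) (hj : (s 1).length = j) (hjN : j < N)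
    (hT : 15 * v.length + 15 * k + 70 ≤ T₀) (hk : k ≠ 0) (hε : 4 * (1 / 2) ^ k ≤ ε) (φ : Bool → ℝ)
    (hφ : ∀ b, 0 ≤ φ b) (hK : ∀ b, LGood c ε T₀ N B (j + 1) (φ b) (K, Function.update s 2 [b])) :
    LGood c ε T₀ N (B + 1) j
      (answerProb c m v k true * φ true + answerProb c m v k false * φ false)
      (.call :: K, s) := by
  intro T hT'
  obtain ⟨T, rfl⟩ : ∃ T', T = T' + 1 := ⟨T - 1, by omega⟩
  have hcond : (s 1).length < N ∧ ∀ u : maskedParity.dom d × Bool,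
      none ∉ (execRandom T₀ (randomizerProg.init [s 0, u.1, [u.2]])).support := by
    refine ⟨hj ▸ hjN, fun u => ?_⟩
    rw [hs, execRandom_randomizerProg k m v _ _ hT]
    simp
  have hR : ∀ u : maskedParity.dom d × Bool,
      (execRandom T₀ (randomizerProg.init [s 0, u.1, [u.2]])).map (fun o => o.getD [])
        = (noisy (contribution m v u.1 u.2) k).map fun b => [b] := by
    intro u
    rw [hs, execRandom_randomizerProg k m v _ _ hT, PMF.map_comp]
    rfl
  simp only [execOracle, Cmd.step, toLocal]
  rw [dif_pos hcond]
  simp only [hR]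
  refine ⟨⟨hj, isLocalRandomizer_noisy _ hk hε, ?_⟩, ?_⟩
  · rintro w ⟨u, hw⟩
    simp only [PMF.support_map, Set.mem_image] at hw
    obtain ⟨b, -, rfl⟩ := hw
    exact (hK b T (by omega)).1
  · simp only [freshRun]
    rw [← PMF.map_bind, PMF.bind_map, PMF.toOuterMeasure_bind_apply, tsum_fintype,
      Fintype.sum_bool]
    simp only [uniform_bind_noisy_apply]
    rw [ENNReal.ofReal_add (mul_nonneg (answerProb_nonneg _ _ _ _) (hφ _))
      (mul_nonneg (answerProb_nonneg _ _ _ _) (hφ _)),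
      ENNReal.ofReal_mul (answerProb_nonneg _ _ _ _), ENNReal.ofReal_mul (answerProb_nonneg _ _ _ _)]
    exact add_le_add (mul_le_mul_right (hK true T (by omega)).2 _)
      (mul_le_mul_right (hK false T (by omega)).2 _)

end

/-- Put the query in register `0` to the next entry and count the answer. -/
def voteStep : Cmd :=
  .seq (.pop 9) (.seq .call (.seq (.push 1 true) (.test 2 .skip (.push 11 true) (.push 10 true))))

/-- Push the majority of the answers onto register `5`. -/
def voteEnd : Cmd :=
  .seq (.loop 11 (.seq (.pop 11) (.pop 10)))
    (.seq (.test 10 (.push 5 false) .skip (.push 5 true)) (clear 10))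

/-- Find out a bit by a majority vote. -/
def voteProg : Cmd := .seq (app 8 6 9) (.seq (.loop 9 voteStep) voteEnd)

/-- The stores that occur during a vote: `m` queries are still to be asked, and there were `p` and `f`
answers `true` and `false`. -/
def voteStore (l0 : List Bool) (j : ℕ) (l2 l3 : List Bool) (i : ℕ) (l5 : List Bool) (k N m p f : ℕ)
    (tail : List (List Bool)) : Store :=
  st (l0 :: unary j :: l2 :: l3 :: List.replicate i false :: l5 :: [] :: unary k :: unary N ::
    unary m :: unary p :: unary f :: tail)

theorem runs_voteEnd (l0 : List Bool) (j : ℕ) (l2 l3 : List Bool) (i : ℕ) (l5 : List Bool)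
    (k N p f : ℕ) (tail : List (List Bool)) :
    Runs voteEnd (voteStore l0 j l2 l3 i l5 k N 0 p f tail)
      (voteStore l0 j l2 l3 i (decide (f < p) :: l5) k N 0 0 0 tail) (4 * f + 2 * p + 20) := by
  have h1 : Runs (.loop 11 (.seq (.pop 11) (.pop 10))) (voteStore l0 j l2 l3 i l5 k N 0 p f tail)
      (voteStore l0 j l2 l3 i l5 k N 0 (p - f) 0 tail) (4 * f + 1) := by
    induction f generalizing p with
    | zero => exact (Runs.loop_nil rfl).mono (by omega)
    | succ f ih =>
      have h := ih (p - 1)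
      rw [show p - 1 - f = p - (f + 1) by omega] at h
      refine (Runs.loop_cons (by simp [voteStore, st_apply, unary, List.replicate_succ])
        (Cmd.Straight.runs_of_eq ?_ ?_) h).mono ?_
      · simp [Cmd.Straight]
      · simp [Cmd.eval, st_apply, update_st, unary, List.replicate_succ, voteStore]
      · simp [Cmd.cost]; omega
  have h2 : Runs (.test 10 (.push 5 false) .skip (.push 5 true))
      (voteStore l0 j l2 l3 i l5 k N 0 (p - f) 0 tail)
      (voteStore l0 j l2 l3 i (decide (f < p) :: l5) k N 0 (p - f) 0 tail) 4 := by
    refine (Cmd.Straight.runs_of_eq (by simp [Cmd.Straight]) ?_).mono (by simp [Cmd.cost])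
    by_cases hfp : f < p
    · obtain ⟨t, ht⟩ : ∃ t, p - f = t + 1 := ⟨p - f - 1, by omega⟩
      simp [Cmd.eval, st_apply, update_st, unary, List.replicate_succ, voteStore, ht, hfp]
    · have ht : p - f = 0 := by omega
      simp [Cmd.eval, st_apply, update_st, unary, voteStore, ht, hfp]
  have h3 : Runs (clear 10) (voteStore l0 j l2 l3 i (decide (f < p) :: l5) k N 0 (p - f) 0 tail)
      (voteStore l0 j l2 l3 i (decide (f < p) :: l5) k N 0 0 0 tail) (2 * (p - f) + 1) := by
    refine ((runs_clear 10 _).mono ?_).of_eq ?_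
    · simp [voteStore, st_apply, unary]
    · simp [voteStore, update_st, unary]
  exact (h1.seq (h2.seq h3)).mono (by omega)

theorem one_le_pow_mul_inv_pow {x : ℝ} (hx : 1 ≤ x) {w r : ℕ} (h : r ≤ w) :
    1 ≤ x ^ w * x⁻¹ ^ r := by
  have h0 : x ≠ 0 := by positivity
  rw [inv_pow, ← pow_sub₀ x h0 h]
  exact one_le_pow₀ hx

/-- The advantage of the correct answer over the wrong one in a noisy query. -/
noncomputable def advantage (d k : ℕ) : ℝ := (1 / 2) ^ k / (4 * dim d)

theorem advantage_nonneg (d k : ℕ) : 0 ≤ advantage d k := by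
  unfold advantage
  positivity

theorem advantage_le_one (d k : ℕ) : advantage d k ≤ 1 := by
  unfold advantage
  rcases Nat.eq_zero_or_pos (dim d) with h | h
  · simp [h]
  · have h1 : (1 : ℝ) ≤ dim d := by exact_mod_cast h
    have h2 : ((1 : ℝ) / 2) ^ k ≤ 1 := pow_le_one₀ (by norm_num) (by norm_num)
    rw [div_le_one (by positivity)]
    linarith

/-- The exponential moment that bounds the probability of a wrong majority, if `m` queries are
still to be asked and there were `p` and `f` answers `true` and `false`. -/
noncomputable def potential (γ : ℝ) (b : Bool) (p f m : ℕ) : ℝ :=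
  (1 + γ) ^ (if b then f else p) * (1 + γ)⁻¹ ^ (if b then p else f) * (1 - γ ^ 2) ^ m

theorem potential_nonneg {γ : ℝ} (h0 : 0 ≤ γ) (h1 : γ ≤ 1) (b : Bool) (p f m : ℕ) :
    0 ≤ potential γ b p f m := by
  have : 0 ≤ 1 - γ ^ 2 := by nlinarith
  unfold potential
  positivity

theorem vote_step_le {d : ℕ} {c : maskedParity.X d → Bool} {m b : Bool} {v : List Bool}
    (hb : Reveals d c m v b) (k : ℕ) (φ : ℝ) (p f t : ℕ) :
    answerProb c m v k true * (φ + potential (advantage d k) b (p + 1) f t)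
      + answerProb c m v k false * (φ + potential (advantage d k) b p (f + 1) t)
      ≤ φ + potential (advantage d k) b p f (t + 1) := by
  obtain ⟨g, hg, h1, h2⟩ := hb.answerProb_eq k
  have h3 := moment_step (advantage_nonneg d k) hg
  have h4 : 0 ≤ 1 - advantage d k ^ 2 := by
    nlinarith [advantage_nonneg d k, advantage_le_one d k]
  have h5 := advantage_nonneg d k
  set γ := advantage d k
  have h6 : ∀ w r : ℕ, 0 ≤ (1 + γ) ^ w * (1 + γ)⁻¹ ^ r * (1 - γ ^ 2) ^ t := fun w r => by positivity
  cases b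
  · simp only [Bool.not_false] at h2
    rw [h1, h2]
    simp only [potential, Bool.false_eq_true, if_false]
    have := mul_le_mul_of_nonneg_left h3 (h6 p f)
    ring_nf at this ⊢
    linarith
  · simp only [Bool.not_true] at h2
    rw [h1, h2]
    simp only [potential, if_true]
    have := mul_le_mul_of_nonneg_left h3 (h6 f p)
    ring_nf at this ⊢
    linarith

section

variable {d : ℕ} {c : maskedParity.X d → Bool} {ε : ℝ} {T₀ Ndb : ℕ}

theorem lGood_voteStep {k : ℕ} (hk : k ≠ 0) (hε : 4 * (1 / 2) ^ k ≤ ε) {m b : Bool}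
    {v l3 l5 : List Bool} {i N B J M : ℕ} {tail : List (List Bool)} {K : List Cmd} {φ : ℝ}
    (hφ : 0 ≤ φ) (hb : Reveals d c m v b ∨ 1 ≤ φ) (hT : 15 * v.length + 15 * k + 70 ≤ T₀)
    (hJ : J ≤ Ndb)
    (hK : ∀ l2 b', LGood c ε T₀ Ndb B J (if b' = b then φ else 1)
      (K, voteStore (unary k ++ false :: m :: v) J l2 l3 i (b' :: l5) k N 0 0 0 tail))
    (t j p f : ℕ) (l2 : List Bool) (hj : j + t = J) (hM : p + f + t = M) :
    LGood c ε T₀ Ndb (B + 4 * M + 25 + 20 * t) j (φ + potential (advantage d k) b p f t)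
      (.loop 9 voteStep :: voteEnd :: K,
        voteStore (unary k ++ false :: m :: v) j l2 l3 i l5 k N t p f tail) := by
  induction t generalizing j p f l2 with
  | zero =>
    obtain rfl : j = J := by omega
    refine ((Reach.loop_nil rfl).lGood ((runs_voteEnd _ _ _ _ _ _ _ _ _ _ _ _).lGood
      (hK l2 _))).mono (by omega) ?_
    have h1 := potential_nonneg (advantage_nonneg d k) (advantage_le_one d k) b p f 0
    split_ifs with hd
    · linarith
    · suffices 1 ≤ potential (advantage d k) b p f 0 by linarith
      simp only [potential, pow_zero, mul_one]
      refine one_le_pow_mul_inv_pow (by linarith [advantage_nonneg d k]) ?_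
      cases b
      · simp at hd ⊢; omega
      · simp at hd ⊢; omega
  | succ t ih =>
    have h1 : Runs (.pop 9) (voteStore (unary k ++ false :: m :: v) j l2 l3 i l5 k N (t + 1) p f tail)
        (voteStore (unary k ++ false :: m :: v) j l2 l3 i l5 k N t p f tail) 1 := by
      refine (Cmd.Straight.runs_of_eq (by simp [Cmd.Straight]) ?_).mono (by simp [Cmd.cost])
      simp [Cmd.eval, st_apply, update_st, unary, voteStore]
    have h2 : ∀ b', Runs (.seq (.push 1 true) (.test 2 .skip (.push 11 true) (.push 10 true)))
        (Function.update (voteStore (unary k ++ false :: m :: v) j l2 l3 i l5 k N t p f tail) 2 [b'])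
        (voteStore (unary k ++ false :: m :: v) (j + 1) [b'] l3 i l5 k N t
          (if b' then p + 1 else p) (if b' then f else f + 1) tail) 10 := by
      intro b'
      refine (Cmd.Straight.runs_of_eq (by simp [Cmd.Straight]) ?_).mono (by simp [Cmd.cost])
      cases b' <;> simp [Cmd.eval, st_apply, update_st, unary, voteStore, List.replicate_succ]
    have h3 : ∀ b', LGood c ε T₀ Ndb (B + 4 * M + 25 + 20 * t + 10) (j + 1)
        (φ + potential (advantage d k) b (if b' then p + 1 else p) (if b' then f else f + 1) t)
        ([.seq (.push 1 true) (.test 2 .skip (.push 11 true) (.push 10 true)),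
          .loop 9 voteStep, voteEnd] ++ K, Function.update
          (voteStore (unary k ++ false :: m :: v) j l2 l3 i l5 k N t p f tail) 2 [b']) := by
      intro b'
      refine (h2 b' _).lGood (ih (j + 1) _ _ [b'] (by omega) ?_)
      cases b' <;> simp <;> omega
    have h4 := lGood_call (N := Ndb) (B := B + 4 * M + 25 + 20 * t + 10) (j := j) (k := k)
      (s := voteStore (unary k ++ false :: m :: v) j l2 l3 i l5 k N t p f tail) (m := m) (v := v)
      rfl (by simp [voteStore, st_apply, unary]) (by omega) hT hk hε _
      (fun b' => add_nonneg hφ (potential_nonneg (advantage_nonneg d k) (advantage_le_one d k) b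
        (if b' then p + 1 else p) (if b' then f else f + 1) t)) h3
    have h5 := (Reach.loop (r := 9) (c := voteStep)
      (s := voteStore (unary k ++ false :: m :: v) j l2 l3 i l5 k N (t + 1) p f tail)
      (K := voteEnd :: K) (by simp [voteStore, st_apply, unary])).lGood
      ((Reach.seq _ _ _ _).lGood ((h1 _).lGood ((Reach.seq _ _ _ _).lGood h4)))
    rcases hb with hb | hb
    · refine h5.mono (by omega) ?_
      simpa using vote_step_le hb k φ p f t
    · refine (h5.of_one_le ?_).mono (by omega) le_rfl
      have := potential_nonneg (advantage_nonneg d k) (advantage_le_one d k) b p f (t + 1)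
      linarith

theorem lGood_voteProg {k : ℕ} (hk : k ≠ 0) (hε : 4 * (1 / 2) ^ k ≤ ε) {m b : Bool}
    {v l2 l3 l5 : List Bool} {i N B j : ℕ} {tail : List (List Bool)} {K : List Cmd} {φ : ℝ}
    (hφ : 0 ≤ φ) (hb : Reveals d c m v b ∨ 1 ≤ φ) (hT : 15 * v.length + 15 * k + 70 ≤ T₀)
    (hJ : j + N ≤ Ndb)
    (hK : ∀ l2 b', LGood c ε T₀ Ndb B (j + N) (if b' = b then φ else 1)
      (K, mainStore (unary k ++ false :: m :: v) (unary (j + N)) l2 l3 i (b' :: l5) k (unary N)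
        tail)) :
    LGood c ε T₀ Ndb (B + 46 * N + 30) j (φ + (1 - advantage d k ^ 2) ^ N)
      (voteProg :: K,
        mainStore (unary k ++ false :: m :: v) (unary j) l2 l3 i l5 k (unary N) tail) := by
  have h1 : Runs (app 8 6 9)
      (mainStore (unary k ++ false :: m :: v) (unary j) l2 l3 i l5 k (unary N) tail)
      (voteStore (unary k ++ false :: m :: v) j l2 l3 i l5 k N N 0 0 tail) (22 * N + 3) := by
    refine ((runs_app (by simp) (by simp) (by simp) rfl).mono ?_).of_eq ?_
    · simp [mainStore, st_apply, unary]
    · simp [mainStore, voteStore, st_apply, update_st, unary]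
  have h2 := lGood_voteStep hk hε (T₀ := T₀) (M := N) hφ hb hT hJ hK N j 0 0 l2 rfl (by omega)
  have h3 := (Reach.seq _ _ _ _).lGood ((h1 _).lGood ((Reach.seq _ _ _ _).lGood h2))
  refine h3.mono (by omega) ?_
  simp [potential]

open Classical in
theorem lGood_learnProg {k : ℕ} (hk : k ≠ 0) (hε : 4 * (1 / 2) ^ k ≤ ε) (a : Bool)
    (r : Fin (dim d) → Bool) {N : ℕ} (hT : 15 * dim d + 15 * k + 100 ≤ T₀)
    (hN : Ndb = (dim d + 1) * N) (l2 l3 : List Bool) (tail : List (List Bool)) :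
    LGood c ε T₀ Ndb (400 * (dim d + 1) * (N + dim d + k + 3)) 0
      (if dim d ≠ 0 ∧ c = (fun x => ip (a :: List.ofFn r) x.1) then
        (dim d + 1) * (1 - advantage d k ^ 2) ^ N else 1)
      ([learnProg voteProg],
        mainStore [] (unary 0) l2 l3 (dim d) [] k (unary N) tail) := by
  set δ : ℝ := (1 - advantage d k ^ 2) ^ N with hδ
  have hδ0 : 0 ≤ δ := by
    have : 0 ≤ 1 - advantage d k ^ 2 := by
      nlinarith [advantage_nonneg d k, advantage_le_one d k]
    positivity
  set Hc : Prop := dim d ≠ 0 ∧ c = (fun x => ip (a :: List.ofFn r) x.1) with hHc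
  set W : ℕ := N + dim d + k + 3 with hW
  have key : ∀ i ≤ dim d, ∀ (j : ℕ) (l0 l2 l5 : List Bool), j + (i + 1) * N = Ndb →
      l0.length ≤ dim d + k + 3 → l5.length + i = dim d →
      LGood c ε T₀ Ndb (300 * W + i * (100 * W)) j
        (if Hc ∧ l5 = (List.ofFn r).drop i then (i + 1) * δ else 1)
        ([.loop 4 (.seq indexPrep voteProg),
          .seq finalPrep (.seq voteProg (.seq (clear 0) (app 5 6 0)))],
        mainStore l0 (unary j) l2 l3 i l5 k (unary N) tail) := by
    intro i
    induction i with
    | zero =>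
      intro _ j l0 l2 l5 hj hl0 hl5
      have h1 : ∀ (φ : ℝ), φ = (if Hc ∧ l5 = List.ofFn r then 0 else 1) →
          ∀ l2 b', LGood c ε T₀ Ndb (24 * W + 30) (j + N) (if b' = a then φ else 1)
          ([.seq (clear 0) (app 5 6 0)],
            mainStore (unary k ++ false :: true :: l5) (unary (j + N)) l2 l3 0 (b' :: l5) k (unary N)
              tail) := by
        intro φ hφ l2 b'
        have h2 := (runs_outputResult (unary k ++ false :: true :: l5) (unary (j + N)) l2 l3 0
          (b' :: l5) k (unary N) tail []).lGood (lGood_nil (c := c) (ε := ε) (T₀ := T₀) (N := Ndb)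
            0 (j + N) _ (by simp [mainStore, st_apply]; omega))
        by_cases hgood : Hc ∧ l5 = List.ofFn r ∧ b' = a
        · obtain ⟨⟨-, hc⟩, rfl, rfl⟩ := hgood
          refine h2.mono (by simp [unary]; omega) ?_
          rw [if_pos]
          · rw [hφ]; split_ifs <;> norm_num
          · exact hc
        · refine (h2.of_one_le ?_).mono (by simp [unary]; omega) le_rfl
          split_ifs with h3
          · rw [hφ, if_neg fun h => hgood ⟨h.1, h.2, h3⟩]
          · exact le_rfl
      have h2 := lGood_voteProg (c := c) (T₀ := T₀) (Ndb := Ndb) hk hε (l2 := l2) (m := true)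
        (b := a) (v := l5) (j := j) (φ := if Hc ∧ l5 = List.ofFn r then 0 else 1)
        (by split_ifs <;> norm_num) (by
          split_ifs with h
          · left
            obtain ⟨⟨hd, rfl⟩, rfl⟩ := h
            exact reveals_ofFn hd a r
          · exact .inr le_rfl) (by omega) (by omega) (h1 _ rfl)
      have h3 := (Reach.loop_nil (r := 4) (c := .seq indexPrep voteProg)
        (s := mainStore l0 (unary j) l2 l3 0 l5 k (unary N) tail) rfl).lGood
        ((Reach.seq _ _ _ _).lGood ((runs_finalPrep _ _ _ _ _ _ _ _ _ _).lGood
          ((Reach.seq _ _ _ _).lGood h2)))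
      by_cases hgood : Hc ∧ l5 = List.ofFn r
      · refine h3.mono (by omega) ?_
        simp [hgood, ← hδ]
      · refine (h3.of_one_le ?_).mono (by omega) le_rfl
        simp [hgood]
    | succ i ih =>
      intro hi j l0 l2 l5 hj hl0 hl5
      have hmul := add_one_mul (i + 1) N
      have hmul' := add_one_mul i (100 * W)
      have hdrop : (List.ofFn r).drop i = r ⟨i, hi⟩ :: (List.ofFn r).drop (i + 1) := by
        rw [List.drop_eq_getElem_cons (by simpa using hi), List.getElem_ofFn]
      set φ : ℝ := if Hc ∧ l5 = (List.ofFn r).drop (i + 1) then (i + 1) * δ else 1 with hφ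
      have hφ0 : 0 ≤ φ := by
        rw [hφ]
        split_ifs <;> positivity
      have h1 : ∀ l2 b', LGood c ε T₀ Ndb (300 * W + i * (100 * W)) (j + N)
          (if b' = r ⟨i, hi⟩ then φ else 1)
          ([.loop 4 (.seq indexPrep voteProg),
            .seq finalPrep (.seq voteProg (.seq (clear 0) (app 5 6 0)))],
          mainStore (unary k ++ false :: false :: selector i) (unary (j + N)) l2 l3 i (b' :: l5) k
            (unary N) tail) := by
        intro l2 b'
        have h2 := ih (by omega) (j + N) (unary k ++ false :: false :: selector i) l2 (b' :: l5)
          (by omega) (by simp [unary, selector]; omega) (by simp; omega)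
        simp only [hdrop, List.cons.injEq] at h2
        by_cases hb' : b' = r ⟨i, hi⟩
        · simpa [hb', hφ] using h2
        · simpa [hb'] using h2
      have h2 := lGood_voteProg (c := c) (T₀ := T₀) (Ndb := Ndb) hk hε (l2 := l2) (m := false)
        (b := r ⟨i, hi⟩) (v := selector i) (j := j) hφ0 (by
          rw [hφ]
          split_ifs with h
          · left
            obtain ⟨⟨hd, rfl⟩, -⟩ := h
            exact reveals_selector hd a r ⟨i, hi⟩
          · exact .inr le_rfl) (by simp [selector]; omega) (by omega) h1
      have h3 := (Reach.loop (r := 4) (c := .seq indexPrep voteProg)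
        (s := mainStore l0 (unary j) l2 l3 (i + 1) l5 k (unary N) tail)
        (by simp [mainStore, st_apply])).lGood
        ((Reach.seq _ _ _ _).lGood ((runs_indexPrep _ _ _ _ _ _ _ _ _ _).lGood h2))
      by_cases hgood : Hc ∧ l5 = (List.ofFn r).drop (i + 1)
      · refine h3.mono (by omega) ?_
        rw [hφ, if_pos hgood, if_pos hgood, ← hδ]
        push_cast
        linarith
      · refine (h3.of_one_le ?_).mono (by omega) le_rfl
        rw [if_neg hgood]
  have h1 := key (dim d) le_rfl 0 [] l2 [] (by rw [hN]; omega) (by simp) (by simp)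
  have h2 : ([] : List Bool) = (List.ofFn r).drop (dim d) := by
    rw [List.drop_of_length_le (by simp)]
  simp only [← h2, and_true] at h1
  refine ((Reach.seq _ _ _ _).lGood h1).mono ?_ le_rfl
  have h3 : 400 * (dim d + 1) * W = 400 * (dim d * W) + 400 * W := by ring
  have h4 : dim d * (100 * W) = 100 * (dim d * W) := by ring
  omega

end

/-! ### Preparations of the local learner -/

theorem unary_append (a b : ℕ) : unary a ++ unary b = unary (a + b) := by
  simp [unary]

/-- The stores that occur during the preparations of the local learner. -/
def prepStore (l0 l1 l2 l3 : List Bool) (k N x y a b s t : ℕ) : Store :=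
  st [l0, l1, l2, l3, [], [], [], unary k, unary N, unary x, unary y, [], unary a, unary b, unary s,
    unary t]

/-- Replace the number in register `8` by its square. -/
def squareProg : Cmd :=
  .seq (app 8 6 9) (.seq (.loop 9 (.seq (.pop 9) (app 8 6 10)))
    (.seq (clear 8) (.seq (app 10 6 8) (clear 10))))

theorem runs_squareProg (l0 l1 l2 l3 : List Bool) (k N a b s t : ℕ) :
    Runs squareProg (prepStore l0 l1 l2 l3 k N 0 0 a b s t)
      (prepStore l0 l1 l2 l3 k (N * N) 0 0 a b s t) (60 * (N + 1) * (N + 1)) := by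
  have h1 : Runs (app 8 6 9) (prepStore l0 l1 l2 l3 k N 0 0 a b s t)
      (prepStore l0 l1 l2 l3 k N N 0 a b s t) (22 * N + 3) := by
    refine ((runs_app (by simp) (by simp) (by simp) rfl).mono ?_).of_eq ?_
    · simp [prepStore, st_apply, unary]
    · simp [prepStore, st_apply, update_st, unary]
  have h2 : ∀ x y, Runs (.loop 9 (.seq (.pop 9) (app 8 6 10)))
      (prepStore l0 l1 l2 l3 k N x y a b s t)
      (prepStore l0 l1 l2 l3 k N 0 (x * N + y) a b s t) (x * (22 * N + 6) + 1) := by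
    intro x
    induction x with
    | zero => exact fun y => ((Runs.loop_nil rfl).mono (by omega)).of_eq (by simp)
    | succ x ih =>
      intro y
      have h3 : Runs (.pop 9) (prepStore l0 l1 l2 l3 k N (x + 1) y a b s t)
          (prepStore l0 l1 l2 l3 k N x y a b s t) 1 := by
        refine (Cmd.Straight.runs_of_eq (by simp [Cmd.Straight]) ?_).mono (by simp [Cmd.cost])
        simp [Cmd.eval, st_apply, update_st, unary, prepStore]
      have h4 : Runs (app 8 6 10) (prepStore l0 l1 l2 l3 k N x y a b s t)
          (prepStore l0 l1 l2 l3 k N x (N + y) a b s t) (22 * N + 3) := by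
        refine ((runs_app (by simp) (by simp) (by simp) rfl).mono ?_).of_eq ?_
        · simp [prepStore, st_apply, unary]
        · simp [prepStore, st_apply, update_st, unary]
      refine ((Runs.loop_cons (by simp [prepStore, st_apply, unary]) (h3.seq h4)
        (ih (N + y))).mono ?_).of_eq ?_
      · have := add_one_mul x (22 * N + 6)
        omega
      · rw [show x * N + (N + y) = (x + 1) * N + y by ring]
  have h3 : Runs (clear 8) (prepStore l0 l1 l2 l3 k N 0 (N * N + 0) a b s t)
      (prepStore l0 l1 l2 l3 k 0 0 (N * N) a b s t) (2 * N + 1) := by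
    refine ((runs_clear 8 _).mono ?_).of_eq ?_
    · simp [prepStore, st_apply, unary]
    · simp [prepStore, update_st, unary]
  have h4 : Runs (app 10 6 8) (prepStore l0 l1 l2 l3 k 0 0 (N * N) a b s t)
      (prepStore l0 l1 l2 l3 k (N * N) 0 (N * N) a b s t) (22 * (N * N) + 3) := by
    refine ((runs_app (by simp) (by simp) (by simp) rfl).mono ?_).of_eq ?_
    · simp [prepStore, st_apply, unary]
    · simp [prepStore, st_apply, update_st, unary]
  have h5 : Runs (clear 10) (prepStore l0 l1 l2 l3 k (N * N) 0 (N * N) a b s t)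
      (prepStore l0 l1 l2 l3 k (N * N) 0 0 a b s t) (2 * (N * N) + 1) := by
    refine ((runs_clear 10 _).mono ?_).of_eq ?_
    · simp [prepStore, st_apply, unary]
    · simp [prepStore, update_st, unary]
  refine (h1.seq ((h2 N 0).seq (h3.seq (h4.seq h5)))).mono ?_
  ring_nf
  omega

/-- Count in register `7` how often the number in register `14` can be halved. -/
def logProg : Cmd :=
  .loop 14 (.seq (.pop 14) (.seq (.loop 14 (.seq (.pop 14) (.seq (.pop 14) (.push 15 true))))
    (.seq (app 15 6 14) (.seq (clear 15) (.push 7 true)))))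

theorem runs_halve (l0 l1 l2 l3 : List Bool) (k N x y a b s t : ℕ) :
    Runs (.loop 14 (.seq (.pop 14) (.seq (.pop 14) (.push 15 true))))
      (prepStore l0 l1 l2 l3 k N x y a b s t)
      (prepStore l0 l1 l2 l3 k N x y a b 0 ((s + 1) / 2 + t)) (6 * s + 1) := by
  induction s using Nat.twoStepInduction generalizing t with
  | zero => exact ((Runs.loop_nil rfl).mono (by omega)).of_eq (by simp)
  | one =>
    refine (Runs.loop_cons (by simp [prepStore, st_apply, unary]) (Cmd.Straight.runs_of_eq
      (s' := prepStore l0 l1 l2 l3 k N x y a b 0 (1 + t)) ?_ ?_)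
      ((Runs.loop_nil rfl).of_eq ?_)).mono ?_
    · simp [Cmd.Straight]
    · simp [Cmd.eval, st_apply, update_st, unary, prepStore, List.replicate_succ, add_comm 1]
    · simp
    · simp [Cmd.cost]
  | more s ih _ =>
    have h := ih (t + 1)
    refine (Runs.loop_cons (by simp [prepStore, st_apply, unary]) (Cmd.Straight.runs_of_eq
      (s' := prepStore l0 l1 l2 l3 k N x y a b s (t + 1)) ?_ ?_) (h.of_eq ?_)).mono ?_
    · simp [Cmd.Straight]
    · simp [Cmd.eval, st_apply, update_st, unary, prepStore, List.replicate_succ]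
    · rw [show (s + 1) / 2 + (t + 1) = (s + 2 + 1) / 2 + t by omega]
    · simp [Cmd.cost]; omega

theorem exists_runs_logProg (s : ℕ) : ∃ k', s < 2 ^ k' ∧ (2 ^ k' ≤ 1 ∨ 2 ^ k' ≤ 2 * s) ∧
    ∀ (l0 l1 l2 l3 : List Bool) (k N x y a b : ℕ),
      Runs logProg (prepStore l0 l1 l2 l3 k N x y a b s 0)
        (prepStore l0 l1 l2 l3 (k' + k) N x y a b 0 0) (60 * (s + 1) * (s + 1)) := by
  induction s using Nat.strong_induction_on with
  | _ s ih =>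
    rcases Nat.eq_zero_or_pos s with rfl | hs
    · refine ⟨0, by simp, by simp, fun l0 l1 l2 l3 k N x y a b => ?_⟩
      exact ((Runs.loop_nil rfl).mono (by omega)).of_eq (by simp)
    · obtain ⟨k', h1, h2, h3⟩ := ih (s / 2) (by omega)
      refine ⟨k' + 1, by rw [pow_succ]; omega, by rw [pow_succ]; omega,
        fun l0 l1 l2 l3 k N x y a b => ?_⟩
      obtain ⟨s, rfl⟩ : ∃ s', s = s' + 1 := ⟨s - 1, by omega⟩
      have h4 : Runs (.pop 14) (prepStore l0 l1 l2 l3 k N x y a b (s + 1) 0)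
          (prepStore l0 l1 l2 l3 k N x y a b s 0) 1 := by
        refine (Cmd.Straight.runs_of_eq (by simp [Cmd.Straight]) ?_).mono (by simp [Cmd.cost])
        simp [Cmd.eval, st_apply, update_st, unary, prepStore]
      have h5 := runs_halve l0 l1 l2 l3 k N x y a b s 0
      rw [add_zero] at h5
      have h6 : Runs (app 15 6 14) (prepStore l0 l1 l2 l3 k N x y a b 0 ((s + 1) / 2))
          (prepStore l0 l1 l2 l3 k N x y a b ((s + 1) / 2) ((s + 1) / 2))
          (22 * ((s + 1) / 2) + 3) := by
        refine ((runs_app (by simp) (by simp) (by simp) rfl).mono ?_).of_eq ?_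
        · simp [prepStore, st_apply, unary]
        · simp [prepStore, st_apply, update_st, unary]
      have h7 : Runs (clear 15)
          (prepStore l0 l1 l2 l3 k N x y a b ((s + 1) / 2) ((s + 1) / 2))
          (prepStore l0 l1 l2 l3 k N x y a b ((s + 1) / 2) 0) (2 * ((s + 1) / 2) + 1) := by
        refine ((runs_clear 15 _).mono ?_).of_eq ?_
        · simp [prepStore, st_apply, unary]
        · simp [prepStore, update_st, unary]
      have h8 : Runs (.push 7 true) (prepStore l0 l1 l2 l3 k N x y a b ((s + 1) / 2) 0)
          (prepStore l0 l1 l2 l3 (k + 1) N x y a b ((s + 1) / 2) 0) 1 := by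
        refine (Cmd.Straight.runs_of_eq (by simp [Cmd.Straight]) ?_).mono (by simp [Cmd.cost])
        simp [Cmd.eval, st_apply, update_st, unary, prepStore, List.replicate_succ]
      refine ((Runs.loop_cons (by simp [prepStore, st_apply, unary])
        (h4.seq (h5.seq (h6.seq (h7.seq h8)))) (h3 l0 l1 l2 l3 (k + 1) N x y a b)).mono ?_).of_eq ?_
      · obtain ⟨q, hq⟩ : ∃ q, (s + 1) / 2 = q := ⟨_, rfl⟩
        rw [hq]
        have : 2 * q ≤ s + 1 := by omega
        nlinarith
      · rw [show k' + (k + 1) = k' + 1 + k by ring]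

/-- Compute `4 (d + K + L)` in register `13`, from the inputs `d`, `K` and `L` in the registers `0`, `1`
and `3`. -/
def sumProg : Cmd :=
  .seq (.seq (app 0 6 12) (.seq (app 1 6 12) (app 3 6 12)))
    (.seq (.seq (app 12 6 13) (app 12 6 13)) (.seq (app 12 6 13) (app 12 6 13)))

theorem runs_sumProg (d K L : ℕ) (l2 : List Bool) :
    Runs sumProg (prepStore (unary d) (unary K) l2 (unary L) 0 0 0 0 0 0 0 0)
      (prepStore (unary d) (unary K) l2 (unary L) 0 0 0 0 (d + K + L) (4 * (d + K + L)) 0 0)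
      (110 * (d + K + L) + 30) := by
  have h1 : Runs (app 0 6 12) (prepStore (unary d) (unary K) l2 (unary L) 0 0 0 0 0 0 0 0)
      (prepStore (unary d) (unary K) l2 (unary L) 0 0 0 0 d 0 0 0) (22 * d + 3) := by
    refine ((runs_app (by simp) (by simp) (by simp) rfl).mono ?_).of_eq ?_
    · simp [prepStore, st_apply, unary]
    · simp [prepStore, st_apply, update_st, unary_append]
  have h2 : Runs (app 1 6 12) (prepStore (unary d) (unary K) l2 (unary L) 0 0 0 0 d 0 0 0)
      (prepStore (unary d) (unary K) l2 (unary L) 0 0 0 0 (K + d) 0 0 0) (22 * K + 3) := by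
    refine ((runs_app (by simp) (by simp) (by simp) rfl).mono ?_).of_eq ?_
    · simp [prepStore, st_apply, unary]
    · simp [prepStore, st_apply, update_st, unary_append]
  have h3 : Runs (app 3 6 12) (prepStore (unary d) (unary K) l2 (unary L) 0 0 0 0 (K + d) 0 0 0)
      (prepStore (unary d) (unary K) l2 (unary L) 0 0 0 0 (d + K + L) 0 0 0) (22 * L + 3) := by
    refine ((runs_app (by simp) (by simp) (by simp) rfl).mono ?_).of_eq ?_
    · simp [prepStore, st_apply, unary]
    · rw [show d + K + L = L + (K + d) by ring]
      simp [prepStore, st_apply, update_st, unary_append]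
  have h4 : ∀ b, Runs (app 12 6 13)
      (prepStore (unary d) (unary K) l2 (unary L) 0 0 0 0 (d + K + L) b 0 0)
      (prepStore (unary d) (unary K) l2 (unary L) 0 0 0 0 (d + K + L) (d + K + L + b) 0 0)
      (22 * (d + K + L) + 3) := by
    intro b
    refine ((runs_app (by simp) (by simp) (by simp) rfl).mono ?_).of_eq ?_
    · simp [prepStore, st_apply, unary]
    · simp [prepStore, st_apply, update_st, unary_append]
  refine (((h1.seq (h2.seq h3)).seq (((h4 _).seq (h4 _)).seq ((h4 _).seq (h4 _)))).mono
    (by omega)).of_eq ?_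
  congr 1
  ring

/-- Preparations of the local learner. -/
def localPrep : Cmd :=
  .seq sumProg (.seq (.seq (app 13 6 14) logProg)
    (.seq (.seq (app 13 6 8) (.seq squareProg (.seq squareProg squareProg)))
      (.seq (.seq (clear 1) (.pop 0)) (.seq halveProg (clear 1)))))

/-- The local learner for masked parities. -/
def localProg : Cmd := .seq localPrep (learnProg voteProg)

theorem exists_runs_localPrep (d K A L : ℕ) (hK : 0 < K) :
    ∃ k, 4 * (d + K + L) < 2 ^ k ∧ 2 ^ k ≤ 2 * (4 * (d + K + L)) ∧
      Runs localPrep (st ([unary d, unary K, unary A, unary L] ++ List.replicate 12 []))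
        (mainStore [] (unary 0) (unary A) (unary L) (dim d) [] k (unary ((4 * (d + K + L)) ^ 8))
          [unary (d + K + L), unary (4 * (d + K + L)), [], []]) (2000 * (4 * (d + K + L)) ^ 8) := by
  obtain ⟨S, hS⟩ : ∃ S, S = 4 * (d + K + L) := ⟨_, rfl⟩
  obtain ⟨k, h1, h2, h3⟩ := exists_runs_logProg S
  rw [← hS]
  refine ⟨k, h1, by omega, ?_⟩
  have r1 := runs_sumProg d K L (unary A)
  rw [← hS] at r1
  have r2 : Runs (app 13 6 14)
      (prepStore (unary d) (unary K) (unary A) (unary L) 0 0 0 0 (d + K + L) S 0 0)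
      (prepStore (unary d) (unary K) (unary A) (unary L) 0 0 0 0 (d + K + L) S S 0)
      (22 * S + 3) := by
    refine ((runs_app (by simp) (by simp) (by simp) rfl).mono ?_).of_eq ?_
    · simp [prepStore, st_apply, unary]
    · simp [prepStore, st_apply, update_st, unary_append]
  have r3 := h3 (unary d) (unary K) (unary A) (unary L) 0 0 0 0 (d + K + L) S
  have r4 : Runs (app 13 6 8)
      (prepStore (unary d) (unary K) (unary A) (unary L) (k + 0) 0 0 0 (d + K + L) S 0 0)
      (prepStore (unary d) (unary K) (unary A) (unary L) k S 0 0 (d + K + L) S 0 0)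
      (22 * S + 3) := by
    refine ((runs_app (by simp) (by simp) (by simp) rfl).mono ?_).of_eq ?_
    · simp [prepStore, st_apply, unary]
    · simp [prepStore, st_apply, update_st, unary_append]
  have r5 : ∀ N, Runs squareProg
      (prepStore (unary d) (unary K) (unary A) (unary L) k N 0 0 (d + K + L) S 0 0)
      (prepStore (unary d) (unary K) (unary A) (unary L) k (N * N) 0 0 (d + K + L) S 0 0)
      (60 * (N + 1) * (N + 1)) := fun N => runs_squareProg _ _ _ _ k N _ _ 0 0
  have r6 : ∀ N, Runs (.seq (clear 1) (.pop 0))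
      (prepStore (unary d) (unary K) (unary A) (unary L) k N 0 0 (d + K + L) S 0 0)
      (prepStore (unary (d - 1)) (unary 0) (unary A) (unary L) k N 0 0 (d + K + L) S 0 0)
      (2 * K + 5) := by
    intro N
    refine (((runs_clear 1 _).seq (Cmd.Straight.runs_of_eq (c := .pop 0) trivial rfl)).mono
      ?_).of_eq ?_
    · simp [prepStore, st_apply, unary, Cmd.cost]
    · simp [prepStore, st_apply, update_st, unary, Cmd.eval]
  have r7 : ∀ N, Runs halveProg
      (prepStore (unary (d - 1)) (unary 0) (unary A) (unary L) k N 0 0 (d + K + L) S 0 0)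
      (mainStore [] (unary (8 * dim d)) (unary A) (unary L) (dim d) [] k (unary N)
        [unary (d + K + L), unary S, [], []]) (30 * d + 1) := fun N =>
    (runs_halveProg (d - 1) 0 0 (unary A) (unary L) [[], [], unary k, unary N, [], [], [],
      unary (d + K + L), unary S, [], []]).mono (by omega)
  have r8 : ∀ N, Runs (clear 1)
      (mainStore [] (unary (8 * dim d)) (unary A) (unary L) (dim d) [] k (unary N)
        [unary (d + K + L), unary S, [], []])
      (mainStore [] (unary 0) (unary A) (unary L) (dim d) [] k (unary N)
        [unary (d + K + L), unary S, [], []]) (16 * dim d + 1) := by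
    intro N
    refine ((runs_clear 1 _).mono ?_).of_eq ?_
    · simp [mainStore, st_apply, unary]; omega
    · simp [mainStore, update_st, unary]
  have hrun := r1.seq ((r2.seq r3).seq ((r4.seq ((r5 _).seq ((r5 _).seq (r5 _)))).seq
    ((r6 _).seq ((r7 _).seq (r8 _)))))
  have e8 : S * S * (S * S) * (S * S * (S * S)) = S ^ 8 := by ring
  rw [e8] at hrun
  refine Runs.mono hrun ?_
  have hdim : 2 * dim d ≤ d := by unfold dim; omega
  have hS4 : 4 ≤ S := by omega
  have p1 : 1 ≤ S := by omega
  have q1 : S ≤ S ^ 8 := Nat.le_self_pow (by norm_num) S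
  have q2 : (S + 1) * (S + 1) ≤ 4 * S ^ 8 := by
    calc (S + 1) * (S + 1) ≤ (2 * S) * (2 * S) := by gcongr <;> omega
      _ = 4 * S ^ 2 := by ring
      _ ≤ 4 * S ^ 8 := Nat.mul_le_mul_left 4 (Nat.pow_le_pow_right p1 (by norm_num))
  have q3 : (S * S + 1) * (S * S + 1) ≤ 4 * S ^ 8 := by
    have : 1 ≤ S * S := Nat.mul_pos p1 p1
    calc (S * S + 1) * (S * S + 1) ≤ (2 * (S * S)) * (2 * (S * S)) := by gcongr <;> omega
      _ = 4 * S ^ 4 := by ring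
      _ ≤ 4 * S ^ 8 := Nat.mul_le_mul_left 4 (Nat.pow_le_pow_right p1 (by norm_num))
  have q4 : (S * S * (S * S) + 1) * (S * S * (S * S) + 1) ≤ 4 * S ^ 8 := by
    have : 1 ≤ S * S * (S * S) := Nat.mul_pos (Nat.mul_pos p1 p1) (Nat.mul_pos p1 p1)
    calc (S * S * (S * S) + 1) * (S * S * (S * S) + 1)
        ≤ (2 * (S * S * (S * S))) * (2 * (S * S * (S * S))) := by gcongr <;> omega
      _ = 4 * S ^ 8 := by ring
  rw [mul_assoc 60 (S + 1), mul_assoc 60 (S * S + 1), mul_assoc 60 (S * S * (S * S) + 1)]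
  omega

/-- The failure probability of the local learner is small. -/
theorem failure_le {d K L k : ℕ} (hd : dim d ≠ 0) (hk : 2 ^ k ≤ 2 * (4 * (d + K + L))) {β : ℝ}
    (hβ : 0 < β) (hL : Real.logb 2 (1 / β) ≤ L) :
    ((dim d : ℝ) + 1) * (1 - advantage d k ^ 2) ^ ((4 * (d + K + L)) ^ 8) ≤ β := by
  obtain ⟨S, hS⟩ : ∃ S, S = 4 * (d + K + L) := ⟨_, rfl⟩
  rw [← hS] at hk ⊢
  have hdim : 2 * dim d ≤ d := by unfold dim; omega
  have hn : (0 : ℝ) < dim d := Nat.cast_pos.2 (Nat.pos_of_ne_zero hd)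
  have hS1 : (8 : ℝ) * dim d ≤ S := by exact_mod_cast (by omega : 8 * dim d ≤ S)
  have hS2 : (dim d : ℝ) + L ≤ S := by exact_mod_cast (by omega : dim d + L ≤ S)
  have hS3 : (1 : ℝ) ≤ S := by exact_mod_cast (by omega : 1 ≤ S)
  have hk' : (2 : ℝ) ^ k ≤ 2 * S := by exact_mod_cast hk
  set γ := advantage d k with hγ
  have hγ0 : 0 ≤ γ := advantage_nonneg d k
  have hγ1 : γ ≤ 1 := advantage_le_one d k
  have hinv : 1 / (S : ℝ) ^ 2 ≤ γ := by
    rw [hγ, advantage, one_div_pow, div_div]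
    refine one_div_le_one_div_of_le (by positivity) ?_
    calc (2 : ℝ) ^ k * (4 * dim d) ≤ 2 * S * (4 * dim d) := by gcongr
      _ = S * (8 * dim d) := by ring
      _ ≤ S * S := by gcongr
      _ = S ^ 2 := by ring
  have h1 : (S : ℝ) ≤ γ ^ 2 * (S : ℝ) ^ 8 := by
    calc (S : ℝ) = S ^ 1 := (pow_one _).symm
      _ ≤ S ^ 4 := pow_le_pow_right₀ hS3 (by norm_num)
      _ = (1 / (S : ℝ) ^ 2) ^ 2 * (S : ℝ) ^ 8 := by field_simp
      _ ≤ γ ^ 2 * (S : ℝ) ^ 8 := by gcongr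
  have h2 : (1 - γ ^ 2) ^ (S ^ 8) ≤ Real.exp (-S) := by
    calc (1 - γ ^ 2) ^ (S ^ 8) ≤ Real.exp (-γ ^ 2) ^ (S ^ 8) := by
          refine pow_le_pow_left₀ (by nlinarith) ?_ _
          linarith [Real.add_one_le_exp (-γ ^ 2)]
      _ = Real.exp (-(γ ^ 2 * (S : ℝ) ^ 8)) := by
          rw [← Real.exp_nat_mul]
          congr 1
          push_cast
          ring
      _ ≤ Real.exp (-S) := Real.exp_le_exp.2 (by linarith)
  have h3 : Real.exp (-L) ≤ β := by
    rw [← Real.le_log_iff_exp_le hβ] at *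
    have h4 : Real.logb 2 (1 / β) = -Real.log β / Real.log 2 := by
      rw [Real.logb, one_div, Real.log_inv]
    rw [h4, div_le_iff₀ (Real.log_pos (by norm_num))] at hL
    have h5 : Real.log 2 ≤ 1 := by linarith [Real.log_two_lt_d9]
    have h6 : (L : ℝ) * Real.log 2 ≤ L * 1 := by gcongr
    linarith
  calc ((dim d : ℝ) + 1) * (1 - γ ^ 2) ^ (S ^ 8)
      ≤ Real.exp (dim d) * Real.exp (-(dim d + L)) := by
        refine mul_le_mul (Real.add_one_le_exp _) (h2.trans (Real.exp_le_exp.2 (by linarith)))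
          (pow_nonneg (by nlinarith) _) (Real.exp_pos _).le
    _ = Real.exp (-L) := by rw [← Real.exp_add]; congr 1; ring
    _ ≤ β := h3

/-- The parameter in terms of which the local learner measures its resources. -/
noncomputable def localParam (d : ℕ) (ε β : ℝ) : ℕ :=
  4 * (d + ⌈1 / ε⌉₊ + ⌈Real.logb 2 (1 / β)⌉₊)

/-- The size of the database of the local learner. -/
noncomputable def localEntries (d : ℕ) (ε _α β : ℝ) : ℕ := (dim d + 1) * localParam d ε β ^ 8

/-- The running time of the local learner. -/
noncomputable def localTime (d : ℕ) (ε _α β : ℝ) : ℕ := 5000 * localParam d ε β ^ 9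

theorem le_localParam {d : ℕ} {ε : ℝ} (hε : 0 < ε) (β : ℝ) : 4 * (d + 1) ≤ localParam d ε β := by
  have : 0 < ⌈1 / ε⌉₊ := Nat.ceil_pos.2 (by positivity)
  unfold localParam
  omega

theorem localParam_le {d : ℕ} {ε α β : ℝ} (hε : 0 < ε) (h : Admissible α β) {x : ℝ}
    (hx : d + 1 / ε + 1 / α + Real.logb 2 (1 / β) ≤ x) : (localParam d ε β : ℝ) ≤ 8 * (1 + x) := by
  obtain ⟨h1, h2⟩ := h.nonneg
  have h3 := (Nat.ceil_lt_add_one (one_div_pos.2 hε).le).le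
  have h4 := (Nat.ceil_lt_add_one h2.le).le
  have hd : (0 : ℝ) ≤ d := Nat.cast_nonneg _
  have h5 := one_div_pos.2 hε
  unfold localParam
  push_cast
  linarith

theorem localTime_le {d : ℕ} {ε α β : ℝ} (hε : 0 < ε) (h : Admissible α β) {x : ℝ}
    (hx : d + 1 / ε + 1 / α + Real.logb 2 (1 / β) ≤ x) :
    (localTime d ε α β : ℝ) ≤ polyBound (5000 * 8 ^ 9) 9 x := by
  unfold localTime polyBound
  push_cast
  calc 5000 * (localParam d ε β : ℝ) ^ 9 ≤ 5000 * (8 * (1 + x)) ^ 9 := by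
        gcongr
        exact localParam_le hε h hx
    _ = _ := by ring

theorem localEntries_le_localTime {d : ℕ} {ε : ℝ} (hε : 0 < ε) (α β : ℝ) :
    localEntries d ε α β ≤ localTime d ε α β := by
  have h1 := le_localParam (d := d) hε β
  have hdim : 2 * dim d ≤ d := by unfold dim; omega
  unfold localEntries localTime
  calc (dim d + 1) * localParam d ε β ^ 8 ≤ localParam d ε β * localParam d ε β ^ 8 := by
        gcongr; omega
    _ = 1 * localParam d ε β ^ 9 := by ring
    _ ≤ 5000 * localParam d ε β ^ 9 := by gcongr; norm_num

/-- What the machine of the local learner does before its output is decoded. -/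
noncomputable def localAlg (d : ℕ) (ε α β : ℝ) :
    Alg (LRQuery (maskedParity.X d × Bool) (localEntries d ε α β)) (List Bool)
      (Option (maskedParity.X d → Bool)) :=
  machineLocal maskedParity localProg randomizerProg evalProg localTime localEntries d ε α β

open Classical in
theorem localAlg_good {d : ℕ} {ε α β : ℝ} (hε : 0 < ε) (hβ : 0 < β)
    (c : maskedParity.X d → Bool) (a : Bool) (r : Fin (dim d) → Bool) :
    Tame ε (localAlg d ε α β) 0 ∧
    (freshRun c (localAlg d ε α β)).toOuterMeasure {o | o ≠ some c} ≤ ENNReal.ofReal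
      (if dim d ≠ 0 ∧ c = (fun x => ip (a :: List.ofFn r) x.1) then β else 1) := by
  have hK : 0 < ⌈1 / ε⌉₊ := Nat.ceil_pos.2 (by positivity)
  obtain ⟨k, h1, h2, h3⟩ := exists_runs_localPrep d ⌈1 / ε⌉₊ ⌈1 / α⌉₊ ⌈Real.logb 2 (1 / β)⌉₊ hK
  have hSK : 4 * ⌈1 / ε⌉₊ ≤ localParam d ε β := by unfold localParam; omega
  have hSd := le_localParam (d := d) hε β
  have hfail : dim d ≠ 0 → _ := fun hd => failure_le hd h2 hβ (Nat.le_ceil _)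
  rw [show 4 * (d + ⌈1 / ε⌉₊ + ⌈Real.logb 2 (1 / β)⌉₊) = localParam d ε β from rfl] at h1 h2 h3 hfail
  have hT9 : localTime d ε α β = 5000 * localParam d ε β ^ 9 := rfl
  have hE : localEntries d ε α β = (dim d + 1) * localParam d ε β ^ 8 := rfl
  set S := localParam d ε β with hS
  have hdim : 2 * dim d ≤ d := by unfold dim; omega
  have hkS : k ≤ 2 * S := (Nat.lt_two_pow_self (n := k)).le.trans h2
  have hk0 : k ≠ 0 := by
    rintro rfl
    simp at h1
    omega
  have hS9 : S ≤ S ^ 9 := Nat.le_self_pow (by norm_num) S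
  have hε' : 4 * (1 / 2) ^ k ≤ ε := by
    have h4 : 4 * (1 / ε) ≤ 2 ^ k := by
      have h5 : (4 * ⌈1 / ε⌉₊ : ℝ) ≤ 2 ^ k := by exact_mod_cast hSK.trans h1.le
      linarith [Nat.le_ceil (1 / ε)]
    rw [one_div_pow, mul_one_div, div_le_iff₀ (by positivity)]
    rw [mul_one_div, div_le_iff₀ hε] at h4
    linarith
  have h4 := lGood_learnProg (c := c) (T₀ := localTime d ε α β) (Ndb := localEntries d ε α β) hk0 hε'
    a r (N := S ^ 8) (by omega) hE (unary ⌈1 / α⌉₊) (unary ⌈Real.logb 2 (1 / β)⌉₊)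
    [unary (d + ⌈1 / ε⌉₊ + ⌈Real.logb 2 (1 / β)⌉₊), unary S, [], []]
  have h5 := (Reach.seq _ _ _ _).lGood ((h3 _).lGood h4)
  have h6 := h5 (localTime d ε α β) (by
    have q1 : S ≤ S ^ 8 := Nat.le_self_pow (by norm_num) S
    have q2 : S * S ^ 8 = S ^ 9 := by ring
    have q3 : 400 * (dim d + 1) * (S ^ 8 + dim d + k + 3) ≤ 400 * S * (5 * S ^ 8) := by
      gcongr <;> omega
    have q4 : 400 * S * (5 * S ^ 8) = 2000 * S ^ 9 := by ring
    have q5 : S ^ 8 ≤ S ^ 9 := Nat.pow_le_pow_right (by omega) (by norm_num)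
    have q6 : 1 ≤ S ^ 9 := Nat.one_le_pow _ _ (by omega)
    rw [hT9]
    omega)
  rw [localAlg, machineLocal, init_eq _ _ 12]
  refine ⟨h6.1, h6.2.trans (ENNReal.ofReal_le_ofReal ?_)⟩
  split_ifs with h7
  · exact hfail h7.1
  · exact le_rfl

/-- The local learner for masked parities. -/
noncomputable def localLearner : LocalFamily maskedParity where
  n := localEntries
  alg d ε α β := (localAlg d ε α β).mapOutput fun o => o.getD fun _ => false

theorem PMF.one_le_toOuterMeasure_add_compl {H : Type} (p : PMF H) (S : Set H) :
    1 ≤ p.toOuterMeasure S + p.toOuterMeasure Sᶜ := by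
  rw [PMF.toOuterMeasure_apply, PMF.toOuterMeasure_apply, ← ENNReal.tsum_add, ← p.tsum_coe]
  refine ENNReal.tsum_le_tsum fun x => ?_
  by_cases h : x ∈ S <;> simp [h]

theorem maskedParity_mem_effInteractiveLocal : maskedParity ∈ EffInteractiveLocal := by
  refine ⟨localLearner, ⟨5000 * 8 ^ 9, 9, ?_⟩,
    localProg, randomizerProg, evalProg, localTime, 5000 * 8 ^ 9, 9, ?_⟩
  · intro d ε α β hε hαβ
    obtain ⟨hα, hβ⟩ := hαβ.nonneg
    refine ⟨?_, ?_, ?_⟩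
    · refine le_trans ?_ (localTime_le hε hαβ le_rfl)
      exact_mod_cast localEntries_le_localTime hε α β
    · exact ((localAlg_good hε hαβ.2.1 (fun _ => false) false fun _ => false).1.localWithin
        fun _ _ => rfl).mapOutput _
    · intro c hc
      refine ⟨?_, ?_⟩
      · refine ((queriesWithin_toLocal _ _ _ _ _ _ _ _).mono (fun _ h => h) ?_).mapOutput _
        refine Nat.le_floor (localTime_le hε hαβ ?_)
        have : (0 : ℝ) ≤ maskedParity.size d c := Nat.cast_nonneg _
        linarith
      · obtain ⟨hd, s, hs, hcs⟩ := maskedParity_mem_concepts.1 hc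
        obtain ⟨a, s, rfl⟩ := List.exists_cons_of_length_eq_add_one hs
        obtain ⟨r, rfl⟩ : ∃ r : Fin (dim d) → Bool, s = List.ofFn r := by
          have h : s.length = dim d := by simpa using hs
          rw [← h]
          exact ⟨s.get, (List.ofFn_get s).symm⟩
        obtain ⟨h1, h2⟩ := localAlg_good (α := α) hε hαβ.2.1 c a r
        rw [if_pos ⟨hd, hcs⟩, ← h1.localOutput_eq] at h2
        have h3 := PMF.one_le_toOuterMeasure_add_compl (localOutput (localAlg d ε α β) c) {some c}
        have h4 : ((PMF.uniformOfFintype (Fin (localLearner.n d ε α β) → maskedParity.X d)).bind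
            fun x => (localLearner.alg d ε α β).runLR fun i => (x i, c (x i)))
            = (localOutput (localAlg d ε α β) c).map fun o => o.getD fun _ => false := by
          rw [localOutput, PMF.map_bind]
          simp only [localLearner, Alg.runLR_mapOutput]
          rfl
        rw [h4, PMF.toOuterMeasure_map_apply, ENNReal.ofReal_sub _ hαβ.2.1.le, ENNReal.ofReal_one,
          tsub_le_iff_right]
        refine h3.trans (add_le_add (MeasureTheory.OuterMeasure.mono _ ?_) h2)
        rintro o rfl
        simpa [err_self] using hαβ.1.1.le
  · intro d ε α β hε hαβ
    refine ⟨fun c hc => localTime_le hε hαβ ?_, fun z => ?_, rfl⟩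
    · have : (0 : ℝ) ≤ maskedParity.size d c := Nat.cast_nonneg _
      linarith
    · exact (localAlg_good hε hαβ.2.1 (fun _ => false) false fun _ => false).1.none_notMem z

end PrivateLearning

theorem mainTheorem9 :
    (PrivateLearning.NonadaptiveSQ ⊂ PrivateLearning.AdaptiveSQ ∧
      PrivateLearning.NoninteractiveLocal ⊂ PrivateLearning.InteractiveLocal) ∧
    (PrivateLearning.EffNonadaptiveSQ ⊂ PrivateLearning.EffAdaptiveSQ ∧
      PrivateLearning.EffNoninteractiveLocal ⊂ PrivateLearning.EffInteractiveLocal) := by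
  have hSQ := PrivateLearning.maskedParity_mem_effAdaptiveSQ
  have hLR := PrivateLearning.maskedParity_mem_effInteractiveLocal
  have hSQ' := PrivateLearning.maskedParity_not_mem_nonadaptiveSQ
  have hLR' := PrivateLearning.maskedParity_not_mem_noninteractiveLocal
  refine ⟨⟨⟨?_, ?_⟩, ?_, ?_⟩, ⟨?_, ?_⟩, ?_, ?_⟩
  · exact fun C ⟨A, h, _⟩ => ⟨A, h⟩
  · obtain ⟨A, h, _⟩ := hSQ
    exact fun h' => hSQ' (h' ⟨A, h⟩)
  · exact fun C ⟨A, h, _⟩ => ⟨A, h⟩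
  · obtain ⟨A, h, _⟩ := hLR
    exact fun h' => hLR' (h' ⟨A, h⟩)
  · exact fun C ⟨A, h, _, h'⟩ => ⟨A, h, h'⟩
  · intro h'
    obtain ⟨A, h, hna, _⟩ := h' hSQ
    exact hSQ' ⟨A, h, hna⟩
  · exact fun C ⟨A, h, _, h'⟩ => ⟨A, h, h'⟩
  · intro h'
    obtain ⟨A, h, hna, _⟩ := h' hLR
    exact hLR' ⟨A, h, hna⟩
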